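/- Let $X\subseteq\mathbb R^d$ be closed and convex, $g:X\to\mathbb R$ convex and lower semicontinuous (possibly non-smooth), $h:\operatorname{dom}(h)\to\mathbb R$ convex with $\operatorname{dom}(h)\subseteq\mathbb R^m$ closed and $\|y\|\le D$ for all $y\in\operatorname{dom}(h)$, and let $\ell:X\to\mathbb R^m$ have convex components and be differentiable with Jacobian $\nabla\ell$, where $\|\nabla\ell(x)\|\le G_\ell$ and $\|\nabla\ell(x)-\nabla\ell(x')\|\le L_\ell\|x-x'\|$ for $x,x'\in X$. Assume that either (DC case) $\operatorname{dom}(h)\subseteq\mathbb R^m_+$ or (bi-convex case) $\operatorname{dom}(h)\subseteq\mathbb R^m_-$. Put $$f(x,y)=g(x)+h(y)-\langle y,\ell(x)\rangle,\qquad F(x)=\min_{y\in\operatorname{dom}(h)}f(x,y)\quad(x\in X),$$ and let $\partial$ denote the limiting (Fréchet) subdifferential, where functions are extended by $+\infty$ outside their domain ($X$ for $g$ and $F$, $\operatorname{dom}(h)$ for $h$). Assume that the conjugate $h^*(s)=\sup_{y\in\operatorname{dom}(h)}\langle y,s\rangle-h(y)$ is differentiable with $\|\nabla h^*(s)-\nabla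 h^*(s')\|\le L_{h^*}\|s-s'\|^v$ for all $s,s'$, where $v\in(0,1]$, and that $f(x,y)-f(x',y')\le M$ for all $x,x'\in X$, $y,y'\in\operatorname{dom}(h)$. Stochastic oracles $\partial g(x;\xi_g)$, $\ell(x;\xi_\ell)$, $\nabla\ell(x;\xi_\ell)$, $\partial h(y;\xi_h)$ are available that are unbiased, i.e. $\mathrm E[\partial g(x;\xi_g)]\in\partial g(x)$, $\mathrm E[\ell(x;\xi_\ell)]=\ell(x)$, $\mathrm E[\nabla\ell(x;\xi_\ell)]=\nabla\ell(x)$, $\mathrm E[\partial h(y;\xi_h)]\in\partial h(y)$, and for which $\mathrm E\|\partial g(x;\xi_g)\|^2$, $\mathrm E\|\ell(x;\xi_\ell)-\ell(x)\|^2$, $\mathrm E\|\nabla\ell(x;\xi_\ell)-\nabla\ell(x)\|^2$ and $\mathrm E\|\partial h(y;\xi_h)\|^2$ are at most $\sigma^2$ for all $x\in X$, $y\in\operatorname{dom}(h)$. For a closed convex set $S$, a convex objective with stochastic gradient $G(z;\xi)$, $z_1\in S$, $T\ge1$ and $\gamma>0$, the method SPG iterates $$z_{t+1}=\arg\min_{z\in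 S}\ \langle G(z_t;\xi_t),z\rangle+\tfrac\gamma2\|z-z_1\|^2+\tfrac1{2\eta_t}\|z-z_t\|^2,\qquad \eta_t=\tfrac4{\gamma t},\quad t=1,\dots,T,$$ and returns $\hat z_T=\big(\sum_{t=1}^Tt\,z_t\big)/\sum_{t=1}^Tt$. Fix $\gamma,\mu>0$ and $\alpha\ge1$. The method St-SPG starts from $x_1\in X$, $y_1\in\operatorname{dom}(h)$. In stage $k=1,2,\dots$ it obtains $x_{k+1}$ by $T^x_k=\lceil k/\gamma\rceil+1$ iterations of SPG on $X$ from $x_k$ with parameter $\gamma$ for the objective $$f^k_x(x)=g(x)-\langle y_k,\ell(x_k)+\nabla\ell(x_k)(x-x_k)\rangle\ \text{(DC)}\quad\text{or}\quad f^k_x(x)=g(x)-\langle y_k,\ell(x)\rangle\ \text{(bi-convex)},$$ with stochastic gradient $\partial g(x;\xi_g)-\nabla\ell(x_k;\xi_\ell)^\top y_k$, respectively $\partial g(x;\xi_g)-\nabla\ell(x;\xi_\ell)^\top y_k$. Then it obtains $y_{k+1}$ by $T^y_k=\lceil k/\mu\rceil+1$ iterations of SPG on $\operatorname{dom}(h)$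 from $y_k$ with parameter $\mu$ for $f^k_y(y)=h(y)-\langle y,\ell(x_{k+1})\rangle$ with stochastic gradient $\partial h(y;\xi_h)-\ell(x_{k+1};\xi'_\ell)$. All random draws are independent. Let $v_k=\arg\min_{x\in X}f^k_x(x)+\frac\gamma2\|x-x_k\|^2$. Then there are constants $c,C>0$, depending only on $\gamma,\mu,\alpha,v,L_{h^*},G_\ell,L_\ell,D,\sigma,M$, such that the following holds for every $\epsilon\in(0,1]$ and every integer $K\ge c\,\epsilon^{-2/v}$. If $\mathrm E\|\ell(x_{k+1};\xi_\ell)\|^2\le D^2$ for $k=1,\dots,K$ (with $\xi_\ell$ independent of $x_{k+1}$), and $\tau$ is sampled independently of the draws with $P(\tau=k)=k^\alpha/\sum_{s=1}^Ks^\alpha$, $k=1,\dots,K$, then $$\mathrm E[\operatorname{dist}(0,\partial F(v_\tau))]\le\epsilon\qquad\text{and}\qquad \mathrm E\|x_\tau-v_\tau\|\le C\,\epsilon^{1/v}.$$ If moreover $K\le c\,\epsilon^{-2/v}+1$, so that the number of stages is $K=O(\epsilon^{-2/v})$, then the total iteration complexity satisfies $\sum_{k=1}^K(T^x_k+T^y_k)\le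 C\,\epsilon^{-4/v}$. -/

import Mathlib

open MeasureTheory ProbabilityTheory Filter Topology
open scoped ENNReal InnerProductSpace

noncomputable section

/-- `ℝⁿ` with the Euclidean norm. -/
abbrev Vec (n : ℕ) : Type := EuclideanSpace ℝ (Fin n)

/-- Fréchet subgradients at `x` of the function equal to `φ` on `S` and to `+∞` off `S`:
`liminf_{x' → x, x' ≠ x} (φ x' - φ x - ⟪s, x' - x⟫) / ‖x' - x‖ ≥ 0`. -/
def frechetSubdiff {n : ℕ} (S : Set (Vec n)) (φ : Vec n → ℝ) (x : Vec n) : Set (Vec n) :=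
  {s | x ∈ S ∧ ∀ δ : ℝ, 0 < δ →
    ∀ᶠ x' in 𝓝[S] x, -(δ * ‖x' - x‖) ≤ φ x' - φ x - ⟪s, x' - x⟫_ℝ}

/-- Limiting (Fréchet) subdifferential `∂φ(x)` of the function equal to `φ` on `S` and to `+∞`
off `S`. -/
def limitingSubdiff {n : ℕ} (S : Set (Vec n)) (φ : Vec n → ℝ) (x : Vec n) : Set (Vec n) :=
  {s | x ∈ S ∧ ∃ (xs ss : ℕ → Vec n),
    Tendsto xs atTop (𝓝 x) ∧ Tendsto (fun j => φ (xs j)) atTop (𝓝 (φ x)) ∧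
    (∀ j, ss j ∈ frechetSubdiff S φ (xs j)) ∧ Tendsto ss atTop (𝓝 s)}

/-- A minimizer of `φ` over `S` (a junk point if there is none). -/
def argminOn {n : ℕ} (S : Set (Vec n)) (φ : Vec n → ℝ) : Vec n :=
  Classical.epsilon fun z => z ∈ S ∧ IsMinOn φ S z

/-- The convex conjugate `s ↦ sup_{y ∈ S} ⟪y, s⟫ - φ y` of the function `φ` with domain `S`. -/
def conjOn {n : ℕ} (S : Set (Vec n)) (φ : Vec n → ℝ) (s : Vec n) : ℝ :=
  ⨆ y : S, (⟪(y : Vec n), s⟫_ℝ - φ y)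

/-- Data of the problem `min_{x ∈ X} g x + min_{y ∈ dom h} (h y - ⟪y, ℓ x⟫)`. The values of `g`,
`ℓ`, `J` off `X` and of `h` off `domh` play no role. -/
structure InfProjection (d m : ℕ) where
  /-- the feasible set -/
  X : Set (Vec d)
  /-- the first component of the objective -/
  g : Vec d → ℝ
  /-- the domain of `h` -/
  domh : Set (Vec m)
  /-- the function `h` -/
  h : Vec m → ℝ
  /-- the inner mapping `ℓ` -/
  ℓ : Vec d → Vec m
  /-- the Jacobian of `ℓ` -/
  J : Vec d → (Vec d →L[ℝ] Vec m)

namespace InfProjection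

variable {d m : ℕ}

/-- `f(x, y) = g(x) + h(y) - ⟪y, ℓ(x)⟫`. -/
def f (p : InfProjection d m) (x : Vec d) (y : Vec m) : ℝ :=
  p.g x + p.h y - ⟪y, p.ℓ x⟫_ℝ

/-- The objective `F(x) = g(x) + min_{y ∈ dom h} (h(y) - ⟪y, ℓ(x)⟫)`. -/
def F (p : InfProjection d m) (x : Vec d) : ℝ :=
  p.g x + ⨅ y : p.domh, (p.h y - ⟪(y : Vec m), p.ℓ x⟫_ℝ)

end InfProjection

/-- Stochastic first-order information: `∂g(x; ξ_g)`, `ℓ(x; ξ_ℓ)`, `∇ℓ(x; ξ_ℓ)`, `∂h(y; ξ_h)`. -/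
structure Oracles (d m : ℕ) (Ξg Ξl Ξh : Type*) where
  /-- stochastic subgradient of `g` -/
  dg : Vec d → Ξg → Vec d
  /-- stochastic version of `ℓ` -/
  val : Vec d → Ξl → Vec m
  /-- stochastic version of the Jacobian of `ℓ` -/
  jac : Vec d → Ξl → (Vec d →L[ℝ] Vec m)
  /-- stochastic subgradient of `h` -/
  dh : Vec m → Ξh → Vec m

/-- The two cases in which `h*` is monotone: `dom h ⊆ ℝᵐ₊` (difference of convex functions) and
`dom h ⊆ ℝᵐ₋` (bi-convex functions). -/
inductive Regime
  | dc
  | biconvex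

/-- The sign condition on `dom h` that belongs to each case. -/
def Regime.SignCondition {m : ℕ} : Regime → Set (Vec m) → Prop
  | .dc, Y => ∀ y ∈ Y, ∀ i, 0 ≤ y i
  | .biconvex, Y => ∀ y ∈ Y, ∀ i, y i ≤ 0

/-- The assumptions on the deterministic data: `X` closed convex, `g` lower semicontinuous and
convex, `h` convex with closed domain, bounded by `D` and in the orthant that belongs to the case;
`ℓ` convex, differentiable with Jacobian `J`, `Gl`-Lipschitz and `Ll`-smooth; `h*` with
`(Lh, v)`-Hölder continuous gradient; oscillation of `f` at most `M`. -/
structure InfProjection.Regular {d m : ℕ} (p : InfProjection d m) (r : Regime)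
    (Gl Ll Lh v D M : ℝ) : Prop where
  isClosed_X : IsClosed p.X
  convex_X : Convex ℝ p.X
  lsc_g : LowerSemicontinuousOn p.g p.X
  convex_g : ConvexOn ℝ p.X p.g
  isClosed_domh : IsClosed p.domh
  convex_h : ConvexOn ℝ p.domh p.h
  norm_le_of_mem_domh : ∀ y ∈ p.domh, ‖y‖ ≤ D
  sign_domh : r.SignCondition p.domh
  convex_l : ∀ i, ConvexOn ℝ p.X fun x => p.ℓ x i
  hasFDeriv_l : ∀ x ∈ p.X, HasFDerivWithinAt p.ℓ (p.J x) p.X x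
  lipschitz_l : ∀ x ∈ p.X, ‖p.J x‖ ≤ Gl
  smooth_l : ∀ x ∈ p.X, ∀ x' ∈ p.X, ‖p.J x - p.J x'‖ ≤ Ll * ‖x - x'‖
  differentiable_conj : Differentiable ℝ (conjOn p.domh p.h)
  holder_conj : ∀ s s', ‖gradient (conjOn p.domh p.h) s - gradient (conjOn p.domh p.h) s'‖
    ≤ Lh * ‖s - s'‖ ^ v
  osc_f : ∀ x ∈ p.X, ∀ x' ∈ p.X, ∀ y ∈ p.domh, ∀ y' ∈ p.domh, p.f x y - p.f x' y' ≤ M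

/-- The assumptions on the oracles: measurability, unbiasedness, and the moment bounds. -/
structure Oracles.Regular {d m : ℕ} {Ξg Ξl Ξh : Type*} [MeasurableSpace Ξg] [MeasurableSpace Ξl]
    [MeasurableSpace Ξh] (o : Oracles d m Ξg Ξl Ξh) (p : InfProjection d m)
    (Pg : Measure Ξg) (Pl : Measure Ξl) (Ph : Measure Ξh) (σ : ℝ) : Prop where
  measurable_dg : Measurable (Function.uncurry o.dg)
  measurable_val : Measurable (Function.uncurry o.val)
  measurable_jac : Measurable (Function.uncurry o.jac)
  measurable_dh : Measurable (Function.uncurry o.dh)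
  mean_dg : ∀ x ∈ p.X, ∫ ξ, o.dg x ξ ∂Pg ∈ limitingSubdiff p.X p.g x
  mean_val : ∀ x ∈ p.X, ∫ ξ, o.val x ξ ∂Pl = p.ℓ x
  mean_jac : ∀ x ∈ p.X, ∫ ξ, o.jac x ξ ∂Pl = p.J x
  mean_dh : ∀ y ∈ p.domh, ∫ ξ, o.dh y ξ ∂Ph ∈ limitingSubdiff p.domh p.h y
  moment_dg : ∀ x ∈ p.X, ∫⁻ ξ, ‖o.dg x ξ‖ₑ ^ 2 ∂Pg ≤ ENNReal.ofReal (σ ^ 2)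
  variance_val : ∀ x ∈ p.X, ∫⁻ ξ, ‖o.val x ξ - p.ℓ x‖ₑ ^ 2 ∂Pl ≤ ENNReal.ofReal (σ ^ 2)
  variance_jac : ∀ x ∈ p.X, ∫⁻ ξ, ‖o.jac x ξ - p.J x‖ₑ ^ 2 ∂Pl ≤ ENNReal.ofReal (σ ^ 2)
  moment_dh : ∀ y ∈ p.domh, ∫⁻ ξ, ‖o.dh y ξ‖ₑ ^ 2 ∂Ph ≤ ENNReal.ofReal (σ ^ 2)

/-- Iterates `z₁, z₂, …` of SPG over the set `S`, with regularizer `γ/2 ‖z - z₁‖²`, step sizes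
`η_t = 4 / (γ t)`, and stochastic gradient `G t z` of the objective at `z` drawn in iteration `t`.
(The value at index `0` is not used.) -/
def spgIter {n : ℕ} (S : Set (Vec n)) (γ : ℝ) (G : ℕ → Vec n → Vec n) (z₁ : Vec n) : ℕ → Vec n
  | 0 => z₁
  | t + 1 =>
    if t = 0 then z₁
    else argminOn S fun z =>
      ⟪G t (spgIter S γ G z₁ t), z⟫_ℝ + γ / 2 * ‖z - z₁‖ ^ 2
        + 1 / (2 * (4 / (γ * t))) * ‖z - spgIter S γ G z₁ t‖ ^ 2

/-- Output `(∑_{t ≤ T} t z_t) / (∑_{t ≤ T} t)` of SPG run for `T` iterations. -/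
def spg {n : ℕ} (S : Set (Vec n)) (γ : ℝ) (G : ℕ → Vec n → Vec n) (z₁ : Vec n) (T : ℕ) : Vec n :=
  (∑ t ∈ Finset.Icc 1 T, (t : ℝ))⁻¹ • ∑ t ∈ Finset.Icc 1 T, (t : ℝ) • spgIter S γ G z₁ t

/-- Number of SPG iterations in stage `k` on a subproblem with regularization parameter `γ`:
`k/γ + 1`, rounded up to an integer. -/
def stageLength (γ : ℝ) (k : ℕ) : ℕ := ⌈(k : ℝ) / γ⌉₊ + 1

/-- The random data drawn in one iteration index: `(ξ_g, ξ_ℓ)` for the `x`-subproblem and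
`(ξ_h, ξ'_ℓ)` for the `y`-subproblem. -/
abbrev Draw (Ξg Ξl Ξh : Type*) : Type _ := (Ξg × Ξl) × (Ξh × Ξl)

section StSPG

variable {d m : ℕ} {Ξg Ξl Ξh : Type*}

/-- Objective `f_x^k` of the `x`-subproblem of a stage that starts from `(xk, yk)`. -/
def objX (r : Regime) (p : InfProjection d m) (xk : Vec d) (yk : Vec m) (x : Vec d) : ℝ :=
  match r with
  | .dc => p.g x - ⟪yk, p.ℓ xk + p.J xk (x - xk)⟫_ℝ
  | .biconvex => p.g x - ⟪yk, p.ℓ x⟫_ℝ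

/-- Stochastic gradient of `f_x^k` at `x`. -/
def gradX (r : Regime) (o : Oracles d m Ξg Ξl Ξh) (xk : Vec d) (yk : Vec m)
    (ξ : Ξg × Ξl) (x : Vec d) : Vec d :=
  match r with
  | .dc => o.dg x ξ.1 - (o.jac xk ξ.2).adjoint yk
  | .biconvex => o.dg x ξ.1 - (o.jac x ξ.2).adjoint yk

/-- Stochastic gradient at `y` of `f_y^k(y) = h(y) - ⟪y, ℓ(xk')⟫`, where `xk'` is the new `x`. -/
def gradY (o : Oracles d m Ξg Ξl Ξh) (xk' : Vec d) (ξ : Ξh × Ξl) (y : Vec m) : Vec m :=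
  o.dh y ξ.1 - o.val xk' ξ.2

/-- The iterates `(x_k, y_k)`, `k ≥ 1`, of St-SPG along the draws `ξ (k, t)`, where `k` is the stage
and `t` the SPG iteration. (The value at index `0` is not used.) -/
def stSPG (r : Regime) (p : InfProjection d m) (o : Oracles d m Ξg Ξl Ξh) (γ μ : ℝ)
    (x₁ : Vec d) (y₁ : Vec m) (ξ : ℕ × ℕ → Draw Ξg Ξl Ξh) : ℕ → Vec d × Vec m
  | 0 => (x₁, y₁)
  | k + 1 =>
    if k = 0 then (x₁, y₁)
    else
      let xk := (stSPG r p o γ μ x₁ y₁ ξ k).1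
      let yk := (stSPG r p o γ μ x₁ y₁ ξ k).2
      let xk' := spg p.X γ (fun t => gradX r o xk yk (ξ (k, t)).1) xk (stageLength γ k)
      let yk' := spg p.domh μ (fun t => gradY o xk' (ξ (k, t)).2) yk (stageLength μ k)
      (xk', yk')

/-- The exact solution `v_k = argmin_{x ∈ X} f_x^k(x) + γ/2 ‖x - x_k‖²` of the `x`-subproblem of the
stage that starts from `(xk, yk)`. -/
def exactX (r : Regime) (p : InfProjection d m) (γ : ℝ) (xk : Vec d) (yk : Vec m) : Vec d :=
  argminOn p.X fun x => objX r p xk yk x + γ / 2 * ‖x - xk‖ ^ 2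

end StSPG

end

/-! ### Functions with uniformly bounded subgradients. -/

noncomputable section

/-! Each stage is an inexact alternating proximal step on `f(x, y)`. In the DC case `y ≥ 0` makes
the linearized model of the `x`-step a majorant of `f(·, y_k)` touching it at `x_k`. In the
bi-convex case the model is `f(·, y_k)` itself up to a constant, and `y ≤ 0` makes it convex. About
`k/γ` SPG iterations solve the regularized, hence strongly convex, model up to an expected error
`O(1/k)` (`StochSubgrad.spg_progress`), and likewise for `y`. Let `v_k`, `w_k` be the exact
solutions of the two subproblems. Then `E f(x_{k+1}, y_{k+1}) + e_k ≤ E f(x_k, y_k) + q/k`, where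
`e_k` is a weighted sum of `E‖x_k - v_k‖²`, `E‖y_k - w_k‖²` and `E‖x_{k+1} - v_k‖²`
(`x_update_progress`, `y_update_progress`). Summation by parts with weights `k^α`, the bound on the
oscillation of `f`, and `∑ k^α ≥ K^(α+1)/(α+1)` bound the expected `stageGap` at the random stage by
`Q/K` (`lintegral_stageGap_random_le`).

Stationarity is then a pathwise matter. Since `F = g - h* ∘ ℓ` with `h*` differentiable, optimality
of `v_k` gives a Fréchet subgradient of `F` at `v_k` of norm at most `(γ + D Ll)‖x_k - v_k‖ + Gl
‖y_k - ∇h*(ℓ(v_k))‖`. The last distance is controlled because `w_k = ∇h*(ℓ(x_{k+1}) - μ (w_k -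
y_k))` and `∇h*` is Hölder (`infEDist_limitingSubdiff_le`). So the distance to stationarity is of
order `gap^(1/2) + gap^(v/2)`, and a gap of size `ε^(2/v)` suffices. In place of Jensen's inequality
for these concave powers, the pointwise bound `s^q ≤ l^q (1 + s/l)` is integrated with `l ≥ E s`.

On the probabilistic side, a stage is analysed from a frozen starting state and then averaged over
that state by independence. After shifting `f` to be nonnegative the averages are taken in `ℝ≥0∞`,
so no integrability has to be carried from stage to stage. -/

/-- At each point of `S` the function `φ` has a subgradient relative to `S` of norm at most `L`. -/
def BoundedSubgrad {n : ℕ} (S : Set (Vec n)) (φ : Vec n → ℝ) (L : ℝ) : Prop :=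
  ∀ z ∈ S, ∃ s : Vec n, ‖s‖ ≤ L ∧ ∀ u ∈ S, φ z + ⟪s, u - z⟫_ℝ ≤ φ u

namespace BoundedSubgrad

variable {n : ℕ} {S : Set (Vec n)} {φ : Vec n → ℝ} {L : ℝ}

lemma sub_le (h : BoundedSubgrad S φ L) {z u : Vec n} (hz : z ∈ S) (hu : u ∈ S) :
    φ z - φ u ≤ L * ‖z - u‖ := by
  obtain ⟨s, hs, hsub⟩ := h z hz
  have h1 := hsub u hu
  have h2 : -⟪s, u - z⟫_ℝ ≤ ‖s‖ * ‖u - z‖ := by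
    have := abs_real_inner_le_norm s (u - z)
    exact (neg_le_abs _).trans this
  have h3 : ‖s‖ * ‖u - z‖ ≤ L * ‖z - u‖ := by
    rw [norm_sub_rev u z]
    gcongr
  linarith

lemma abs_sub_le (h : BoundedSubgrad S φ L) {z u : Vec n} (hz : z ∈ S) (hu : u ∈ S) :
    |φ z - φ u| ≤ L * ‖z - u‖ := by
  rw [abs_le]
  have h1 := h.sub_le hz hu
  have h2 := h.sub_le hu hz
  rw [norm_sub_rev] at h2
  constructor <;> linarith

lemma continuousOn (h : BoundedSubgrad S φ L) : ContinuousOn φ S := by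
  have hL : LipschitzOnWith (Real.toNNReal L) φ S := by
    refine LipschitzOnWith.of_dist_le_mul fun x hx y hy => ?_
    rw [Real.dist_eq, dist_eq_norm]
    refine (h.abs_sub_le hx hy).trans ?_
    gcongr
    exact Real.le_coe_toNNReal L
  exact hL.continuousOn

/-- Average the supporting affine function at the intermediate point over the two end points. Thus a
stochastic subgradient oracle already implies convexity of its objective. -/
lemma convexOn (h : BoundedSubgrad S φ L) (hS : Convex ℝ S) : ConvexOn ℝ S φ := by
  refine ⟨hS, fun x hx y hy a b ha hb hab => ?_⟩
  obtain ⟨s, -, hs⟩ := h _ (hS hx hy ha hb hab)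
  have h1 := hs x hx
  have h2 := hs y hy
  have h3 : a * ⟪s, x - (a • x + b • y)⟫_ℝ + b * ⟪s, y - (a • x + b • y)⟫_ℝ = 0 := by
    rw [← real_inner_smul_right, ← real_inner_smul_right, ← inner_add_right]
    have : a • (x - (a • x + b • y)) + b • (y - (a • x + b • y)) = 0 := by
      have : b = 1 - a := by linarith
      subst this
      module
    rw [this, inner_zero_right]
  simp only [smul_eq_mul]
  generalize φ (a • x + b • y) = w at *
  have h4 := mul_le_mul_of_nonneg_left h1 ha
  have h5 := mul_le_mul_of_nonneg_left h2 hb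
  have : w = a * w + b * w := by rw [← add_mul, hab, one_mul]
  nlinarith

lemma affine (S : Set (Vec n)) (a : Vec n) (b : ℝ) :
    BoundedSubgrad S (fun z => ⟪a, z⟫_ℝ + b) ‖a‖ := fun z _ =>
  ⟨a, le_rfl, fun u _ => by rw [inner_sub_right]; linarith⟩

end BoundedSubgrad

/-- `u` minimizes `φ + κ/2 ‖· - c‖²` over `S`. -/
def IsProx {n : ℕ} (S : Set (Vec n)) (φ : Vec n → ℝ) (κ : ℝ) (c u : Vec n) : Prop :=
  u ∈ S ∧ ∀ z ∈ S, φ u + κ / 2 * ‖u - c‖ ^ 2 ≤ φ z + κ / 2 * ‖z - c‖ ^ 2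

/-! ### Proximal points: existence, strong convexity, stability. -/

section Prox

variable {n : ℕ} {S : Set (Vec n)} {φ : Vec n → ℝ} {L κ : ℝ} {c u : Vec n}

lemma norm_combo_sq (a b : Vec n) (t : ℝ) :
    ‖(1 - t) • a + t • b‖ ^ 2 = (1 - t) * ‖a‖ ^ 2 + t * ‖b‖ ^ 2 - t * (1 - t) * ‖a - b‖ ^ 2 := by
  rw [@norm_add_sq_real, @norm_sub_sq_real, norm_smul, norm_smul, real_inner_smul_left,
    real_inner_smul_right, mul_pow, mul_pow, Real.norm_eq_abs, Real.norm_eq_abs, sq_abs, sq_abs]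
  ring

lemma BoundedSubgrad.exists_isProx (h : BoundedSubgrad S φ L) (hS : IsClosed S)
    (hne : S.Nonempty) (hκ : 0 < κ) (c : Vec n) : ∃ u, IsProx S φ κ c u := by
  obtain ⟨z₀, hz₀⟩ := hne
  have hcont : ContinuousOn (fun z => φ z + κ / 2 * ‖z - c‖ ^ 2) S :=
    h.continuousOn.add (by fun_prop)
  -- Coercivity: at distance `ρ` from `z₀` the quadratic gains at least `κ ρ²/2 - κ ρ ‖z₀ - c‖`,
  -- while `φ` loses at most `|L| ρ`. The threshold below is where the gain takes over.
  have hbig : ∀ᶠ z in cocompact (Vec n) ⊓ 𝓟 S,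
      φ z₀ + κ / 2 * ‖z₀ - c‖ ^ 2 ≤ φ z + κ / 2 * ‖z - c‖ ^ 2 := by
    rw [eventually_inf_principal]
    have ht : Tendsto (fun z : Vec n => ‖z‖) (cocompact (Vec n)) atTop := tendsto_norm_cocompact_atTop
    filter_upwards [ht.eventually_ge_atTop (‖z₀‖ + 2 * (|L| + κ * ‖z₀ - c‖) / κ)] with z hz hzS
    have h1 := h.sub_le hz₀ hzS
    have hr : 2 * (|L| + κ * ‖z₀ - c‖) / κ ≤ ‖z - z₀‖ := by
      have := norm_sub_norm_le z z₀
      linarith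
    rw [div_le_iff₀ hκ] at hr
    have h2 : L * ‖z₀ - z‖ ≤ |L| * ‖z - z₀‖ := by
      rw [norm_sub_rev]
      gcongr
      exact le_abs_self L
    have h3 : ‖z - c‖ ^ 2 = ‖z - z₀‖ ^ 2 + 2 * ⟪z - z₀, z₀ - c⟫_ℝ + ‖z₀ - c‖ ^ 2 := by
      rw [← norm_add_sq_real]
      congr 2
      abel
    have h4 : -(‖z - z₀‖ * ‖z₀ - c‖) ≤ ⟪z - z₀, z₀ - c⟫_ℝ :=
      (abs_le.1 (abs_real_inner_le_norm _ _)).1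
    rw [h3]
    have h5 := mul_le_mul_of_nonneg_left h4 hκ.le
    have h6 := mul_le_mul_of_nonneg_right hr (norm_nonneg (z - z₀))
    nlinarith
  obtain ⟨u, hu, hmin⟩ := hcont.exists_isMinOn' hS hz₀ hbig
  exact ⟨u, hu, fun z hz => hmin hz⟩

/-- Compare `u` with `(1 - t) u + t z`, divide by `t` and let `t → 0`; the missing curvature of `φ`
is supplied by the quadratic. -/
lemma IsProx.strong (hu : IsProx S φ κ c u) (hφ : ConvexOn ℝ S φ) {z : Vec n} (hz : z ∈ S) :
    φ u + κ / 2 * ‖u - c‖ ^ 2 + κ / 2 * ‖z - u‖ ^ 2 ≤ φ z + κ / 2 * ‖z - c‖ ^ 2 := by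
  have key : ∀ t : ℝ, 0 < t → t ≤ 1 →
      φ u + κ / 2 * ‖u - c‖ ^ 2 + (1 - t) * (κ / 2 * ‖z - u‖ ^ 2) ≤
        φ z + κ / 2 * ‖z - c‖ ^ 2 := by
    intro t ht ht1
    have hmem : (1 - t) • u + t • z ∈ S :=
      hφ.1 hu.1 hz (sub_nonneg.2 ht1) ht.le (sub_add_cancel 1 t)
    have h1 := hu.2 _ hmem
    have h2 := hφ.2 hu.1 hz (sub_nonneg.2 ht1) ht.le (sub_add_cancel 1 t)
    have h3 : (1 - t) • u + t • z - c = (1 - t) • (u - c) + t • (z - c) := by module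
    rw [h3, norm_combo_sq, show u - c - (z - c) = -(z - u) by abel, norm_neg] at h1
    simp only [smul_eq_mul] at h2
    have : t * (φ u + κ / 2 * ‖u - c‖ ^ 2 + (1 - t) * (κ / 2 * ‖z - u‖ ^ 2)) ≤
        t * (φ z + κ / 2 * ‖z - c‖ ^ 2) := by nlinarith
    exact le_of_mul_le_mul_left this ht
  have hlim : Tendsto (fun t : ℝ => φ u + κ / 2 * ‖u - c‖ ^ 2 +
      (1 - t) * (κ / 2 * ‖z - u‖ ^ 2)) (𝓝[>] 0)
      (𝓝 (φ u + κ / 2 * ‖u - c‖ ^ 2 + (1 - 0) * (κ / 2 * ‖z - u‖ ^ 2))) := by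
    refine Tendsto.mono_left ?_ nhdsWithin_le_nhds
    exact (Continuous.tendsto (by fun_prop) 0)
  have := le_of_tendsto hlim (b := φ z + κ / 2 * ‖z - c‖ ^ 2) (by
    filter_upwards [Ioc_mem_nhdsGT (zero_lt_one' ℝ)] with t ht using key t ht.1 ht.2)
  simpa using this

/-- Add the two strong convexity inequalities, each tested at the other minimizer, and divide by `‖u
- u'‖`. The second alternative is the case where this division is impossible, `δ` being of arbitrary
sign. -/
lemma IsProx.stability {φ' : Vec n → ℝ} {c' u' : Vec n} {δ : ℝ} (hκ : 0 < κ)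
    (hu : IsProx S φ κ c u) (hu' : IsProx S φ' κ c' u')
    (hφ : ConvexOn ℝ S φ) (hφ' : ConvexOn ℝ S φ')
    (hδ : ∀ a ∈ S, ∀ b ∈ S, (φ a - φ' a) - (φ b - φ' b) ≤ δ * ‖a - b‖) :
    κ * ‖u - u'‖ ≤ δ + κ * ‖c - c'‖ ∨ u = u' := by
  by_cases heq : u = u'
  · exact Or.inr heq
  left
  have hpos : 0 < ‖u - u'‖ := norm_pos_iff.2 (sub_ne_zero.2 heq)
  have h1 := hu.strong hφ hu'.1
  have h2 := hu'.strong hφ' hu.1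
  have h3 := hδ u' hu'.1 u hu.1
  rw [norm_sub_rev u' u] at h1 h3
  have h4 : ‖u' - c‖ ^ 2 - ‖u' - c'‖ ^ 2 - (‖u - c‖ ^ 2 - ‖u - c'‖ ^ 2) =
      2 * ⟪u - u', c - c'⟫_ℝ := by
    simp only [@norm_sub_sq_real, inner_sub_left, inner_sub_right]
    ring
  have h5 : ⟪u - u', c - c'⟫_ℝ ≤ ‖u - u'‖ * ‖c - c'‖ := real_inner_le_norm _ _
  have h6 := mul_le_mul_of_nonneg_left h5 hκ.le
  have h7 : ‖u - u'‖ * (κ * ‖u - u'‖) ≤ ‖u - u'‖ * (δ + κ * ‖c - c'‖) := by nlinarith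
  exact le_of_mul_le_mul_left h7 hpos

lemma IsProx.norm_sub_le {φ' : Vec n → ℝ} {c' u' : Vec n} {δ : ℝ} (hκ : 0 < κ) (hδ0 : 0 ≤ δ)
    (hu : IsProx S φ κ c u) (hu' : IsProx S φ' κ c' u')
    (hφ : ConvexOn ℝ S φ) (hφ' : ConvexOn ℝ S φ')
    (hδ : ∀ a ∈ S, ∀ b ∈ S, (φ a - φ' a) - (φ b - φ' b) ≤ δ * ‖a - b‖) :
    ‖u - u'‖ ≤ κ⁻¹ * δ + ‖c - c'‖ := by
  rcases hu.stability hκ hu' hφ hφ' hδ with h | h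
  · have := mul_le_mul_of_nonneg_left h (inv_nonneg.2 hκ.le)
    rwa [mul_add, ← mul_assoc, ← mul_assoc, inv_mul_cancel₀ hκ.ne', one_mul, one_mul] at this
  · rw [h, sub_self, norm_zero]
    positivity

/-- Proximal points stay close to the center. -/
lemma IsProx.norm_sub_center_le (hL : BoundedSubgrad S φ L) (hS : Convex ℝ S)
    (hu : IsProx S φ κ c u) (hc : c ∈ S) : κ * ‖u - c‖ ^ 2 ≤ L * ‖u - c‖ ∧ κ * ‖u - c‖ ≤ |L| := by
  have h1 := hu.strong (hL.convexOn hS) hc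
  have h2 := hL.sub_le hc hu.1
  rw [sub_self, norm_zero, norm_sub_rev c u] at h1
  rw [norm_sub_rev c u] at h2
  have h3 : κ * ‖u - c‖ ^ 2 ≤ L * ‖u - c‖ := by nlinarith
  refine ⟨h3, ?_⟩
  rcases (norm_nonneg (u - c)).eq_or_lt with h | h
  · rw [← h, mul_zero]; positivity
  · have : κ * ‖u - c‖ ≤ L := by
      rw [pow_two, ← mul_assoc] at h3
      exact le_of_mul_le_mul_right h3 h
    exact this.trans (le_abs_self L)

lemma argminOn_isProx (h : ∃ u, IsProx S φ κ c u) :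
    IsProx S φ κ c (argminOn S fun z => φ z + κ / 2 * ‖z - c‖ ^ 2) := by
  obtain ⟨u, hu⟩ := h
  have : ∃ z, z ∈ S ∧ IsMinOn (fun z => φ z + κ / 2 * ‖z - c‖ ^ 2) S z :=
    ⟨u, hu.1, fun z hz => hu.2 z hz⟩
  have h2 := Classical.epsilon_spec this
  exact ⟨h2.1, fun z hz => h2.2 hz⟩

end Prox

/-! ### Fréchet and limiting subgradients. -/

section Subdifferential

variable {n : ℕ} {S : Set (Vec n)} {φ : Vec n → ℝ} {x s : Vec n}

/-- Local becomes global by convexity: apply the Fréchet inequality at `x + t (u - x)` for one small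
`t`, divide by `t`, then let `δ → 0`. -/
lemma subgradient_of_mem_frechetSubdiff (hφ : ConvexOn ℝ S φ) (hs : s ∈ frechetSubdiff S φ x)
    {u : Vec n} (hu : u ∈ S) : φ x + ⟪s, u - x⟫_ℝ ≤ φ u := by
  obtain ⟨hx, hs⟩ := hs
  have key : ∀ δ : ℝ, 0 < δ → -(δ * ‖u - x‖) ≤ φ u - φ x - ⟪s, u - x⟫_ℝ := by
    intro δ hδ
    have hmem : ∀ t ∈ Set.Ioc (0 : ℝ) 1, x + t • (u - x) ∈ S := fun t ht => by
      have := hφ.1 hx hu (sub_nonneg.2 ht.2) ht.1.le (sub_add_cancel 1 t)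
      convert this using 1
      module
    have htend : Tendsto (fun t : ℝ => x + t • (u - x)) (𝓝[>] 0) (𝓝[S] x) := by
      refine tendsto_nhdsWithin_iff.2 ⟨?_, ?_⟩
      · refine Tendsto.mono_left ?_ nhdsWithin_le_nhds
        have : Continuous fun t : ℝ => x + t • (u - x) := by fun_prop
        simpa using this.tendsto 0
      · filter_upwards [Ioc_mem_nhdsGT (zero_lt_one' ℝ)] with t ht using hmem t ht
    have h1 := htend.eventually (hs δ hδ)
    obtain ⟨t, ht1, ht⟩ := (h1.and (Ioc_mem_nhdsGT (zero_lt_one' ℝ))).exists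
    have h2 := hφ.2 hx hu (sub_nonneg.2 ht.2) ht.1.le (sub_add_cancel 1 t)
    rw [show (1 - t) • x + t • u = x + t • (u - x) by module] at h2
    rw [add_sub_cancel_left, norm_smul, real_inner_smul_right, Real.norm_eq_abs,
      abs_of_pos ht.1] at ht1
    simp only [smul_eq_mul] at h2
    refine le_of_mul_le_mul_left ?_ ht.1
    nlinarith
  have hlim : Tendsto (fun δ : ℝ => -(δ * ‖u - x‖)) (𝓝[>] 0) (𝓝 (-(0 * ‖u - x‖))) := by
    refine Tendsto.mono_left ?_ nhdsWithin_le_nhds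
    exact (Continuous.tendsto (by fun_prop) 0)
  have := le_of_tendsto hlim (b := φ u - φ x - ⟪s, u - x⟫_ℝ) (by
    filter_upwards [self_mem_nhdsWithin] with δ hδ using key δ hδ)
  linarith

lemma subgradient_of_mem_limitingSubdiff (hφ : ConvexOn ℝ S φ) (hs : s ∈ limitingSubdiff S φ x)
    {u : Vec n} (hu : u ∈ S) : φ x + ⟪s, u - x⟫_ℝ ≤ φ u := by
  obtain ⟨-, xs, ss, hxs, hφs, hss, hlim⟩ := hs
  have h1 : Tendsto (fun j => φ (xs j) + ⟪ss j, u - xs j⟫_ℝ) atTop (𝓝 (φ x + ⟪s, u - x⟫_ℝ)) :=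
    hφs.add (hlim.inner (tendsto_const_nhds.sub hxs))
  exact le_of_tendsto h1 (Eventually.of_forall fun j =>
    subgradient_of_mem_frechetSubdiff hφ (hss j) hu)

lemma frechetSubdiff_subset_limitingSubdiff : frechetSubdiff S φ x ⊆ limitingSubdiff S φ x :=
  fun s hs => ⟨hs.1, fun _ => x, fun _ => s, tendsto_const_nhds, tendsto_const_nhds,
    fun _ => hs, tendsto_const_nhds⟩

/-- If the increments of `φ` dominate those of a function `ψ` differentiable at `x`, the gradient of
`ψ` is a Fréchet subgradient of `φ`. This is how a nonconvex `F` acquires subgradients. -/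
lemma mem_frechetSubdiff_of_hasFDerivWithinAt (hx : x ∈ S)
    {ψ : Vec n → ℝ} {A : Vec n →L[ℝ] ℝ} (hψ : HasFDerivWithinAt ψ A S x)
    (hle : ∀ u ∈ S, ψ u - ψ x ≤ φ u - φ x) (hs : ∀ u, A u = ⟪s, u⟫_ℝ) :
    s ∈ frechetSubdiff S φ x := by
  refine ⟨hx, fun δ hδ => ?_⟩
  have h1 := (hasFDerivWithinAt_iff_isLittleO.1 hψ).def hδ
  filter_upwards [h1, self_mem_nhdsWithin] with u hu huS
  have h2 := (abs_le.1 hu).1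
  have h3 := hle u huS
  rw [hs] at h2
  linarith

lemma ConvexOn.tangent_le {A : Vec n →L[ℝ] ℝ} (hφ : ConvexOn ℝ S φ) (hx : x ∈ S)
    (hd : HasFDerivWithinAt φ A S x) {u : Vec n} (hu : u ∈ S) : φ x + A (u - x) ≤ φ u := by
  have h := mem_frechetSubdiff_of_hasFDerivWithinAt (s := (InnerProductSpace.toDual ℝ _).symm A)
    hx hd (fun _ _ => le_rfl) (fun u => by simp)
  simpa using subgradient_of_mem_frechetSubdiff hφ h hu

end Subdifferential

/-! ### Second moments. -/

section MomentBounds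

variable {Ω E : Type*} [MeasurableSpace Ω] {P : Measure Ω} [NormedAddCommGroup E]
  {f : Ω → E} {B : ℝ}

lemma memLp_two_of_lintegral_le (hf : AEStronglyMeasurable f P)
    (h : ∫⁻ ω, ‖f ω‖ₑ ^ 2 ∂P ≤ ENNReal.ofReal B) : MemLp f 2 P := by
  refine ⟨hf, ?_⟩
  rw [eLpNorm_lt_top_iff_lintegral_rpow_enorm_lt_top (by norm_num) (by norm_num)]
  refine lt_of_le_of_lt ?_ (h.trans_lt ENNReal.ofReal_lt_top)
  simp

lemma integral_sq_norm_le (hB : 0 ≤ B) (hf : AEStronglyMeasurable f P)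
    (h : ∫⁻ ω, ‖f ω‖ₑ ^ 2 ∂P ≤ ENNReal.ofReal B) : ∫ ω, ‖f ω‖ ^ 2 ∂P ≤ B := by
  rw [integral_eq_lintegral_of_nonneg_ae (Eventually.of_forall fun _ => by positivity)
    (by fun_prop)]
  refine ENNReal.toReal_le_of_le_ofReal hB ?_
  refine le_trans (le_of_eq ?_) h
  refine lintegral_congr fun ω => ?_
  rw [ENNReal.ofReal_pow (norm_nonneg _), ofReal_norm]

lemma norm_integral_le_sqrt [NormedSpace ℝ E] [CompleteSpace E] [IsProbabilityMeasure P]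
    (hB : 0 ≤ B) (hf : AEStronglyMeasurable f P)
    (h : ∫⁻ ω, ‖f ω‖ₑ ^ 2 ∂P ≤ ENNReal.ofReal B) : ‖∫ ω, f ω ∂P‖ ≤ √B := by
  have hL := memLp_two_of_lintegral_le hf h
  have h1 : ∫ ω, ‖f ω‖ ∂P ≤ √(∫ ω, ‖f ω‖ ^ 2 ∂P) := by
    refine Real.le_sqrt_of_sq_le ?_
    have hi : Integrable (fun ω => ‖f ω‖) P := (hL.integrable one_le_two).norm
    have hi2 : Integrable (fun ω => ‖f ω‖ ^ 2) P := hL.norm.integrable_sq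
    set a := ∫ ω, ‖f ω‖ ∂P
    have h2 : 0 ≤ ∫ ω, (‖f ω‖ - a) ^ 2 ∂P := integral_nonneg fun _ => sq_nonneg _
    have h3 : ∫ ω, (‖f ω‖ - a) ^ 2 ∂P = ∫ ω, ‖f ω‖ ^ 2 ∂P - 2 * a * a + a ^ 2 := by
      have : ∀ ω, (‖f ω‖ - a) ^ 2 = ‖f ω‖ ^ 2 - 2 * a * ‖f ω‖ + a ^ 2 := fun ω => by ring
      simp_rw [this]
      have hi3 : Integrable (fun ω => 2 * a * ‖f ω‖) P := hi.const_mul _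
      have hi4 : Integrable (fun ω => ‖f ω‖ ^ 2 - 2 * a * ‖f ω‖) P := hi2.sub hi3
      rw [integral_add hi4 (integrable_const _), integral_sub hi2 hi3, integral_const_mul]
      simp [a]
    nlinarith
  exact (norm_integral_le_integral_norm _).trans
    (h1.trans (Real.sqrt_le_sqrt (integral_sq_norm_le hB hf h)))

end MomentBounds

/-! ### Independence of disjoint blocks and Fubini. -/

section Independence

variable {Ω : Type*} {mΩ : MeasurableSpace Ω} {P : Measure Ω}

lemma ProbabilityTheory.iIndepFun.indepFun_of_measurable_iSup {ι : Type*} {β : ι → Type*}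
    {mβ : ∀ i, MeasurableSpace (β i)} {f : ∀ i, Ω → β i} (hf : iIndepFun f P)
    (hm : ∀ i, Measurable (f i)) {s t : Set ι} (hst : Disjoint s t)
    {α α' : Type*} {mα : MeasurableSpace α} {mα' : MeasurableSpace α'} {A : Ω → α} {A' : Ω → α'}
    (hA : Measurable[⨆ i ∈ s, (mβ i).comap (f i)] A)
    (hA' : Measurable[⨆ i ∈ t, (mβ i).comap (f i)] A') : IndepFun A A' P := by
  rw [IndepFun_iff_Indep]
  have h := indep_iSup_of_disjoint (fun i => (hm i).comap_le) hf.iIndep hst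
  exact indep_of_indep_of_le_right (indep_of_indep_of_le_left h hA.comap_le) hA'.comap_le

lemma measurable_iSup_comap {ι : Type*} {β : ι → Type*} {mβ : ∀ i, MeasurableSpace (β i)}
    (f : ∀ i, Ω → β i) {s : Set ι} {i : ι} (hi : i ∈ s) :
    Measurable[⨆ i ∈ s, (mβ i).comap (f i)] (f i) :=
  measurable_iff_comap_le.2 (le_iSup₂_of_le i hi le_rfl)

lemma iSup_comap_mono {ι : Type*} {β : ι → Type*} {mβ : ∀ i, MeasurableSpace (β i)}
    (f : ∀ i, Ω → β i) {s t : Set ι} (hst : s ⊆ t) :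
    (⨆ i ∈ s, (mβ i).comap (f i)) ≤ ⨆ i ∈ t, (mβ i).comap (f i) :=
  biSup_mono hst

lemma ProbabilityTheory.IndepFun.lintegral_eq [IsProbabilityMeasure P] {α β : Type*}
    {mα : MeasurableSpace α}
    {mβ : MeasurableSpace β} {A : Ω → α} {Z : Ω → β} (h : IndepFun A Z P) (hA : Measurable A)
    (hZ : Measurable Z) {H : α → β → ℝ≥0∞} (hH : Measurable (Function.uncurry H)) :
    ∫⁻ ω, H (A ω) (Z ω) ∂P = ∫⁻ ω, ∫⁻ z, H (A ω) z ∂(P.map Z) ∂P := by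
  have hmap := (indepFun_iff_map_prod_eq_prod_map_map hA.aemeasurable hZ.aemeasurable).1 h
  have := Measure.isProbabilityMeasure_map (μ := P) hZ.aemeasurable
  have h1 : ∫⁻ ω, H (A ω) (Z ω) ∂P
      = ∫⁻ q, Function.uncurry H q ∂(P.map fun ω => (A ω, Z ω)) := by
    rw [lintegral_map hH (hA.prodMk hZ)]
    rfl
  rw [h1, hmap, lintegral_prod _ hH.aemeasurable, lintegral_map (hH.lintegral_prod_right') hA]
  rfl

lemma ProbabilityTheory.IndepFun.integral_eq [IsProbabilityMeasure P] {α β : Type*}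
    {mα : MeasurableSpace α} {mβ : MeasurableSpace β} {A : Ω → α} {Z : Ω → β}
    (h : IndepFun A Z P) (hA : Measurable A)
    (hZ : Measurable Z) {H : α → β → ℝ} (hH : Measurable (Function.uncurry H))
    (hint : Integrable (fun ω => H (A ω) (Z ω)) P) :
    Integrable (fun ω => ∫ z, H (A ω) z ∂(P.map Z)) P ∧
      ∫ ω, H (A ω) (Z ω) ∂P = ∫ ω, ∫ z, H (A ω) z ∂(P.map Z) ∂P := by
  have hmap := (indepFun_iff_map_prod_eq_prod_map_map hA.aemeasurable hZ.aemeasurable).1 h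
  have := Measure.isProbabilityMeasure_map (μ := P) hZ.aemeasurable
  have hint' : Integrable (Function.uncurry H) ((P.map A).prod (P.map Z)) := by
    rw [← hmap, integrable_map_measure hH.aestronglyMeasurable (hA.prodMk hZ).aemeasurable]
    exact hint
  have hl := hint'.integral_prod_left
  refine ⟨(integrable_map_measure hl.aestronglyMeasurable hA.aemeasurable).1 hl, ?_⟩
  have h1 : ∫ ω, H (A ω) (Z ω) ∂P
      = ∫ q, Function.uncurry H q ∂(P.map fun ω => (A ω, Z ω)) := by
    rw [integral_map (hA.prodMk hZ).aemeasurable hH.aestronglyMeasurable]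
    rfl
  rw [h1, hmap, integral_prod _ hint', integral_map hA.aemeasurable hl.aestronglyMeasurable]
  rfl

end Independence

lemma ContinuousOn.measurable_comp_of_mem {Ω α β : Type*} [MeasurableSpace Ω] [TopologicalSpace α]
    [MeasurableSpace α] [OpensMeasurableSpace α] [TopologicalSpace β] [MeasurableSpace β]
    [BorelSpace β] {F : α → β} {S : Set α} (hF : ContinuousOn F S) {A : Ω → α}
    (hA : Measurable A) (hAS : ∀ ω, A ω ∈ S) : Measurable fun ω => F (A ω) :=
  (continuousOn_iff_continuous_domRestrict.1 hF).measurable.comp (hA.subtype_mk (h := hAS))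

/-! ### SPG along a fixed sequence of stochastic gradients. -/

section SPGStep

variable {n : ℕ} {S : Set (Vec n)} {γ : ℝ}

/-- The minimizer of `⟪a, z⟫ + κ/2 ‖z - c‖²` over `S`, as a function of `(a, c)`. -/
def linProx (S : Set (Vec n)) (κ : ℝ) (q : Vec n × Vec n) : Vec n :=
  -- The `+ 0` matches the affine form in `BoundedSubgrad.affine`.
  argminOn S fun z => (⟪q.1, z⟫_ℝ + 0) + κ / 2 * ‖z - q.2‖ ^ 2

lemma linProx_isProx (hS : IsClosed S) (hne : S.Nonempty) {κ : ℝ} (hκ : 0 < κ)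
    (q : Vec n × Vec n) : IsProx S (fun z => ⟪q.1, z⟫_ℝ + 0) κ q.2 (linProx S κ q) :=
  argminOn_isProx ((BoundedSubgrad.affine S q.1 0).exists_isProx hS hne hκ q.2)

lemma continuous_linProx (hS : IsClosed S) (hS' : Convex ℝ S) (hne : S.Nonempty) {κ : ℝ}
    (hκ : 0 < κ) : Continuous (linProx S κ) := by
  refine LipschitzWith.continuous (K := Real.toNNReal (κ⁻¹ + 1)) ?_
  refine LipschitzWith.of_dist_le_mul fun q q' => ?_
  have h := (linProx_isProx hS hne hκ q).norm_sub_le hκ (norm_nonneg (q.1 - q'.1))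
    (linProx_isProx hS hne hκ q')
    ((BoundedSubgrad.affine S q.1 0).convexOn hS') ((BoundedSubgrad.affine S q'.1 0).convexOn hS')
    (fun a _ b _ => by
      have := real_inner_le_norm (q.1 - q'.1) (a - b)
      simp only [inner_sub_left, inner_sub_right] at this ⊢
      linarith)
  rw [dist_eq_norm, dist_eq_norm, Real.coe_toNNReal _ (by positivity), add_mul, one_mul]
  refine h.trans ?_
  gcongr
  · exact norm_fst_le (q - q')
  · exact norm_snd_le (q - q')

lemma spgIter_one (G : ℕ → Vec n → Vec n) (z₁ : Vec n) : spgIter S γ G z₁ 1 = z₁ := by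
  simp [spgIter]

/-- The linear part of the objective that defines the next SPG iterate. -/
def spgSlope (γ : ℝ) (G : ℕ → Vec n → Vec n) (z₁ : Vec n) (t : ℕ) (z : Vec n) : Vec n :=
  G t z + (γ * t / 4) • (z₁ - z)

/-- Completing the square merges the two quadratic terms of an SPG step into a single one of weight
`γ + γ t / 4` centred at the fixed point `z₁`; the shift of the centre goes into the slope and the
constant `b`. -/
lemma spgIter_succ_isProx (hS : IsClosed S) (hne : S.Nonempty) (hγ : 0 < γ)
    (G : ℕ → Vec n → Vec n) (z₁ : Vec n) {t : ℕ} (ht : t ≠ 0) : ∃ b : ℝ,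
    IsProx S (fun z => ⟪spgSlope γ G z₁ t (spgIter S γ G z₁ t), z⟫_ℝ + b) (γ + γ * t / 4) z₁
      (spgIter S γ G z₁ (t + 1)) := by
  set zt := spgIter S γ G z₁ t with hzt
  refine ⟨γ * t / 8 * (‖zt‖ ^ 2 - ‖z₁‖ ^ 2), ?_⟩
  have hκ : 0 < γ + γ * t / 4 := by positivity
  have h := argminOn_isProx ((BoundedSubgrad.affine S (spgSlope γ G z₁ t zt)
    (γ * t / 8 * (‖zt‖ ^ 2 - ‖z₁‖ ^ 2))).exists_isProx hS hne hκ z₁)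
  convert h using 1
  rw [spgIter, if_neg ht, ← hzt]
  congr 1
  funext z
  have ht' : (t : ℝ) ≠ 0 := Nat.cast_ne_zero.2 ht
  have h1 : 1 / (2 * (4 / (γ * t))) = γ * t / 8 := by field_simp; norm_num
  rw [h1, spgSlope, inner_add_left, real_inner_smul_left, inner_sub_left]
  simp only [@norm_sub_sq_real, real_inner_comm z]
  ring

/-- Stability with `δ = 0` is uniqueness. It replaces the chosen minimizer by a continuous function
of slope and centre, from which measurability follows. -/
lemma spgIter_succ_eq (hS : IsClosed S) (hS' : Convex ℝ S) (hne : S.Nonempty) (hγ : 0 < γ)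
    (G : ℕ → Vec n → Vec n) (z₁ : Vec n) {t : ℕ} (ht : t ≠ 0) :
    spgIter S γ G z₁ (t + 1) =
      linProx S (γ + γ * t / 4) (spgSlope γ G z₁ t (spgIter S γ G z₁ t), z₁) := by
  obtain ⟨b, hb⟩ := spgIter_succ_isProx hS hne hγ G z₁ ht
  have hκ : 0 < γ + γ * t / 4 := by positivity
  have h := hb.norm_sub_le hκ le_rfl (linProx_isProx hS hne hκ
    (spgSlope γ G z₁ t (spgIter S γ G z₁ t), z₁))
    ((BoundedSubgrad.affine S _ _).convexOn hS') ((BoundedSubgrad.affine S _ _).convexOn hS')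
    (fun a _ b _ => by simp)
  simp only [mul_zero, sub_self, norm_zero, add_zero] at h
  exact sub_eq_zero.1 (norm_le_zero_iff.1 h)

lemma spgIter_mem (hS : IsClosed S) (hγ : 0 < γ) (G : ℕ → Vec n → Vec n) {z₁ : Vec n}
    (hz₁ : z₁ ∈ S) (t : ℕ) : spgIter S γ G z₁ t ∈ S := by
  rcases t with _ | t
  · simpa [spgIter]
  · by_cases ht : t = 0
    · subst ht; simpa [spgIter]
    · obtain ⟨b, hb⟩ := spgIter_succ_isProx hS ⟨z₁, hz₁⟩ hγ G z₁ ht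
      exact hb.1

lemma spg_weight_sum {T : ℕ} : ∑ t ∈ Finset.Icc 1 T, (t : ℝ) = T * (T + 1) / 2 := by
  induction T with
  | zero => simp
  | succ T ih => rw [Finset.sum_Icc_succ_top (by omega), ih]; push_cast; ring

lemma spg_eq_sum (S : Set (Vec n)) (γ : ℝ) (G : ℕ → Vec n → Vec n) (z₁ : Vec n) (T : ℕ) :
    spg S γ G z₁ T = ∑ t ∈ Finset.Icc 1 T, ((t : ℝ) / (T * (T + 1) / 2)) • spgIter S γ G z₁ t := by
  rw [spg, spg_weight_sum, Finset.smul_sum]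
  refine Finset.sum_congr rfl fun t _ => ?_
  rw [smul_smul]
  congr 1
  ring

lemma spg_weight_normalized {T : ℕ} (hT : T ≠ 0) :
    ∑ t ∈ Finset.Icc 1 T, ((t : ℝ) / (T * (T + 1) / 2)) = 1 := by
  rw [← Finset.sum_div, spg_weight_sum, div_self]
  have : (T : ℝ) ≠ 0 := Nat.cast_ne_zero.2 hT
  positivity

lemma spg_mem (hS : IsClosed S) (hS' : Convex ℝ S) (hγ : 0 < γ) (G : ℕ → Vec n → Vec n)
    {z₁ : Vec n} (hz₁ : z₁ ∈ S) {T : ℕ} (hT : T ≠ 0) : spg S γ G z₁ T ∈ S := by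
  rw [spg_eq_sum]
  exact hS'.sum_mem (fun t _ => by positivity) (spg_weight_normalized hT)
    (fun t _ => spgIter_mem hS hγ G hz₁ t)

/-- Only the gradients with index `s < t` are used, so iterate `t` will be independent of draw `t`.
-/
lemma measurable_spgIter {Ω : Type*} {mΩ : MeasurableSpace Ω} (hS : IsClosed S)
    (hS' : Convex ℝ S) (hne : S.Nonempty) (hγ : 0 < γ) {H : ℕ → Ω → Vec n → Vec n}
    {z₁ : Ω → Vec n} (hz₁ : Measurable z₁) {t : ℕ}
    (hH : ∀ s < t, Measurable (Function.uncurry (H s))) :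
    Measurable fun ω => spgIter S γ (fun s => H s ω) (z₁ ω) t := by
  induction t with
  | zero => simpa [spgIter]
  | succ t ih =>
    by_cases ht : t = 0
    · subst ht; simpa [spgIter]
    · simp_rw [spgIter_succ_eq hS hS' hne hγ _ _ ht]
      have hz := ih fun s hs => hH s (by omega)
      have h1 : Measurable fun ω => H t ω (spgIter S γ (fun s => H s ω) (z₁ ω) t) :=
        (hH t (by omega)).comp (measurable_id.prodMk hz)
      refine (continuous_linProx hS hS' hne (by positivity)).measurable.comp
        (Measurable.prodMk ?_ hz₁)
      exact h1.add ((hz₁.sub hz).const_smul (γ * t / 4))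

lemma measurable_spg {Ω : Type*} {mΩ : MeasurableSpace Ω} (hS : IsClosed S)
    (hS' : Convex ℝ S) (hne : S.Nonempty) (hγ : 0 < γ) {H : ℕ → Ω → Vec n → Vec n}
    {z₁ : Ω → Vec n} (hz₁ : Measurable z₁) {T : ℕ}
    (hH : ∀ s, Measurable (Function.uncurry (H s))) :
    Measurable fun ω => spg S γ (fun s => H s ω) (z₁ ω) T := by
  simp_rw [spg_eq_sum]
  exact Finset.measurable_fun_sum _ fun t _ =>
    (measurable_spgIter hS hS' hne hγ hz₁ fun s _ => hH s).const_smul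
      ((t : ℝ) / (T * (T + 1) / 2))

/-- One step of SPG, compared with an arbitrary point `u` of `S`. -/
lemma spgIter_step (hS : IsClosed S) (hS' : Convex ℝ S) (hγ : 0 < γ) (G : ℕ → Vec n → Vec n)
    (z₁ : Vec n) {t : ℕ} (ht : t ≠ 0) {u : Vec n} (hu : u ∈ S) :
    ⟪G t (spgIter S γ G z₁ t), spgIter S γ G z₁ t - u⟫_ℝ
        + γ / 2 * ‖spgIter S γ G z₁ (t + 1) - z₁‖ ^ 2 ≤
      γ / 2 * ‖u - z₁‖ ^ 2 + γ * t / 8 * ‖spgIter S γ G z₁ t - u‖ ^ 2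
        - (γ * t / 8 + γ / 2) * ‖spgIter S γ G z₁ (t + 1) - u‖ ^ 2
        + 2 / (γ * t) * ‖G t (spgIter S γ G z₁ t)‖ ^ 2 := by
  obtain ⟨b, hb⟩ := spgIter_succ_isProx hS ⟨u, hu⟩ hγ G z₁ ht
  have h := hb.strong ((BoundedSubgrad.affine S _ _).convexOn hS') hu
  set zt := spgIter S γ G z₁ t
  set w := spgIter S γ G z₁ (t + 1)
  set g := G t zt
  have htpos : (0 : ℝ) < t := by positivity
  have he : 0 < γ * t / 4 := by positivity
  -- Young's inequality, balanced by the step size `4 / (γ t)`, is obtained by expanding this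
  -- square.
  have h1 : 0 ≤ ‖g - (γ * t / 4) • (zt - w)‖ ^ 2 := by positivity
  rw [@norm_sub_sq_real, norm_smul, mul_pow, Real.norm_of_nonneg he.le,
    real_inner_smul_right] at h1
  have h2 : ⟪g, zt - w⟫_ℝ ≤ 2 / (γ * t) * ‖g‖ ^ 2 + γ * t / 8 * ‖zt - w‖ ^ 2 := by
    have h3 := mul_le_mul_of_nonneg_left h1 (show 0 ≤ 2 / (γ * t) by positivity)
    have h4 : 2 / (γ * t) * (‖g‖ ^ 2 - 2 * (γ * t / 4 * ⟪g, zt - w⟫_ℝ)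
        + (γ * t / 4) ^ 2 * ‖zt - w‖ ^ 2) =
        2 / (γ * t) * ‖g‖ ^ 2 - ⟪g, zt - w⟫_ℝ + γ * t / 8 * ‖zt - w‖ ^ 2 := by
      field_simp
      ring
    linarith
  rw [spgSlope] at h
  simp only [inner_add_left, real_inner_smul_left, inner_sub_left] at h
  simp only [inner_sub_right] at h2 ⊢
  simp only [@norm_sub_sq_real] at h h2 ⊢
  rw [real_inner_comm w z₁, real_inner_comm u z₁, real_inner_comm w u] at h
  nlinarith

/-- With `e = γ t / 4` the prox inequality gives `(γ + e)‖z_{t+1} - z₁‖ ≤ ‖G‖ + e ‖z_t - z₁‖`.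
Reading the right side as a combination with weights `γ`, `e` and using convexity of the square
keeps the recursion stable even when `S` is unbounded. -/
lemma spgIter_norm_sub_sq_le (hS : IsClosed S) (hS' : Convex ℝ S) (hγ : 0 < γ)
    (G : ℕ → Vec n → Vec n) {z₁ : Vec n} (hz₁ : z₁ ∈ S) {t : ℕ} (ht : t ≠ 0) :
    (γ + γ * t / 4) * ‖spgIter S γ G z₁ (t + 1) - z₁‖ ^ 2 ≤
      γ * t / 4 * ‖spgIter S γ G z₁ t - z₁‖ ^ 2 + ‖G t (spgIter S γ G z₁ t)‖ ^ 2 / γ := by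
  obtain ⟨b, hb⟩ := spgIter_succ_isProx hS ⟨z₁, hz₁⟩ hγ G z₁ ht
  have h := (hb.norm_sub_center_le (BoundedSubgrad.affine S _ _) hS' hz₁).2
  set zt := spgIter S γ G z₁ t
  set w := spgIter S γ G z₁ (t + 1)
  have he : 0 ≤ γ * t / 4 := by positivity
  rw [abs_of_nonneg (norm_nonneg _), spgSlope] at h
  have h1 : ‖G t zt + (γ * t / 4) • (z₁ - zt)‖ ≤ ‖G t zt‖ + γ * t / 4 * ‖zt - z₁‖ := by
    refine (norm_add_le _ _).trans ?_
    rw [norm_smul, Real.norm_of_nonneg he, norm_sub_rev]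
  have h2 := h.trans h1
  set e := γ * t / 4
  set a := ‖zt - z₁‖
  set q := ‖G t zt‖
  have h3 : ((γ + e) * ‖w - z₁‖) ^ 2 ≤ (q + e * a) ^ 2 := by gcongr
  have h4 : (q + e * a) ^ 2 ≤ (γ + e) * (e * a ^ 2 + q ^ 2 / γ) := by
    have : (γ + e) * (e * a ^ 2 + q ^ 2 / γ) - (q + e * a) ^ 2 = e / γ * (γ * a - q) ^ 2 := by
      field_simp
      ring
    have h5 : 0 ≤ e / γ * (γ * a - q) ^ 2 := by positivity
    linarith
  have h5 : (γ + e) * ((γ + e) * ‖w - z₁‖ ^ 2) ≤ (γ + e) * (e * a ^ 2 + q ^ 2 / γ) := by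
    nlinarith
  exact le_of_mul_le_mul_left h5 (by positivity)

/-- The one-step inequality, multiplied by `t`, telescopes. It involves `r (t + 1)` where the sum
wants `r t`; shifting the index costs one `r t ≤ B / (2γ)` per step, which together with the noise
`2B/γ` gives `5B / (2γ)`. -/
lemma spg_weighted_sum_le {e r b : ℕ → ℝ} {B E R : ℝ} (hγ : 0 < γ) (hb : ∀ t, 0 ≤ b t)
    (hr1 : r 1 = 0) (hr : ∀ t, r t ≤ B / (2 * γ))
    (hstep : ∀ t, t ≠ 0 → e t - E + r (t + 1) ≤ R + γ * t / 8 * b t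
      - (γ * t / 8 + γ / 2) * b (t + 1) + 2 / (γ * t) * B)
    {T : ℕ} (hT : 1 ≤ T) :
    ∑ t ∈ Finset.Icc 1 T, (t : ℝ) * (e t + r t - E - R)
      + T * (γ * T / 8 + γ / 2) * b (T + 1) + T * r (T + 1)
      ≤ γ / 8 * b 1 + T * (5 * B / (2 * γ)) := by
  induction T, hT using Nat.le_induction with
  | base =>
    have h := hstep 1 one_ne_zero
    have h0 := hr 1
    rw [hr1] at h0
    simp only [Finset.Icc_self, Finset.sum_singleton, Nat.cast_one, one_mul, hr1] at h ⊢
    have h2 : 2 / (γ * 1) * B + B / (2 * γ) = 5 * B / (2 * γ) := by field_simp; ring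
    linarith
  | succ T hT ih =>
    rw [Finset.sum_Icc_succ_top (by omega)]
    have hT1 : (1 : ℝ) ≤ T := by exact_mod_cast hT
    have h := hstep (T + 1) (by omega)
    have h0 := hr (T + 1)
    push_cast at h ⊢
    have h1 := mul_le_mul_of_nonneg_left h (show (0 : ℝ) ≤ T + 1 by positivity)
    have h2 : ((T : ℝ) + 1) * (2 / (γ * (T + 1)) * B) = 2 * B / γ := by
      field_simp
    have h3 : 2 * B / γ + B / (2 * γ) = 5 * B / (2 * γ) := by field_simp; ring
    -- The weights absorb each other: `(T + 1)² ≤ T² + 4T` for `T ≥ 1`.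
    have h4 : (T + 1) * (γ * (T + 1) / 8) * b (T + 1) ≤ T * (γ * T / 8 + γ / 2) * b (T + 1) := by
      refine mul_le_mul_of_nonneg_right ?_ (hb _)
      nlinarith
    nlinarith

end SPGStep

/-! ### SPG in expectation. -/

lemma MeasureTheory.MemLp.integrable_real_inner {Ω E : Type*} [MeasurableSpace Ω] {P : Measure Ω}
    [NormedAddCommGroup E] [InnerProductSpace ℝ E] {f g : Ω → E} (hf : MemLp f 2 P)
    (hg : MemLp g 2 P) : Integrable (fun ω => ⟪f ω, g ω⟫_ℝ) P := by
  refine (hf.norm.integrable_sq.add hg.norm.integrable_sq).mono' (hf.1.inner hg.1)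
    (Eventually.of_forall fun ω => ?_)
  have h1 := abs_real_inner_le_norm (f ω) (g ω)
  simp only [Pi.add_apply, Real.norm_eq_abs]
  nlinarith [sq_nonneg (‖f ω‖ - ‖g ω‖), sq_nonneg (‖f ω‖), sq_nonneg ‖g ω‖]

/-- `G` is an unbiased stochastic subgradient of `φ` on `S` with second moment at most `B`. -/
structure StochSubgrad {n : ℕ} {Z : Type*} [MeasurableSpace Z] (S : Set (Vec n)) (φ : Vec n → ℝ)
    (G : Z → Vec n → Vec n) (ν : Measure Z) (B : ℝ) : Prop where
  measurable : Measurable (Function.uncurry G)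
  nonneg : 0 ≤ B
  subgrad : ∀ z ∈ S, ∀ u ∈ S, φ z + ⟪∫ ξ, G ξ z ∂ν, u - z⟫_ℝ ≤ φ u
  moment : ∀ z ∈ S, ∫⁻ ξ, ‖G ξ z‖ₑ ^ 2 ∂ν ≤ ENNReal.ofReal B

namespace StochSubgrad

variable {n : ℕ} {Z : Type*} [mZ : MeasurableSpace Z] {S : Set (Vec n)} {φ : Vec n → ℝ}
  {G : Z → Vec n → Vec n} {ν : Measure Z} {B : ℝ}

lemma measurable_apply (h : StochSubgrad S φ G ν B) (z : Vec n) : Measurable fun ξ => G ξ z :=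
  h.measurable.comp (measurable_id.prodMk measurable_const)

lemma boundedSubgrad [IsProbabilityMeasure ν] (h : StochSubgrad S φ G ν B) :
    BoundedSubgrad S φ √B := fun z hz =>
  ⟨∫ ξ, G ξ z ∂ν, norm_integral_le_sqrt h.nonneg (h.measurable_apply z).aestronglyMeasurable
    (h.moment z hz), h.subgrad z hz⟩

variable {Ω : Type*} [MeasurableSpace Ω] {P : Measure Ω} [IsProbabilityMeasure P]
  {ζ : ℕ → Ω → Z} {γ : ℝ} {z₁ : Vec n}

section Iterates

variable (h : StochSubgrad S φ G ν B) (hS : IsClosed S) (hS' : Convex ℝ S) (hγ : 0 < γ)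
  (hz₁ : z₁ ∈ S) (hζ : ∀ t, Measurable (ζ t)) (hind : iIndepFun ζ P) (hlaw : ∀ t, P.map (ζ t) = ν)

include h hS hS' hγ hz₁

omit [MeasurableSpace Ω] in
lemma measurable_iter_past (t : ℕ) :
    Measurable[⨆ s ∈ Set.Iio t, mZ.comap (ζ s)]
      fun ω => spgIter S γ (fun s => G (ζ s ω)) z₁ t := by
  refine measurable_spgIter hS hS' ⟨z₁, hz₁⟩ hγ measurable_const fun s hs => ?_
  exact h.measurable.comp
    (((measurable_iSup_comap ζ (Set.mem_Iio.2 hs)).comp measurable_fst).prodMk measurable_snd)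

include hζ

lemma measurable_iter (t : ℕ) : Measurable fun ω => spgIter S γ (fun s => G (ζ s ω)) z₁ t :=
  measurable_spgIter hS hS' ⟨z₁, hz₁⟩ hγ measurable_const fun s _ =>
    h.measurable.comp (((hζ s).comp measurable_fst).prodMk measurable_snd)

lemma measurable_grad_iter (t : ℕ) :
    Measurable fun ω => G (ζ t ω) (spgIter S γ (fun s => G (ζ s ω)) z₁ t) :=
  h.measurable.comp ((hζ t).prodMk (h.measurable_iter hS hS' hγ hz₁ hζ t))

include hind

omit [IsProbabilityMeasure P] in
lemma indepFun_iter (t : ℕ) :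
    IndepFun (fun ω => spgIter S γ (fun s => G (ζ s ω)) z₁ t) (ζ t) P :=
  hind.indepFun_of_measurable_iSup hζ (s := Set.Iio t) (t := {t}) (by simp)
    (h.measurable_iter_past hS hS' hγ hz₁ t) (measurable_iSup_comap ζ rfl)

include hlaw

lemma lintegral_grad_iter_le (t : ℕ) :
    ∫⁻ ω, ‖G (ζ t ω) (spgIter S γ (fun s => G (ζ s ω)) z₁ t)‖ₑ ^ 2 ∂P ≤ ENNReal.ofReal B := by
  have hH : Measurable (Function.uncurry fun (z : Vec n) (ξ : Z) => ‖G ξ z‖ₑ ^ 2) :=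
    ((h.measurable.comp measurable_swap).enorm).pow_const 2
  rw [(h.indepFun_iter hS hS' hγ hz₁ hζ hind t).lintegral_eq
    (h.measurable_iter hS hS' hγ hz₁ hζ t) (hζ t) hH, hlaw]
  calc _ ≤ ∫⁻ _, ENNReal.ofReal B ∂P :=
        lintegral_mono fun ω => h.moment _ (spgIter_mem hS hγ _ hz₁ t)
    _ = ENNReal.ofReal B := by simp

lemma memLp_grad_iter (t : ℕ) :
    MemLp (fun ω => G (ζ t ω) (spgIter S γ (fun s => G (ζ s ω)) z₁ t)) 2 P :=
  memLp_two_of_lintegral_le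
    (h.measurable_grad_iter hS hS' hγ hz₁ hζ t).aestronglyMeasurable
    (h.lintegral_grad_iter_le hS hS' hγ hz₁ hζ hind hlaw t)

lemma integral_grad_iter_le (t : ℕ) :
    ∫ ω, ‖G (ζ t ω) (spgIter S γ (fun s => G (ζ s ω)) z₁ t)‖ ^ 2 ∂P ≤ B :=
  integral_sq_norm_le h.nonneg
    (h.measurable_grad_iter hS hS' hγ hz₁ hζ t).aestronglyMeasurable
    (h.lintegral_grad_iter_le hS hS' hγ hz₁ hζ hind hlaw t)

/-- The bound is invariant under the recursion of `spgIter_norm_sub_sq_le`: with `e = γ t / 4`, `e ·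
B/γ² + B/γ = (γ + e) · B/γ²`. -/
lemma iter_sub_center (t : ℕ) :
    Integrable (fun ω => ‖spgIter S γ (fun s => G (ζ s ω)) z₁ t - z₁‖ ^ 2) P ∧
      ∫ ω, ‖spgIter S γ (fun s => G (ζ s ω)) z₁ t - z₁‖ ^ 2 ∂P ≤ B / γ ^ 2 := by
  have hB : 0 ≤ B / γ ^ 2 := div_nonneg h.nonneg (by positivity)
  induction t with
  | zero => simpa [spgIter] using hB
  | succ t ih =>
    by_cases ht : t = 0
    · subst ht; simpa [spgIter] using hB
    · have hg := (h.memLp_grad_iter hS hS' hγ hz₁ hζ hind hlaw t).norm.integrable_sq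
      have hκ : 0 < γ + γ * t / 4 := by positivity
      have hstep : ∀ ω, ‖spgIter S γ (fun s => G (ζ s ω)) z₁ (t + 1) - z₁‖ ^ 2 ≤
          (γ + γ * t / 4)⁻¹ * (γ * t / 4 * ‖spgIter S γ (fun s => G (ζ s ω)) z₁ t - z₁‖ ^ 2
            + ‖G (ζ t ω) (spgIter S γ (fun s => G (ζ s ω)) z₁ t)‖ ^ 2 / γ) := fun ω => by
        rw [le_inv_mul_iff₀ hκ]
        exact spgIter_norm_sub_sq_le hS hS' hγ (fun s => G (ζ s ω)) hz₁ ht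
      have hmaj := ((ih.1.const_mul (γ * t / 4)).add (hg.div_const γ)).const_mul
        (γ + γ * t / 4)⁻¹
      have hm := ((h.measurable_iter hS hS' hγ hz₁ hζ (t + 1)).sub_const z₁).norm.pow_const 2
      have hint : Integrable
          (fun ω => ‖spgIter S γ (fun s => G (ζ s ω)) z₁ (t + 1) - z₁‖ ^ 2) P :=
        hmaj.mono' hm.aestronglyMeasurable (Eventually.of_forall fun ω => by
          rw [Real.norm_of_nonneg (by positivity)]
          exact hstep ω)
      refine ⟨hint, (integral_mono hint hmaj hstep).trans ?_⟩
      simp only [Pi.add_apply]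
      rw [integral_const_mul, integral_add (ih.1.const_mul _) (hg.div_const _),
        integral_const_mul, integral_div, inv_mul_le_iff₀ hκ]
      have h1 := h.integral_grad_iter_le hS hS' hγ hz₁ hζ hind hlaw t
      have h2 := ih.2
      calc _ ≤ γ * t / 4 * (B / γ ^ 2) + B / γ := by gcongr
        _ = _ := by field_simp; ring

lemma memLp_iter_sub (t : ℕ) (u : Vec n) :
    MemLp (fun ω => spgIter S γ (fun s => G (ζ s ω)) z₁ t - u) 2 P := by
  have hm := h.measurable_iter hS hS' hγ hz₁ hζ t
  have h1 : MemLp (fun ω => spgIter S γ (fun s => G (ζ s ω)) z₁ t - z₁) 2 P :=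
    (memLp_two_iff_integrable_sq_norm (hm.sub_const z₁).aestronglyMeasurable).2
      (h.iter_sub_center hS hS' hγ hz₁ hζ hind hlaw t).1
  convert h1.add (memLp_const (z₁ - u)) using 2 with ω
  simp

end Iterates

lemma integrable_comp [IsProbabilityMeasure ν] (h : StochSubgrad S φ G ν B) (hz₁ : z₁ ∈ S)
    {A : Ω → Vec n} (hA : Measurable A) (hAS : ∀ ω, A ω ∈ S)
    (hL : MemLp (fun ω => A ω - z₁) 2 P) : Integrable (fun ω => φ (A ω)) P := by
  have hb := h.boundedSubgrad
  have hmaj : Integrable (fun ω => |φ z₁| + √B * ‖A ω - z₁‖) P :=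
    (integrable_const _).add ((hL.integrable one_le_two).norm.const_mul _)
  refine hmaj.mono' (hb.continuousOn.measurable_comp_of_mem hA hAS).aestronglyMeasurable
    (Eventually.of_forall fun ω => ?_)
  have h1 := hb.abs_sub_le (hAS ω) hz₁
  rw [Real.norm_eq_abs]
  have h2 := abs_sub_abs_le_abs_sub (φ (A ω)) (φ z₁)
  linarith

lemma convexOn_sq_dist {S : Set (Vec n)} (hS' : Convex ℝ S) {κ : ℝ} (hκ : 0 ≤ κ) (c : Vec n) :
    ConvexOn ℝ S fun z => κ / 2 * ‖z - c‖ ^ 2 := by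
  refine ⟨hS', fun x _ y _ a b ha hb hab => ?_⟩
  obtain rfl : a = 1 - b := by linarith
  have h3 : (1 - b) • x + b • y - c = (1 - b) • (x - c) + b • (y - c) := by module
  simp only [smul_eq_mul]
  rw [h3, norm_combo_sq]
  have : 0 ≤ κ / 2 * (b * (1 - b) * ‖x - c - (y - c)‖ ^ 2) := by positivity
  linarith

section Rate

variable [IsProbabilityMeasure ν]
  (h : StochSubgrad S φ G ν B) (hS : IsClosed S) (hS' : Convex ℝ S) (hγ : 0 < γ)
  (hz₁ : z₁ ∈ S) (hζ : ∀ t, Measurable (ζ t)) (hind : iIndepFun ζ P) (hlaw : ∀ t, P.map (ζ t) = ν)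

include h hS hS' hγ hz₁ hζ hind hlaw

lemma integrable_iter (t : ℕ) :
    Integrable (fun ω => φ (spgIter S γ (fun s => G (ζ s ω)) z₁ t)) P :=
  h.integrable_comp hz₁ (h.measurable_iter hS hS' hγ hz₁ hζ t)
    (fun _ => spgIter_mem hS hγ _ hz₁ t) (h.memLp_iter_sub hS hS' hγ hz₁ hζ hind hlaw t z₁)

/-- Iterate `t` is independent of draw `t`, so by Fubini the stochastic gradient may be replaced by
its mean at the iterate, which is a genuine subgradient. -/
lemma integral_iter_sub_le {u : Vec n} (hu : u ∈ S) (t : ℕ) :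
    ∫ ω, φ (spgIter S γ (fun s => G (ζ s ω)) z₁ t) ∂P - φ u ≤
      ∫ ω, ⟪G (ζ t ω) (spgIter S γ (fun s => G (ζ s ω)) z₁ t),
        spgIter S γ (fun s => G (ζ s ω)) z₁ t - u⟫_ℝ ∂P := by
  have hint := (h.memLp_grad_iter hS hS' hγ hz₁ hζ hind hlaw t).integrable_real_inner
    (h.memLp_iter_sub hS hS' hγ hz₁ hζ hind hlaw t u)
  have hH : Measurable (Function.uncurry fun (z : Vec n) (ξ : Z) => ⟪G ξ z, z - u⟫_ℝ) :=
    (h.measurable.comp measurable_swap).inner (measurable_fst.sub_const u)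
  obtain ⟨hi, heq⟩ := (h.indepFun_iter hS hS' hγ hz₁ hζ hind t).integral_eq
    (h.measurable_iter hS hS' hγ hz₁ hζ t) (hζ t) hH hint
  rw [heq]
  have hφ := h.integrable_iter hS hS' hγ hz₁ hζ hind hlaw t
  have h1 : ∫ ω, φ (spgIter S γ (fun s => G (ζ s ω)) z₁ t) ∂P - φ u =
      ∫ ω, (φ (spgIter S γ (fun s => G (ζ s ω)) z₁ t) - φ u) ∂P := by
    rw [integral_sub hφ (integrable_const _)]
    simp
  rw [h1]
  refine integral_mono (hφ.sub (integrable_const _)) hi fun ω => ?_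
  rw [hlaw]
  have hmem := spgIter_mem hS hγ (fun s => G (ζ s ω)) hz₁ t
  generalize spgIter S γ (fun s => G (ζ s ω)) z₁ t = z at hmem
  have hGi : Integrable (fun ξ => G ξ z) ν := (memLp_two_of_lintegral_le
    (h.measurable_apply z).aestronglyMeasurable (h.moment z hmem)).integrable one_le_two
  have h2 : ∫ ξ, ⟪G ξ z, z - u⟫_ℝ ∂ν = ⟪∫ ξ, G ξ z ∂ν, z - u⟫_ℝ := by
    rw [real_inner_comm, ← integral_inner hGi]
    simp_rw [real_inner_comm (z - u)]
  rw [h2]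
  have h3 := h.subgrad z hmem u hu
  rw [← neg_sub z u, inner_neg_right] at h3
  linarith

/-- Take expectations in `spgIter_step`, sum with weights `t`, divide by `T (T + 1) / 2`, and pass
to the averaged output by Jensen's inequality for the regularized objective. -/
lemma integral_spg_le {u : Vec n} (hu : u ∈ S) {T : ℕ} (hT : 1 ≤ T) :
    Integrable (fun ω => φ (spg S γ (fun s => G (ζ s ω)) z₁ T)) P ∧
    (∀ w, MemLp (fun ω => spg S γ (fun s => G (ζ s ω)) z₁ T - w) 2 P) ∧
    ∫ ω, φ (spg S γ (fun s => G (ζ s ω)) z₁ T) ∂P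
      + γ / 2 * ∫ ω, ‖spg S γ (fun s => G (ζ s ω)) z₁ T - z₁‖ ^ 2 ∂P ≤
      φ u + γ / 2 * ‖u - z₁‖ ^ 2 + γ * ‖u - z₁‖ ^ 2 / (4 * T * (T + 1))
        + 5 * B / (γ * (T + 1)) := by
  have hT0 : T ≠ 0 := by omega
  have hTpos : (0 : ℝ) < T := by positivity
  set z : ℕ → Ω → Vec n := fun t ω => spgIter S γ (fun s => G (ζ s ω)) z₁ t with hzdef
  set out : Ω → Vec n := fun ω => spg S γ (fun s => G (ζ s ω)) z₁ T with hout
  have houteq : ∀ ω, out ω = ∑ t ∈ Finset.Icc 1 T, ((t : ℝ) / (T * (T + 1) / 2)) • z t ω :=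
    fun ω => spg_eq_sum _ _ _ _ _
  have hzL : ∀ t w, MemLp (fun ω => z t ω - w) 2 P := fun t w =>
    h.memLp_iter_sub hS hS' hγ hz₁ hζ hind hlaw t w
  have hzφ : ∀ t, Integrable (fun ω => φ (z t ω)) P := fun t =>
    h.integrable_iter hS hS' hγ hz₁ hζ hind hlaw t
  have hzsq : ∀ t w, Integrable (fun ω => ‖z t ω - w‖ ^ 2) P := fun t w =>
    (hzL t w).norm.integrable_sq
  have houtL0 : MemLp out 2 P := by
    have : MemLp (fun ω => ∑ t ∈ Finset.Icc 1 T, ((t : ℝ) / (T * (T + 1) / 2)) • z t ω) 2 P :=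
      memLp_finsetSum _ fun t _ => by
        have := hzL t 0
        simp only [sub_zero] at this
        exact this.const_smul ((t : ℝ) / (T * (T + 1) / 2))
    exact (memLp_congr_ae (Eventually.of_forall houteq)).2 this
  have houtL : ∀ w, MemLp (fun ω => out ω - w) 2 P := fun w => houtL0.sub (memLp_const w)
  have houtm : Measurable out :=
    measurable_spg hS hS' ⟨z₁, hz₁⟩ hγ measurable_const fun s =>
      h.measurable.comp (((hζ s).comp measurable_fst).prodMk measurable_snd)
  have houtφ : Integrable (fun ω => φ (out ω)) P :=
    h.integrable_comp hz₁ houtm (fun ω => spg_mem hS hS' hγ _ hz₁ hT0) (houtL z₁)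
  refine ⟨houtφ, houtL, ?_⟩
  have hsum := spg_weighted_sum_le (γ := γ) (B := B) (E := φ u) (R := γ / 2 * ‖u - z₁‖ ^ 2)
    (e := fun t => ∫ ω, φ (z t ω) ∂P) (r := fun t => γ / 2 * ∫ ω, ‖z t ω - z₁‖ ^ 2 ∂P)
    (b := fun t => ∫ ω, ‖z t ω - u‖ ^ 2 ∂P) hγ
    (fun t => integral_nonneg fun _ => by positivity)
    (by simp [hzdef, spgIter_one])
    (fun t => by
      have h1 := (h.iter_sub_center hS hS' hγ hz₁ hζ hind hlaw t).2
      calc _ ≤ γ / 2 * (B / γ ^ 2) := by gcongr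
        _ = _ := by field_simp)
    (fun t ht => by
      have hg := (h.memLp_grad_iter hS hS' hγ hz₁ hζ hind hlaw t).norm.integrable_sq
      have hgi : Integrable (fun ω => ⟪G (ζ t ω) (z t ω), z t ω - u⟫_ℝ) P :=
        (h.memLp_grad_iter hS hS' hγ hz₁ hζ hind hlaw t).integrable_real_inner (hzL t u)
      have h1 : ∫ ω, φ (z t ω) ∂P - φ u ≤ ∫ ω, ⟪G (ζ t ω) (z t ω), z t ω - u⟫_ℝ ∂P :=
        h.integral_iter_sub_le hS hS' hγ hz₁ hζ hind hlaw hu t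
      have i1 : Integrable (fun ω => γ / 2 * ‖z (t + 1) ω - z₁‖ ^ 2) P :=
        (hzsq (t + 1) z₁).const_mul _
      have i2 : Integrable (fun ω => γ * t / 8 * ‖z t ω - u‖ ^ 2) P := (hzsq t u).const_mul _
      have i3 : Integrable (fun ω => (γ * t / 8 + γ / 2) * ‖z (t + 1) ω - u‖ ^ 2) P :=
        (hzsq (t + 1) u).const_mul _
      have i4 : Integrable (fun ω => 2 / (γ * t) * ‖G (ζ t ω) (z t ω)‖ ^ 2) P := hg.const_mul _
      have i5 : Integrable (fun ω => γ / 2 * ‖u - z₁‖ ^ 2 + γ * t / 8 * ‖z t ω - u‖ ^ 2) P :=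
        (integrable_const _).add i2
      have i6 : Integrable (fun ω => γ / 2 * ‖u - z₁‖ ^ 2 + γ * t / 8 * ‖z t ω - u‖ ^ 2
        - (γ * t / 8 + γ / 2) * ‖z (t + 1) ω - u‖ ^ 2) P := i5.sub i3
      have h2 := integral_mono (hgi.add i1) (i6.add i4) fun ω =>
        spgIter_step hS hS' hγ (fun s => G (ζ s ω)) z₁ ht hu
      simp only [Pi.add_apply] at h2
      rw [integral_add hgi i1, integral_add i6 i4, integral_sub i5 i3,
        integral_add (integrable_const _) i2, integral_const] at h2
      simp only [integral_const_mul, probReal_univ, one_smul] at h2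
      have h3 : 2 / (γ * t) * ∫ ω, ‖G (ζ t ω) (z t ω)‖ ^ 2 ∂P ≤ 2 / (γ * t) * B :=
        mul_le_mul_of_nonneg_left (h.integral_grad_iter_le hS hS' hγ hz₁ hζ hind hlaw t)
          (by positivity)
      linarith) hT
  have hb1 : ∫ ω, ‖z 1 ω - u‖ ^ 2 ∂P = ‖u - z₁‖ ^ 2 := by
    simp [hzdef, spgIter_one, norm_sub_rev]
  simp only [hb1] at hsum
  have hΨ : ConvexOn ℝ S fun w => φ w + γ / 2 * ‖w - z₁‖ ^ 2 :=
    (h.boundedSubgrad.convexOn hS').add (convexOn_sq_dist hS' hγ.le z₁)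
  have hjensen : ∀ ω, φ (out ω) + γ / 2 * ‖out ω - z₁‖ ^ 2 ≤ ∑ t ∈ Finset.Icc 1 T,
      ((t : ℝ) / (T * (T + 1) / 2)) * (φ (z t ω) + γ / 2 * ‖z t ω - z₁‖ ^ 2) := fun ω => by
    have := hΨ.map_sum_le (t := Finset.Icc 1 T) (w := fun t => (t : ℝ) / (T * (T + 1) / 2))
      (p := fun t => z t ω) (fun t _ => by positivity) (spg_weight_normalized hT0)
      (fun t _ => spgIter_mem hS hγ _ hz₁ t)
    rw [← houteq] at this
    simpa only [smul_eq_mul] using this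
  have i1 : Integrable (fun ω => γ / 2 * ‖out ω - z₁‖ ^ 2) P :=
    (houtL z₁).norm.integrable_sq.const_mul _
  have i2 : ∀ t, Integrable (fun ω => γ / 2 * ‖z t ω - z₁‖ ^ 2) P := fun t =>
    (hzsq t z₁).const_mul _
  have i3 : ∀ t ∈ Finset.Icc 1 T, Integrable (fun ω => ((t : ℝ) / (T * (T + 1) / 2)) *
      (φ (z t ω) + γ / 2 * ‖z t ω - z₁‖ ^ 2)) P := fun t _ =>
    ((hzφ t).add (i2 t)).const_mul _
  have h1 := integral_mono (houtφ.add i1) (integrable_finsetSum _ i3) hjensen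
  simp only [Pi.add_apply] at h1
  rw [integral_add houtφ i1, integral_finsetSum _ i3, integral_const_mul] at h1
  have h2 : ∀ t : ℕ, ∫ ω, ((t : ℝ) / (T * (T + 1) / 2)) *
      (φ (z t ω) + γ / 2 * ‖z t ω - z₁‖ ^ 2) ∂P = ((t : ℝ) / (T * (T + 1) / 2)) *
      (∫ ω, φ (z t ω) ∂P + γ / 2 * ∫ ω, ‖z t ω - z₁‖ ^ 2 ∂P) := fun t => by
    rw [integral_const_mul, integral_add (hzφ t) (i2 t), integral_const_mul]
  simp only [h2] at h1
  refine h1.trans ?_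
  have hW : (0 : ℝ) < T * (T + 1) / 2 := by positivity
  have hnonneg : 0 ≤ T * (γ * T / 8 + γ / 2) * ∫ ω, ‖z (T + 1) ω - u‖ ^ 2 ∂P :=
    mul_nonneg (by positivity) (integral_nonneg fun _ => by positivity)
  have hnonneg' : 0 ≤ T * (γ / 2 * ∫ ω, ‖z (T + 1) ω - z₁‖ ^ 2 ∂P) :=
    mul_nonneg hTpos.le (mul_nonneg (by positivity) (integral_nonneg fun _ => by positivity))
  have h3 : ∑ t ∈ Finset.Icc 1 T, (t : ℝ) * (∫ ω, φ (z t ω) ∂P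
      + γ / 2 * ∫ ω, ‖z t ω - z₁‖ ^ 2 ∂P - φ u - γ / 2 * ‖u - z₁‖ ^ 2)
      ≤ γ / 8 * ‖u - z₁‖ ^ 2 + T * (5 * B / (2 * γ)) := by linarith
  have h4 : ∑ t ∈ Finset.Icc 1 T, ((t : ℝ) / (T * (T + 1) / 2)) *
      (∫ ω, φ (z t ω) ∂P + γ / 2 * ∫ ω, ‖z t ω - z₁‖ ^ 2 ∂P) =
      φ u + γ / 2 * ‖u - z₁‖ ^ 2 + (∑ t ∈ Finset.Icc 1 T, (t : ℝ) * (∫ ω, φ (z t ω) ∂P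
      + γ / 2 * ∫ ω, ‖z t ω - z₁‖ ^ 2 ∂P - φ u - γ / 2 * ‖u - z₁‖ ^ 2)) / (T * (T + 1) / 2) := by
    have h5 : φ u + γ / 2 * ‖u - z₁‖ ^ 2 = ∑ t ∈ Finset.Icc 1 T, ((t : ℝ) / (T * (T + 1) / 2)) *
        (φ u + γ / 2 * ‖u - z₁‖ ^ 2) := by
      rw [← Finset.sum_mul, spg_weight_normalized hT0, one_mul]
    rw [h5, Finset.sum_div, ← Finset.sum_add_distrib]
    refine Finset.sum_congr rfl fun t _ => ?_
    ring
  rw [h4]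
  have h5 := div_le_div_of_nonneg_right h3 hW.le
  have h6 : (γ / 8 * ‖u - z₁‖ ^ 2 + T * (5 * B / (2 * γ))) / (T * (T + 1) / 2) =
      γ * ‖u - z₁‖ ^ 2 / (4 * T * (T + 1)) + 5 * B / (γ * (T + 1)) := by
    field_simp
    ring
  linarith

/-- Expected progress of `stageLength γ k` iterations of SPG towards the proximal point `u`. -/
theorem spg_progress {u : Vec n} (hu : IsProx S φ γ z₁ u) {k : ℕ} (hk : 1 ≤ k) :
    Integrable (fun ω => φ (spg S γ (fun s => G (ζ s ω)) z₁ (stageLength γ k))) P ∧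
    ∫ ω, φ (spg S γ (fun s => G (ζ s ω)) z₁ (stageLength γ k)) ∂P + γ / 2 * ‖u - z₁‖ ^ 2 ≤
      φ z₁ + 6 * B / k ∧
    Integrable (fun ω => ‖spg S γ (fun s => G (ζ s ω)) z₁ (stageLength γ k) - u‖ ^ 2) P ∧
    ∫ ω, ‖spg S γ (fun s => G (ζ s ω)) z₁ (stageLength γ k) - u‖ ^ 2 ∂P ≤
      2 / γ * (6 * B / k) := by
  set T := stageLength γ k with hTdef
  have hT : 1 ≤ T := by rw [hTdef, stageLength]; omega
  obtain ⟨h1, h2, h3⟩ := h.integral_spg_le hS hS' hγ hz₁ hζ hind hlaw hu.1 hT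
  -- This is what the choice of `stageLength` is for: it turns the rate `1 / (γ (T + 1))` into `1 /
  -- k`.
  have hkT : (k : ℝ) ≤ γ * (T + 1) := by
    have : (k : ℝ) / γ ≤ T := by
      rw [hTdef, stageLength]
      push_cast
      linarith [Nat.le_ceil ((k : ℝ) / γ)]
    rw [div_le_iff₀ hγ] at this
    nlinarith
  have hk0 : (0 : ℝ) < k := by exact_mod_cast hk
  have hT1 : (1 : ℝ) ≤ T := by exact_mod_cast hT
  have hB := h.nonneg
  have hcenter := (hu.norm_sub_center_le h.boundedSubgrad hS' hz₁).2
  rw [abs_of_nonneg (Real.sqrt_nonneg B)] at hcenter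
  have hc2 : (γ * ‖u - z₁‖) ^ 2 ≤ B := by
    calc _ ≤ √B ^ 2 := by gcongr
      _ = B := Real.sq_sqrt hB
  -- One part `B / (γ (T + 1))` comes from the initial distance, through `γ ‖u - z₁‖ ≤ √B`, and five
  -- parts from the gradient noise.
  have herr : γ * ‖u - z₁‖ ^ 2 / (4 * T * (T + 1)) + 5 * B / (γ * (T + 1)) ≤ 6 * B / k := by
    have e1 : γ * ‖u - z₁‖ ^ 2 / (4 * T * (T + 1)) ≤ B / (γ * (T + 1)) := by
      rw [div_le_div_iff₀ (by positivity) (by positivity)]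
      have e2 : γ * ‖u - z₁‖ ^ 2 * (γ * (T + 1)) = (γ * ‖u - z₁‖) ^ 2 * (T + 1) := by ring
      rw [e2]
      have e3 := mul_le_mul_of_nonneg_right hc2 (show (0 : ℝ) ≤ T + 1 by positivity)
      have e4 : 0 ≤ B * (T + 1) := by positivity
      nlinarith
    have e5 : 6 * B / (γ * (T + 1)) ≤ 6 * B / k := by gcongr
    have e6 : B / (γ * (T + 1)) + 5 * B / (γ * (T + 1)) = 6 * B / (γ * (T + 1)) := by ring
    linarith
  have hcvx := h.boundedSubgrad.convexOn hS'
  have hstrong := hu.strong hcvx hz₁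
  rw [sub_self, norm_zero, norm_sub_rev z₁ u] at hstrong
  have hsq : Integrable (fun ω => ‖spg S γ (fun s => G (ζ s ω)) z₁ T - u‖ ^ 2) P :=
    (h2 u).norm.integrable_sq
  have hsq' : Integrable (fun ω => ‖spg S γ (fun s => G (ζ s ω)) z₁ T - z₁‖ ^ 2) P :=
    (h2 z₁).norm.integrable_sq
  refine ⟨h1, ?_, hsq, ?_⟩
  · have : 0 ≤ γ / 2 * ∫ ω, ‖spg S γ (fun s => G (ζ s ω)) z₁ T - z₁‖ ^ 2 ∂P :=
      mul_nonneg (by positivity) (integral_nonneg fun _ => by positivity)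
    linarith
  · have i1 : Integrable (fun ω => γ / 2 * ‖spg S γ (fun s => G (ζ s ω)) z₁ T - u‖ ^ 2) P :=
      hsq.const_mul _
    have i2 : Integrable (fun ω => γ / 2 * ‖spg S γ (fun s => G (ζ s ω)) z₁ T - z₁‖ ^ 2) P :=
      hsq'.const_mul _
    have h4 := integral_mono ((integrable_const (φ u + γ / 2 * ‖u - z₁‖ ^ 2)).add i1)
      (h1.add i2) fun ω => hu.strong hcvx (spg_mem hS hS' hγ (fun s => G (ζ s ω)) hz₁
        (show T ≠ 0 by omega))
    simp only [Pi.add_apply] at h4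
    rw [integral_add (integrable_const _) i1, integral_add h1 i2, integral_const_mul,
      integral_const_mul, integral_const] at h4
    simp only [probReal_univ, one_smul] at h4
    have h5 : γ / 2 * ∫ ω, ‖spg S γ (fun s => G (ζ s ω)) z₁ T - u‖ ^ 2 ∂P ≤ 6 * B / k := by
      linarith
    have h6 := mul_le_mul_of_nonneg_left h5 (show 0 ≤ 2 / γ by positivity)
    have h7 : ∀ X : ℝ, 2 / γ * (γ / 2 * X) = X := fun X => by field_simp
    rwa [h7] at h6

end Rate

end StochSubgrad

lemma enorm_sub_sq_le {E : Type*} [SeminormedAddCommGroup E] (a b : E) :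
    ‖a - b‖ₑ ^ 2 ≤ 2 * ‖a‖ₑ ^ 2 + 2 * ‖b‖ₑ ^ 2 := by
  have h : ‖a - b‖₊ ^ 2 ≤ 2 * ‖a‖₊ ^ 2 + 2 * ‖b‖₊ ^ 2 := by
    rw [← mul_add]
    exact (pow_le_pow_left₀ (zero_le) (nnnorm_sub_le a b) 2).trans add_sq_le
  simp only [enorm_eq_nnnorm]
  exact_mod_cast h

lemma lintegral_enorm_sq_le_of_sub {Ω E : Type*} [MeasurableSpace Ω] {P : Measure Ω}
    [IsProbabilityMeasure P] [NormedAddCommGroup E] {f : Ω → E} {a : E} {B : ℝ} (hB : 0 ≤ B)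
    (h : ∫⁻ ω, ‖f ω - a‖ₑ ^ 2 ∂P ≤ ENNReal.ofReal B) :
    ∫⁻ ω, ‖f ω‖ₑ ^ 2 ∂P ≤ ENNReal.ofReal (2 * B + 2 * ‖a‖ ^ 2) := by
  calc ∫⁻ ω, ‖f ω‖ₑ ^ 2 ∂P ≤ ∫⁻ ω, (2 * ‖f ω - a‖ₑ ^ 2 + 2 * ‖a‖ₑ ^ 2) ∂P := by
        refine lintegral_mono fun ω => ?_
        have := enorm_sub_sq_le (f ω - a) (-a)
        rwa [sub_neg_eq_add, sub_add_cancel, enorm_neg] at this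
    _ = 2 * ∫⁻ ω, ‖f ω - a‖ₑ ^ 2 ∂P + 2 * ‖a‖ₑ ^ 2 := by
        rw [lintegral_add_right _ measurable_const, lintegral_const_mul' _ _ (by simp)]
        simp
    _ ≤ 2 * ENNReal.ofReal B + 2 * ‖a‖ₑ ^ 2 := by gcongr
    _ = ENNReal.ofReal (2 * B + 2 * ‖a‖ ^ 2) := by
        rw [ENNReal.ofReal_add (by positivity) (by positivity), ENNReal.ofReal_mul (by norm_num),
          ENNReal.ofReal_mul (by norm_num), ENNReal.ofReal_pow (norm_nonneg _), ofReal_norm]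
        norm_num

/-! ### The two subproblems and their stochastic oracles. -/

section Problem

variable {d m : ℕ} {r : Regime} {p : InfProjection d m} {Gl Ll Lh v D M : ℝ}

namespace InfProjection.Regular

lemma l_tangent_le (hp : p.Regular r Gl Ll Lh v D M) {x u : Vec d} (hx : x ∈ p.X) (hu : u ∈ p.X)
    (i : Fin m) : p.ℓ x i + (p.J x (u - x)) i ≤ p.ℓ u i := by
  have h1 : HasFDerivWithinAt (fun x => p.ℓ x i)
      ((EuclideanSpace.proj i : Vec m →L[ℝ] ℝ).comp (p.J x)) p.X x :=
    (EuclideanSpace.proj i : Vec m →L[ℝ] ℝ).hasFDerivAt.comp_hasFDerivWithinAt x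
      (hp.hasFDeriv_l x hx)
  exact (hp.convex_l i).tangent_le hx h1 hu

lemma norm_l_sub_le (hp : p.Regular r Gl Ll Lh v D M) {x u : Vec d} (hx : x ∈ p.X)
    (hu : u ∈ p.X) : ‖p.ℓ x - p.ℓ u‖ ≤ Gl * ‖x - u‖ :=
  hp.convex_X.norm_image_sub_le_of_norm_hasFDerivWithin_le hp.hasFDeriv_l hp.lipschitz_l hu hx

lemma inner_tangent_le_of_nonneg (hp : p.Regular r Gl Ll Lh v D M) {x u : Vec d} (hx : x ∈ p.X)
    (hu : u ∈ p.X) {y : Vec m} (hy : ∀ i, 0 ≤ y i) :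
    ⟪y, p.ℓ x + p.J x (u - x)⟫_ℝ ≤ ⟪y, p.ℓ u⟫_ℝ := by
  simp only [PiLp.inner_apply, PiLp.add_apply, RCLike.inner_apply, conj_trivial]
  exact Finset.sum_le_sum fun i _ =>
    mul_le_mul_of_nonneg_right (hp.l_tangent_le hx hu i) (hy i)

lemma inner_le_tangent_of_nonpos (hp : p.Regular r Gl Ll Lh v D M) {x u : Vec d} (hx : x ∈ p.X)
    (hu : u ∈ p.X) {y : Vec m} (hy : ∀ i, y i ≤ 0) :
    ⟪y, p.ℓ u⟫_ℝ ≤ ⟪y, p.ℓ x + p.J x (u - x)⟫_ℝ := by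
  simp only [PiLp.inner_apply, PiLp.add_apply, RCLike.inner_apply, conj_trivial]
  exact Finset.sum_le_sum fun i _ =>
    mul_le_mul_of_nonpos_right (hp.l_tangent_le hx hu i) (hy i)

/-- The model of the `x`-subproblem majorizes `f(·, y)`. -/
lemma f_le_objX (hp : p.Regular r Gl Ll Lh v D M) {x u : Vec d} (hx : x ∈ p.X) (hu : u ∈ p.X)
    {y : Vec m} (hy : y ∈ p.domh) : p.f u y ≤ objX r p x y u + p.h y := by
  cases r with
  | dc =>
    have := hp.inner_tangent_le_of_nonneg hx hu (hp.sign_domh y hy)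
    simp only [objX, InfProjection.f]
    linarith
  | biconvex =>
    simp only [objX, InfProjection.f]
    linarith

lemma continuousOn_l (hp : p.Regular r Gl Ll Lh v D M) : ContinuousOn p.ℓ p.X := fun x hx =>
  (hp.hasFDeriv_l x hx).continuousWithinAt

end InfProjection.Regular

lemma objX_self (r : Regime) (p : InfProjection d m) (x : Vec d) (y : Vec m) :
    objX r p x y x + p.h y = p.f x y := by
  cases r <;> simp [objX, InfProjection.f] <;> ring

/-- Objective of the `y`-subproblem. -/
def objY (p : InfProjection d m) (x : Vec d) (y : Vec m) : ℝ := p.h y - ⟪y, p.ℓ x⟫_ℝ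

lemma objY_add (p : InfProjection d m) (x : Vec d) (y : Vec m) :
    objY p x y + p.g x = p.f x y := by
  simp only [objY, InfProjection.f]; ring

/-- Exact solution of the regularized `y`-subproblem of a stage. -/
def exactY (p : InfProjection d m) (μ : ℝ) (x : Vec d) (y : Vec m) : Vec m :=
  argminOn p.domh fun w => objY p x w + μ / 2 * ‖w - y‖ ^ 2

variable {Ξg Ξl Ξh : Type*} [MeasurableSpace Ξg] [MeasurableSpace Ξl] [MeasurableSpace Ξh]
  {Pg : Measure Ξg} {Pl : Measure Ξl} {Ph : Measure Ξh}
  [IsProbabilityMeasure Pg] [IsProbabilityMeasure Pl] [IsProbabilityMeasure Ph]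
  {o : Oracles d m Ξg Ξl Ξh} {σ : ℝ}

section Measurability

omit [IsProbabilityMeasure Pg] [IsProbabilityMeasure Pl] [IsProbabilityMeasure Ph]

/-- In coordinates the adjoint is a sum of inner products with the images `A eᵢ`, each plainly
measurable. -/
lemma Measurable.adjoint_apply {Ω : Type*} [MeasurableSpace Ω] {A : Ω → Vec d →L[ℝ] Vec m}
    {b : Ω → Vec m} (hA : Measurable A) (hb : Measurable b) :
    Measurable fun ω => (A ω).adjoint (b ω) := by
  let e := EuclideanSpace.basisFun (Fin d) ℝ
  have h : ∀ ω, (A ω).adjoint (b ω) = ∑ i, ⟪b ω, A ω (e i)⟫_ℝ • e i := fun ω => by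
    conv_lhs => rw [← e.sum_repr ((A ω).adjoint (b ω))]
    refine Finset.sum_congr rfl fun i _ => ?_
    rw [e.repr_apply_apply, ContinuousLinearMap.adjoint_inner_right, real_inner_comm]
  simp_rw [h]
  refine Finset.measurable_fun_sum _ fun i _ => Measurable.smul_const ?_ _
  exact hb.inner ((ContinuousLinearMap.measurable_apply (e i)).comp hA)

lemma Oracles.Regular.measurable_gradX (ho : o.Regular p Pg Pl Ph σ) (r : Regime) :
    Measurable fun q : (Vec d × Vec m) × ((Ξg × Ξl) × Vec d) =>
      gradX r o q.1.1 q.1.2 q.2.1 q.2.2 := by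
  have h1 : Measurable fun q : (Vec d × Vec m) × ((Ξg × Ξl) × Vec d) => o.dg q.2.2 q.2.1.1 :=
    ho.measurable_dg.comp (measurable_snd.snd.prodMk measurable_snd.fst.fst)
  cases r with
  | dc =>
    have h2 : Measurable fun q : (Vec d × Vec m) × ((Ξg × Ξl) × Vec d) => o.jac q.1.1 q.2.1.2 :=
      ho.measurable_jac.comp (measurable_fst.fst.prodMk measurable_snd.fst.snd)
    have h3 : Measurable fun q : (Vec d × Vec m) × ((Ξg × Ξl) × Vec d) =>
        (o.jac q.1.1 q.2.1.2).adjoint q.1.2 :=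
      h2.adjoint_apply measurable_fst.snd
    simp only [gradX]
    exact h1.sub h3
  | biconvex =>
    have h2 : Measurable fun q : (Vec d × Vec m) × ((Ξg × Ξl) × Vec d) => o.jac q.2.2 q.2.1.2 :=
      ho.measurable_jac.comp (measurable_snd.snd.prodMk measurable_snd.fst.snd)
    have h3 : Measurable fun q : (Vec d × Vec m) × ((Ξg × Ξl) × Vec d) =>
        (o.jac q.2.2 q.2.1.2).adjoint q.1.2 :=
      h2.adjoint_apply measurable_fst.snd
    simp only [gradX]
    exact h1.sub h3

lemma Oracles.Regular.measurable_gradY (ho : o.Regular p Pg Pl Ph σ) :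
    Measurable fun q : Vec d × ((Ξh × Ξl) × Vec m) => gradY o q.1 q.2.1 q.2.2 := by
  have h1 : Measurable fun q : Vec d × ((Ξh × Ξl) × Vec m) => o.dh q.2.2 q.2.1.1 :=
    ho.measurable_dh.comp (measurable_snd.snd.prodMk measurable_snd.fst.fst)
  have h2 : Measurable fun q : Vec d × ((Ξh × Ξl) × Vec m) => o.val q.1 q.2.1.2 :=
    ho.measurable_val.comp (measurable_fst.prodMk measurable_snd.fst.snd)
  exact h1.sub h2

end Measurability

/-- Second moment bound for the stochastic gradients of the `x`-subproblem. -/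
def momentX (Gl D σ : ℝ) : ℝ := 2 * σ ^ 2 + 2 * (D ^ 2 * (2 * σ ^ 2 + 2 * Gl ^ 2))

/-- Second moment bound for the stochastic gradients of the `y`-subproblem at `x`. -/
def momentY (o : Oracles d m Ξg Ξl Ξh) (Pl : Measure Ξl) (σ : ℝ) (x : Vec d) : ℝ :=
  2 * σ ^ 2 + 2 * (∫⁻ s, ‖o.val x s‖ₑ ^ 2 ∂Pl).toReal

namespace Oracles.Regular

omit [IsProbabilityMeasure Pg] [IsProbabilityMeasure Pl] [IsProbabilityMeasure Ph] in
lemma measurable_left (ho : o.Regular p Pg Pl Ph σ) (x : Vec d) : Measurable (o.dg x) :=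
  ho.measurable_dg.comp (measurable_const.prodMk measurable_id)

omit [IsProbabilityMeasure Pg] [IsProbabilityMeasure Pl] [IsProbabilityMeasure Ph] in
lemma measurable_val_left (ho : o.Regular p Pg Pl Ph σ) (x : Vec d) : Measurable (o.val x) :=
  ho.measurable_val.comp (measurable_const.prodMk measurable_id)

omit [IsProbabilityMeasure Pg] [IsProbabilityMeasure Pl] [IsProbabilityMeasure Ph] in
lemma measurable_jac_left (ho : o.Regular p Pg Pl Ph σ) (x : Vec d) : Measurable (o.jac x) :=
  ho.measurable_jac.comp (measurable_const.prodMk measurable_id)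

omit [IsProbabilityMeasure Pg] [IsProbabilityMeasure Pl] [IsProbabilityMeasure Ph] in
lemma measurable_dh_left (ho : o.Regular p Pg Pl Ph σ) (y : Vec m) : Measurable (o.dh y) :=
  ho.measurable_dh.comp (measurable_const.prodMk measurable_id)

variable (ho : o.Regular p Pg Pl Ph σ) (hp : p.Regular r Gl Ll Lh v D M)

include ho hp

omit [IsProbabilityMeasure Pl] [IsProbabilityMeasure Ph] in
lemma boundedSubgrad_g (hσ : 0 ≤ σ) : BoundedSubgrad p.X p.g σ := fun x hx =>
  ⟨_, (norm_integral_le_sqrt (sq_nonneg σ) (ho.measurable_left x).aestronglyMeasurable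
      (ho.moment_dg x hx)).trans (Real.sqrt_sq hσ).le,
    fun _ hu => subgradient_of_mem_limitingSubdiff hp.convex_g (ho.mean_dg x hx) hu⟩

omit [IsProbabilityMeasure Pg] [IsProbabilityMeasure Pl] in
lemma boundedSubgrad_h (hσ : 0 ≤ σ) : BoundedSubgrad p.domh p.h σ := fun y hy =>
  ⟨_, (norm_integral_le_sqrt (sq_nonneg σ) (ho.measurable_dh_left y).aestronglyMeasurable
      (ho.moment_dh y hy)).trans (Real.sqrt_sq hσ).le,
    fun _ hu => subgradient_of_mem_limitingSubdiff hp.convex_h (ho.mean_dh y hy) hu⟩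

omit hp [IsProbabilityMeasure Pg] [IsProbabilityMeasure Ph] in
lemma integrable_jac {x : Vec d} (hx : x ∈ p.X) : Integrable (o.jac x) Pl := by
  have h : MemLp (fun ξ => o.jac x ξ - p.J x) 2 Pl := memLp_two_of_lintegral_le
    ((ho.measurable_jac_left x).sub_const _).aestronglyMeasurable (ho.variance_jac x hx)
  have := (h.integrable one_le_two).add (integrable_const (p.J x))
  exact this.congr (Eventually.of_forall fun ξ => by simp)

omit hp [IsProbabilityMeasure Pg] [IsProbabilityMeasure Ph] in
lemma integrable_val {x : Vec d} (hx : x ∈ p.X) : Integrable (o.val x) Pl := by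
  have h : MemLp (fun ξ => o.val x ξ - p.ℓ x) 2 Pl := memLp_two_of_lintegral_le
    ((ho.measurable_val_left x).sub_const _).aestronglyMeasurable (ho.variance_val x hx)
  have := (h.integrable one_le_two).add (integrable_const (p.ℓ x))
  exact this.congr (Eventually.of_forall fun ξ => by simp)

omit hp [IsProbabilityMeasure Ph] in
lemma mean_gradX {x' : Vec d} {x : Vec d} (hx : x ∈ p.X) (hx' : x' ∈ p.X) (y : Vec m) :
    ∫ ξ, (o.dg x ξ.1 - (o.jac x' ξ.2).adjoint y) ∂(Pg.prod Pl) =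
      ∫ ξ, o.dg x ξ ∂Pg - (p.J x').adjoint y := by
  have hg : Integrable (o.dg x) Pg := (memLp_two_of_lintegral_le
    (ho.measurable_left x).aestronglyMeasurable (ho.moment_dg x hx)).integrable one_le_two
  -- Taking the adjoint and applying it to `y` is continuous and linear in the Jacobian, so it
  -- commutes with the expectation.
  let A : (Vec d →L[ℝ] Vec m) →L[ℝ] Vec d := LinearMap.mkContinuous
    { toFun := fun B => B.adjoint y
      map_add' := fun B B' => by simp
      map_smul' := fun c B => by simp } ‖y‖ fun B => by
        refine (B.adjoint.le_opNorm y).trans ?_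
        rw [LinearIsometryEquiv.norm_map, mul_comm]
  have hA : ∀ B, A B = B.adjoint y := fun B => rfl
  have hj := ho.integrable_jac hx'
  have hj' : Integrable (fun ξ => (o.jac x' ξ).adjoint y) Pl := A.integrable_comp hj
  rw [integral_sub (hg.comp_fst Pl) (hj'.comp_snd Pg), integral_fun_fst,
    integral_fun_snd (fun ξ => (o.jac x' ξ).adjoint y)]
  simp only [probReal_univ, one_smul]
  congr 1
  have := A.integral_comp_comm hj
  simp only [hA] at this
  rw [this, ho.mean_jac x' hx']

omit [IsProbabilityMeasure Ph] in
lemma moment_gradX {x' x : Vec d} (hx : x ∈ p.X)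
    (hx' : x' ∈ p.X) {y : Vec m} (hy : y ∈ p.domh) :
    ∫⁻ ξ, ‖o.dg x ξ.1 - (o.jac x' ξ.2).adjoint y‖ₑ ^ 2 ∂(Pg.prod Pl) ≤
      ENNReal.ofReal (momentX Gl D σ) := by
  have hmd := (ho.measurable_left x).enorm.pow_const 2
  have hmj := (ho.measurable_jac_left x').enorm.pow_const 2
  have hD : 0 ≤ D := (norm_nonneg y).trans (hp.norm_le_of_mem_domh y hy)
  have hadj : ∀ B : Vec d →L[ℝ] Vec m, ‖B.adjoint y‖ₑ ^ 2 ≤ ENNReal.ofReal (D ^ 2) * ‖B‖ₑ ^ 2 := by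
    intro B
    have h1 : ‖B.adjoint y‖ ^ 2 ≤ D ^ 2 * ‖B‖ ^ 2 := by
      rw [← mul_pow]
      refine pow_le_pow_left₀ (norm_nonneg _) ?_ 2
      refine (B.adjoint.le_opNorm y).trans ?_
      rw [LinearIsometryEquiv.norm_map, mul_comm]
      exact mul_le_mul_of_nonneg_right (hp.norm_le_of_mem_domh y hy) (norm_nonneg _)
    rw [← ofReal_norm, ← ofReal_norm, ← ENNReal.ofReal_pow (norm_nonneg _),
      ← ENNReal.ofReal_pow (norm_nonneg _), ← ENNReal.ofReal_mul (by positivity)]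
    exact ENNReal.ofReal_le_ofReal h1
  have hjac : ∫⁻ ξ, ‖o.jac x' ξ‖ₑ ^ 2 ∂Pl ≤ ENNReal.ofReal (2 * σ ^ 2 + 2 * Gl ^ 2) := by
    refine (lintegral_enorm_sq_le_of_sub (sq_nonneg σ) (ho.variance_jac x' hx')).trans ?_
    refine ENNReal.ofReal_le_ofReal ?_
    have := hp.lipschitz_l x' hx'
    gcongr
  calc _ ≤ ∫⁻ ξ, (2 * ‖o.dg x ξ.1‖ₑ ^ 2 + 2 * (ENNReal.ofReal (D ^ 2) * ‖o.jac x' ξ.2‖ₑ ^ 2))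
          ∂(Pg.prod Pl) := by
        refine lintegral_mono fun ξ => (enorm_sub_sq_le _ _).trans ?_
        gcongr
        exact hadj _
    _ = 2 * ∫⁻ ξ, ‖o.dg x ξ‖ₑ ^ 2 ∂Pg
          + 2 * (ENNReal.ofReal (D ^ 2) * ∫⁻ ξ, ‖o.jac x' ξ‖ₑ ^ 2 ∂Pl) := by
        rw [lintegral_add_left (show Measurable fun ξ : Ξg × Ξl => 2 * ‖o.dg x ξ.1‖ₑ ^ 2 from
            (hmd.comp measurable_fst).const_mul 2),
          lintegral_const_mul' _ _ (by simp), lintegral_const_mul' _ _ (by simp),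
          lintegral_const_mul' _ _ (by simp)]
        have e1 := lintegral_prod (μ := Pg) (ν := Pl) (fun ξ => ‖o.dg x ξ.1‖ₑ ^ 2)
          (hmd.comp measurable_fst).aemeasurable
        have e2 := lintegral_prod (μ := Pg) (ν := Pl) (fun ξ => ‖o.jac x' ξ.2‖ₑ ^ 2)
          (hmj.comp measurable_snd).aemeasurable
        rw [e1, e2]
        simp
    _ ≤ 2 * ENNReal.ofReal (σ ^ 2)
          + 2 * (ENNReal.ofReal (D ^ 2) * ENNReal.ofReal (2 * σ ^ 2 + 2 * Gl ^ 2)) := by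
        gcongr
        exact ho.moment_dg x hx
    _ = _ := by
        have hQ : 0 ≤ 2 * σ ^ 2 + 2 * Gl ^ 2 := by positivity
        rw [momentX]
        generalize 2 * σ ^ 2 + 2 * Gl ^ 2 = Q at hQ
        rw [ENNReal.ofReal_add (by positivity) (by positivity),
          ENNReal.ofReal_mul (by norm_num), ENNReal.ofReal_mul (p := 2) (by norm_num),
          ENNReal.ofReal_mul (p := D ^ 2) (by positivity)]
        norm_num

omit [IsProbabilityMeasure Ph] in
-- In the DC case the model is `g` plus an affine function, whatever the sign of `y`. In the
-- bi-convex case `y ≤ 0` turns the tangent inequality for `ℓ` into the subgradient inequality for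
-- `-⟪y, ℓ⟫`.
lemma stochSubgrad_objX {x : Vec d} (hx : x ∈ p.X) {y : Vec m}
    (hy : y ∈ p.domh) :
    StochSubgrad p.X (objX r p x y) (gradX r o x y) (Pg.prod Pl) (momentX Gl D σ) where
  measurable := (ho.measurable_gradX r).comp
    (show Measurable fun q : (Ξg × Ξl) × Vec d => ((x, y), q) from
      measurable_const.prodMk measurable_id)
  nonneg := by unfold momentX; positivity
  subgrad z hz u hu := by
    have hg := subgradient_of_mem_limitingSubdiff hp.convex_g (ho.mean_dg z hz) hu
    cases r with
    | dc =>
      simp only [gradX, objX]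
      rw [ho.mean_gradX hz hx, inner_sub_left, ContinuousLinearMap.adjoint_inner_left]
      simp only [inner_add_right, map_sub, inner_sub_right] at *
      linarith
    | biconvex =>
      have := hp.inner_le_tangent_of_nonpos hz hu (hp.sign_domh y hy)
      simp only [gradX, objX]
      rw [ho.mean_gradX hz hz, inner_sub_left, ContinuousLinearMap.adjoint_inner_left]
      rw [inner_add_right] at this
      linarith
  moment z hz := by
    cases r with
    | dc => exact ho.moment_gradX hp hz hx hy
    | biconvex => exact ho.moment_gradX hp hz hz hy

omit hp [IsProbabilityMeasure Pg] [IsProbabilityMeasure Ph] in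
lemma lintegral_val_ne_top {x : Vec d} (hx : x ∈ p.X) : ∫⁻ s, ‖o.val x s‖ₑ ^ 2 ∂Pl ≠ ∞ :=
  ((lintegral_enorm_sq_le_of_sub (sq_nonneg σ) (ho.variance_val x hx)).trans_lt
    ENNReal.ofReal_lt_top).ne

omit [IsProbabilityMeasure Pg] in
lemma stochSubgrad_objY {x : Vec d} (hx : x ∈ p.X) :
    StochSubgrad p.domh (objY p x) (gradY o x) (Ph.prod Pl) (momentY o Pl σ x) where
  measurable := ho.measurable_gradY.comp
    (show Measurable fun q : (Ξh × Ξl) × Vec m => (x, q) from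
      measurable_const.prodMk measurable_id)
  nonneg := by unfold momentY; positivity
  subgrad z hz u hu := by
    have hh := subgradient_of_mem_limitingSubdiff hp.convex_h (ho.mean_dh z hz) hu
    have hi : Integrable (o.dh z) Ph := (memLp_two_of_lintegral_le
      (ho.measurable_dh_left z).aestronglyMeasurable (ho.moment_dh z hz)).integrable one_le_two
    have hv := ho.integrable_val hx
    simp only [gradY, objY]
    rw [integral_sub (hi.comp_fst Pl) (hv.comp_snd Ph), integral_fun_fst, integral_fun_snd]
    simp only [probReal_univ, one_smul]
    rw [ho.mean_val x hx, inner_sub_left, inner_sub_right (p.ℓ x), real_inner_comm u,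
      real_inner_comm z]
    linarith
  moment z hz := by
    have hmd := (ho.measurable_dh_left z).enorm.pow_const 2
    have hmj := (ho.measurable_val_left x).enorm.pow_const 2
    calc _ ≤ ∫⁻ ξ, (2 * ‖o.dh z ξ.1‖ₑ ^ 2 + 2 * ‖o.val x ξ.2‖ₑ ^ 2) ∂(Ph.prod Pl) :=
          lintegral_mono fun ξ => enorm_sub_sq_le _ _
      _ = 2 * ∫⁻ ξ, ‖o.dh z ξ‖ₑ ^ 2 ∂Ph + 2 * ∫⁻ ξ, ‖o.val x ξ‖ₑ ^ 2 ∂Pl := by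
          rw [lintegral_add_left (show Measurable fun ξ : Ξh × Ξl => 2 * ‖o.dh z ξ.1‖ₑ ^ 2 from
              (hmd.comp measurable_fst).const_mul 2),
            lintegral_const_mul' _ _ (by simp), lintegral_const_mul' _ _ (by simp)]
          have e1 := lintegral_prod (μ := Ph) (ν := Pl) (fun ξ => ‖o.dh z ξ.1‖ₑ ^ 2)
            (hmd.comp measurable_fst).aemeasurable
          have e2 := lintegral_prod (μ := Ph) (ν := Pl) (fun ξ => ‖o.val x ξ.2‖ₑ ^ 2)
            (hmj.comp measurable_snd).aemeasurable
          rw [e1, e2]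
          simp
      _ ≤ 2 * ENNReal.ofReal (σ ^ 2) + 2 * ∫⁻ ξ, ‖o.val x ξ‖ₑ ^ 2 ∂Pl := by
          gcongr
          exact ho.moment_dh z hz
      _ = _ := by
          rw [momentY, ENNReal.ofReal_add (by positivity) (by positivity),
            ENNReal.ofReal_mul (by norm_num), ENNReal.ofReal_mul (by norm_num),
            ENNReal.ofReal_toReal (ho.lintegral_val_ne_top hx)]
          norm_num

omit [IsProbabilityMeasure Ph] in
lemma exactX_isProx {γ : ℝ} (hγ : 0 < γ) {x : Vec d} (hx : x ∈ p.X) {y : Vec m}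
    (hy : y ∈ p.domh) : IsProx p.X (objX r p x y) γ x (exactX r p γ x y) :=
  argminOn_isProx ((ho.stochSubgrad_objX hp hx hy).boundedSubgrad.exists_isProx
    hp.isClosed_X ⟨x, hx⟩ hγ x)

omit [IsProbabilityMeasure Pg] in
lemma exactY_isProx {μ : ℝ} (hμ : 0 < μ) {x : Vec d} (hx : x ∈ p.X) {y : Vec m}
    (hy : y ∈ p.domh) : IsProx p.domh (objY p x) μ y (exactY p μ x y) :=
  argminOn_isProx ((ho.stochSubgrad_objY hp hx).boundedSubgrad.exists_isProx
    hp.isClosed_domh ⟨y, hy⟩ hμ y)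

omit [IsProbabilityMeasure Ph] in
-- Changing `(x, y)` moves the centre and changes the model by a function that is Lipschitz with
-- constant `Gl ‖y - y'‖ + Ll D ‖x - x'‖`; prox stability then makes the solution map Lipschitz. Its
-- purpose is measurability of `v_k`.
lemma continuous_exactX (hGl : 0 ≤ Gl) (hLl : 0 ≤ Ll) (hD : 0 ≤ D) {γ : ℝ} (hγ : 0 < γ) :
    Continuous fun q : p.X × p.domh => exactX r p γ q.1 q.2 := by
  refine LipschitzWith.continuous (K := Real.toNNReal (γ⁻¹ * (Gl + Ll * D) + 1)) ?_
  refine LipschitzWith.of_dist_le_mul fun q q' => ?_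
  obtain ⟨⟨x, hx⟩, ⟨y, hy⟩⟩ := q
  obtain ⟨⟨x', hx'⟩, ⟨y', hy'⟩⟩ := q'
  have h := (ho.exactX_isProx hp hγ hx hy).norm_sub_le hγ
    (δ := Gl * ‖y - y'‖ + Ll * D * ‖x - x'‖) (by positivity) (ho.exactX_isProx hp hγ hx' hy')
    ((ho.stochSubgrad_objX hp hx hy).boundedSubgrad.convexOn hp.convex_X)
    ((ho.stochSubgrad_objX hp hx' hy').boundedSubgrad.convexOn hp.convex_X) ?_
  · have e1 : ‖x - x'‖ ≤ dist ((⟨x, hx⟩, ⟨y, hy⟩) : p.X × p.domh) (⟨x', hx'⟩, ⟨y', hy'⟩) := by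
      rw [← dist_eq_norm]; exact le_max_left _ _
    have e2 : ‖y - y'‖ ≤ dist ((⟨x, hx⟩, ⟨y, hy⟩) : p.X × p.domh) (⟨x', hx'⟩, ⟨y', hy'⟩) := by
      rw [← dist_eq_norm]; exact le_max_right _ _
    rw [dist_eq_norm, Real.coe_toNNReal _ (by positivity)]
    refine h.trans ?_
    rw [add_mul, one_mul, mul_assoc γ⁻¹, add_mul Gl]
    gcongr
  · intro a ha b hb
    cases r with
    | dc =>
      simp only [objX]
      have e0 : ⟪y, p.ℓ x + p.J x (b - x)⟫_ℝ - ⟪y, p.ℓ x + p.J x (a - x)⟫_ℝ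
          - (⟪y', p.ℓ x' + p.J x' (b - x')⟫_ℝ - ⟪y', p.ℓ x' + p.J x' (a - x')⟫_ℝ) =
          ⟪y - y', p.J x' (b - a)⟫_ℝ + ⟪y, (p.J x - p.J x') (b - a)⟫_ℝ := by
        simp only [inner_add_right, map_sub, inner_sub_right, inner_sub_left,
          sub_apply]
        ring
      have e1 : ⟪y - y', p.J x' (b - a)⟫_ℝ ≤ Gl * ‖y - y'‖ * ‖a - b‖ := by
        refine (real_inner_le_norm _ _).trans ?_
        have := (p.J x').le_of_opNorm_le (hp.lipschitz_l x' hx') (b - a)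
        rw [norm_sub_rev b a] at this
        calc _ ≤ ‖y - y'‖ * (Gl * ‖a - b‖) := by gcongr
          _ = _ := by ring
      have e2 : ⟪y, (p.J x - p.J x') (b - a)⟫_ℝ ≤ Ll * D * ‖x - x'‖ * ‖a - b‖ := by
        refine (real_inner_le_norm _ _).trans ?_
        have := (p.J x - p.J x').le_of_opNorm_le (hp.smooth_l x hx x' hx') (b - a)
        rw [norm_sub_rev b a] at this
        have hyD := hp.norm_le_of_mem_domh y hy
        calc _ ≤ D * (Ll * ‖x - x'‖ * ‖a - b‖) := by gcongr
          _ = _ := by ring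
      linarith
    | biconvex =>
      simp only [objX]
      have e0 : ⟪y, p.ℓ b⟫_ℝ - ⟪y, p.ℓ a⟫_ℝ - (⟪y', p.ℓ b⟫_ℝ - ⟪y', p.ℓ a⟫_ℝ) =
          ⟪y - y', p.ℓ b - p.ℓ a⟫_ℝ := by
        simp only [inner_sub_right, inner_sub_left]
        ring
      have e1 : ⟪y - y', p.ℓ b - p.ℓ a⟫_ℝ ≤ Gl * ‖y - y'‖ * ‖a - b‖ := by
        refine (real_inner_le_norm _ _).trans ?_
        have := hp.norm_l_sub_le hb ha
        rw [norm_sub_rev b a] at this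
        calc _ ≤ ‖y - y'‖ * (Gl * ‖a - b‖) := by gcongr
          _ = _ := by ring
      have e2 : 0 ≤ Ll * D * ‖x - x'‖ * ‖a - b‖ := by positivity
      linarith

omit [IsProbabilityMeasure Pg] in
lemma continuous_exactY (hGl : 0 ≤ Gl) {μ : ℝ} (hμ : 0 < μ) :
    Continuous fun q : p.X × p.domh => exactY p μ q.1 q.2 := by
  refine LipschitzWith.continuous (K := Real.toNNReal (μ⁻¹ * Gl + 1)) ?_
  refine LipschitzWith.of_dist_le_mul fun q q' => ?_
  obtain ⟨⟨x, hx⟩, ⟨y, hy⟩⟩ := q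
  obtain ⟨⟨x', hx'⟩, ⟨y', hy'⟩⟩ := q'
  have hcv : Convex ℝ p.domh := hp.convex_h.1
  have h := (ho.exactY_isProx hp hμ hx hy).norm_sub_le hμ
    (δ := Gl * ‖x - x'‖) (by positivity) (ho.exactY_isProx hp hμ hx' hy')
    ((ho.stochSubgrad_objY hp hx).boundedSubgrad.convexOn hcv)
    ((ho.stochSubgrad_objY hp hx').boundedSubgrad.convexOn hcv) ?_
  · have e1 : ‖x - x'‖ ≤ dist ((⟨x, hx⟩, ⟨y, hy⟩) : p.X × p.domh) (⟨x', hx'⟩, ⟨y', hy'⟩) := by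
      rw [← dist_eq_norm]; exact le_max_left _ _
    have e2 : ‖y - y'‖ ≤ dist ((⟨x, hx⟩, ⟨y, hy⟩) : p.X × p.domh) (⟨x', hx'⟩, ⟨y', hy'⟩) := by
      rw [← dist_eq_norm]; exact le_max_right _ _
    rw [dist_eq_norm, Real.coe_toNNReal _ (by positivity)]
    refine h.trans ?_
    rw [add_mul, one_mul, mul_assoc]
    gcongr
  · intro a ha b hb
    simp only [objY]
    have e0 : ⟪b, p.ℓ x⟫_ℝ - ⟪a, p.ℓ x⟫_ℝ - (⟪b, p.ℓ x'⟫_ℝ - ⟪a, p.ℓ x'⟫_ℝ) =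
        ⟪b - a, p.ℓ x - p.ℓ x'⟫_ℝ := by
      simp only [inner_sub_right, inner_sub_left]
    have e1 : ⟪b - a, p.ℓ x - p.ℓ x'⟫_ℝ ≤ Gl * ‖x - x'‖ * ‖a - b‖ := by
      refine (real_inner_le_norm _ _).trans ?_
      have := hp.norm_l_sub_le hx hx'
      rw [norm_sub_rev b a]
      calc _ ≤ ‖a - b‖ * (Gl * ‖x - x'‖) := by gcongr
        _ = _ := by ring
    linarith

omit [IsProbabilityMeasure Pl] in
lemma continuous_f (hσ : 0 ≤ σ) : Continuous fun q : p.X × p.domh => p.f q.1 q.2 := by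
  have hg : Continuous fun x : p.X => p.g x :=
    continuousOn_iff_continuous_domRestrict.1 (ho.boundedSubgrad_g hp hσ).continuousOn
  have hh : Continuous fun y : p.domh => p.h y :=
    continuousOn_iff_continuous_domRestrict.1 (ho.boundedSubgrad_h hp hσ).continuousOn
  have hl : Continuous fun x : p.X => p.ℓ x :=
    continuousOn_iff_continuous_domRestrict.1 hp.continuousOn_l
  exact ((hg.comp continuous_fst).add (hh.comp continuous_snd)).sub
    ((continuous_subtype_val.comp continuous_snd).inner (hl.comp continuous_fst))

end Oracles.Regular

end Problem

/-! ### Progress of one SPG run from a random state. -/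

lemma stageLength_ne_zero (γ : ℝ) (k : ℕ) : stageLength γ k ≠ 0 := Nat.succ_ne_zero _

lemma ProbabilityTheory.IndepFun.lintegral_eq_lintegral_lintegral {Ω : Type*} [MeasurableSpace Ω]
    {P : Measure Ω} [IsProbabilityMeasure P] {α β : Type*} {mα : MeasurableSpace α}
    {mβ : MeasurableSpace β} {A : Ω → α} {Z : Ω → β} (h : IndepFun A Z P) (hA : Measurable A)
    (hZ : Measurable Z) {H : α → β → ℝ≥0∞} (hH : Measurable (Function.uncurry H)) :
    ∫⁻ ω, H (A ω) (Z ω) ∂P = ∫⁻ ω, ∫⁻ ω', H (A ω) (Z ω') ∂P ∂P := by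
  rw [h.lintegral_eq hA hZ hH]
  exact lintegral_congr fun ω => lintegral_map (f := H (A ω)) hH.of_uncurry_left hZ

section Stage

variable {n : ℕ} {Z : Type*} [mZ : MeasurableSpace Z] {S : Set (Vec n)}
  {ν : Measure Z} [IsProbabilityMeasure ν]
  {Ω : Type*} [MeasurableSpace Ω] {P : Measure Ω} [IsProbabilityMeasure P] {ζ : ℕ → Ω → Z} {γ : ℝ}

/-- Majorization-minimization: `W` lies below the shifted model everywhere and is at least the model
at the starting point, so progress on the model is progress on `W`. Nonnegativity of `W` permits the
passage to `ℝ≥0∞`. -/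
lemma StochSubgrad.lintegral_spg_progress {φ : Vec n → ℝ} {G : Z → Vec n → Vec n} {B : ℝ}
    {z₁ : Vec n} (h : StochSubgrad S φ G ν B) (hS : IsClosed S) (hS' : Convex ℝ S) (hγ : 0 < γ)
    (hz₁ : z₁ ∈ S) (hζ : ∀ t, Measurable (ζ t)) (hind : iIndepFun ζ P)
    (hlaw : ∀ t, P.map (ζ t) = ν) {u : Vec n} (hu : IsProx S φ γ z₁ u) {k : ℕ} (hk : 1 ≤ k)
    {c : ℝ} {W : S → ℝ} (hW0 : ∀ z, 0 ≤ W z) (hW : ∀ z, W z ≤ φ z + c)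
    (hW1 : φ z₁ + c ≤ W ⟨z₁, hz₁⟩) :
    ∫⁻ ω, ENNReal.ofReal (W ⟨spg S γ (fun s => G (ζ s ω)) z₁ (stageLength γ k),
        spg_mem hS hS' hγ _ hz₁ (stageLength_ne_zero _ _)⟩) ∂P
      + ENNReal.ofReal (γ / 2 * ‖z₁ - u‖ ^ 2) ≤
      ENNReal.ofReal (W ⟨z₁, hz₁⟩) + ENNReal.ofReal (6 * B / k) ∧
    ∫⁻ ω, ENNReal.ofReal (‖spg S γ (fun s => G (ζ s ω)) z₁ (stageLength γ k) - u‖ ^ 2) ∂P ≤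
      ENNReal.ofReal (2 / γ * (6 * B / k)) := by
  obtain ⟨h1, h2, h3, h4⟩ := h.spg_progress hS hS' hγ hz₁ hζ hind hlaw hu hk
  have hB := h.nonneg
  constructor
  · have e1 : ∫⁻ ω, ENNReal.ofReal (W ⟨spg S γ (fun s => G (ζ s ω)) z₁ (stageLength γ k),
        spg_mem hS hS' hγ _ hz₁ (stageLength_ne_zero _ _)⟩) ∂P ≤
        ∫⁻ ω, ENNReal.ofReal (φ (spg S γ (fun s => G (ζ s ω)) z₁ (stageLength γ k)) + c) ∂P :=
      lintegral_mono fun ω => ENNReal.ofReal_le_ofReal (hW _)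
    have hpos : ∀ ω, 0 ≤ φ (spg S γ (fun s => G (ζ s ω)) z₁ (stageLength γ k)) + c := fun ω =>
      (hW0 ⟨_, spg_mem hS hS' hγ _ hz₁ (stageLength_ne_zero _ _)⟩).trans (hW _)
    have e2 : ∫⁻ ω, ENNReal.ofReal (φ (spg S γ (fun s => G (ζ s ω)) z₁ (stageLength γ k)) + c) ∂P =
        ENNReal.ofReal (∫ ω, φ (spg S γ (fun s => G (ζ s ω)) z₁ (stageLength γ k)) ∂P
          + ∫ _, c ∂P) := by
      rw [← integral_add h1 (integrable_const c)]
      exact (ofReal_integral_eq_lintegral_ofReal (h1.add (integrable_const c))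
        (Eventually.of_forall hpos)).symm
    rw [e2] at e1
    refine (add_le_add_left e1 _).trans ?_
    have hI : 0 ≤ ∫ ω, φ (spg S γ (fun s => G (ζ s ω)) z₁ (stageLength γ k)) ∂P + ∫ _, c ∂P := by
      rw [← integral_add h1 (integrable_const c)]
      exact integral_nonneg hpos
    rw [← ENNReal.ofReal_add hI (by positivity), ← ENNReal.ofReal_add (hW0 _) (by positivity)]
    refine ENNReal.ofReal_le_ofReal ?_
    rw [integral_const, probReal_univ, one_smul, norm_sub_rev]
    linarith
  · rw [← ofReal_integral_eq_lintegral_ofReal h3 (Eventually.of_forall fun _ => by positivity)]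
    exact ENNReal.ofReal_le_ofReal h4

/-- Progress of one run of SPG that starts from a random state `A` independent of the draws. -/
theorem lintegral_stage_progress {α : Type*} [MeasurableSpace α] {φ : α → Vec n → ℝ}
    {G : α → Z → Vec n → Vec n} {B : α → ℝ} {z₁ u : α → Vec n} {A : Ω → α}
    (h : ∀ a, StochSubgrad S (φ a) (G a) ν (B a))
    (hG : Measurable fun q : α × (Z × Vec n) => G q.1 q.2.1 q.2.2)
    (hS : IsClosed S) (hS' : Convex ℝ S) (hne : S.Nonempty) (hγ : 0 < γ)
    (hz₁ : ∀ a, z₁ a ∈ S) (hz₁m : Measurable z₁) (hζ : ∀ t, Measurable (ζ t))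
    (hind : iIndepFun ζ P) (hlaw : ∀ t, P.map (ζ t) = ν)
    (hu : ∀ a, IsProx S (φ a) γ (z₁ a) (u a)) (hum : Measurable u) {k : ℕ} (hk : 1 ≤ k)
    {c : α → ℝ} {W : α → S → ℝ} (hWm : Measurable (Function.uncurry W)) (hW0 : ∀ a z, 0 ≤ W a z)
    (hW : ∀ a z, W a z ≤ φ a z + c a) (hW1 : ∀ a, φ a (z₁ a) + c a ≤ W a ⟨z₁ a, hz₁ a⟩)
    (hA : Measurable A) (hAζ : IndepFun A (fun ω t => ζ t ω) P) :
    ∫⁻ ω, ENNReal.ofReal (W (A ω) ⟨spg S γ (fun s => G (A ω) (ζ s ω)) (z₁ (A ω)) (stageLength γ k),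
        spg_mem hS hS' hγ _ (hz₁ _) (stageLength_ne_zero _ _)⟩) ∂P
      + ∫⁻ ω, ENNReal.ofReal (γ / 2 * ‖z₁ (A ω) - u (A ω)‖ ^ 2) ∂P ≤
      ∫⁻ ω, ENNReal.ofReal (W (A ω) ⟨z₁ (A ω), hz₁ _⟩) ∂P
        + ∫⁻ ω, ENNReal.ofReal (6 * B (A ω) / k) ∂P ∧
    ∫⁻ ω, ENNReal.ofReal
        (‖spg S γ (fun s => G (A ω) (ζ s ω)) (z₁ (A ω)) (stageLength γ k) - u (A ω)‖ ^ 2) ∂P ≤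
      ∫⁻ ω, ENNReal.ofReal (2 / γ * (6 * B (A ω) / k)) ∂P := by
  have hspg : Measurable fun q : α × (ℕ → Z) =>
      spg S γ (fun s => G q.1 (q.2 s)) (z₁ q.1) (stageLength γ k) := by
    refine measurable_spg (H := fun s (q : α × (ℕ → Z)) => G q.1 (q.2 s)) hS hS' hne hγ
      (hz₁m.comp measurable_fst) fun s => ?_
    have hs : Measurable fun q : (α × (ℕ → Z)) × Vec n => q.1.2 s :=
      (measurable_pi_apply s).comp measurable_fst.snd
    exact hG.comp (measurable_fst.fst.prodMk (hs.prodMk measurable_snd))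
  have hζm : Measurable fun ω t => ζ t ω := measurable_pi_iff.2 hζ
  have hWz : Measurable fun a => ENNReal.ofReal (W a ⟨z₁ a, hz₁ a⟩) :=
    (hWm.comp (measurable_id.prodMk (hz₁m.subtype_mk (h := hz₁)))).ennreal_ofReal
  have hH1 : Measurable (Function.uncurry fun (a : α) (w : ℕ → Z) =>
      ENNReal.ofReal (W a ⟨spg S γ (fun s => G a (w s)) (z₁ a) (stageLength γ k),
        spg_mem hS hS' hγ _ (hz₁ _) (stageLength_ne_zero _ _)⟩)) :=
    (hWm.comp (measurable_fst.prodMk (hspg.subtype_mk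
      (h := fun q => spg_mem hS hS' hγ _ (hz₁ _) (stageLength_ne_zero _ _))))).ennreal_ofReal
  have hH2 : Measurable (Function.uncurry fun (a : α) (w : ℕ → Z) =>
      ENNReal.ofReal (‖spg S γ (fun s => G a (w s)) (z₁ a) (stageLength γ k) - u a‖ ^ 2)) :=
    ((hspg.sub (hum.comp measurable_fst)).norm.pow_const 2).ennreal_ofReal
  -- The estimate holds for every frozen state `a`; independence then lets the state be integrated
  -- out.
  have key := fun a => (h a).lintegral_spg_progress hS hS' hγ (hz₁ a) hζ hind hlaw (hu a) hk
    (hW0 a) (hW a) (hW1 a)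
  constructor
  · have hm : Measurable fun ω => ENNReal.ofReal (γ / 2 * ‖z₁ (A ω) - u (A ω)‖ ^ 2) :=
      ((((hz₁m.comp hA).sub (hum.comp hA)).norm.pow_const 2).const_mul _).ennreal_ofReal
    have hWA : Measurable fun ω => ENNReal.ofReal (W (A ω) ⟨z₁ (A ω), hz₁ _⟩) := hWz.comp hA
    have e := hAζ.lintegral_eq_lintegral_lintegral hA hζm hH1
    rw [e, ← lintegral_add_right _ hm, ← lintegral_add_left hWA]
    exact lintegral_mono fun ω => (key (A ω)).1
  · have e := hAζ.lintegral_eq_lintegral_lintegral hA hζm hH2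
    rw [e]
    exact lintegral_mono fun ω => (key (A ω)).2

end Stage

/-! ### Splitting each draw into independent halves. -/

section SplitDraws

variable {Ω : Type*} [MeasurableSpace Ω] {P : Measure Ω}

lemma ProbabilityTheory.IndepFun.iIndepFun_bool [IsProbabilityMeasure P] {β : Type*}
    [MeasurableSpace β] {X : Bool → Ω → β} (h : IndepFun (X false) (X true) P) :
    iIndepFun X P := by
  rw [iIndepFun_iff_measure_inter_preimage_eq_mul]
  intro S sets hS
  have hcases : S = ∅ ∨ S = {false} ∨ S = {true} ∨ S = {false, true} := by
    clear hS; revert S; decide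
  rcases hcases with rfl | rfl | rfl | rfl
  · simp
  · simp
  · simp
  · have := h.measure_inter_preimage_eq_mul (sets false) (sets true) (hS _ (by simp))
      (hS _ (by simp))
    rw [Finset.set_biInter_insert, Finset.set_biInter_singleton, Finset.prod_pair (by simp)]
    exact this

variable {α β : Type*} [MeasurableSpace α] [MeasurableSpace β]

/-- The two halves of a pair, padded by default values to have the same type. -/
def pairHalf (c : α × β) (b : Bool) (q : α × β) : α × β := if b then (c.1, q.2) else (q.1, c.2)

lemma measurable_pairHalf (c : α × β) (b : Bool) : Measurable (pairHalf c b) := by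
  cases b
  · exact measurable_fst.prodMk measurable_const
  · exact measurable_const.prodMk measurable_snd

/-- For independent draws of pairs with independent halves, all the halves are independent. -/
lemma iIndepFun_pairHalf [IsProbabilityMeasure P] {ι : Type*} {ξ : ι → Ω → α × β}
    (hξ : ∀ i, Measurable (ξ i)) (hind : iIndepFun ξ P)
    {μ : Measure α} {ν : Measure β} [IsProbabilityMeasure μ] [IsProbabilityMeasure ν]
    (hlaw : ∀ i, P.map (ξ i) = μ.prod ν) (c : α × β) :
    iIndepFun (fun (q : ι × Bool) ω => pairHalf c q.2 (ξ q.1 ω)) P := by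
  refine iIndepFun_uncurry' (X := fun i b ω => pairHalf c b (ξ i ω))
    (fun i b => (measurable_pairHalf c b).comp (hξ i)) ?_ fun i => ?_
  · exact hind.comp (fun _ q b => pairHalf c b q) fun _ =>
      measurable_pi_iff.2 fun b => measurable_pairHalf c b
  · refine IndepFun.iIndepFun_bool ?_
    have h : IndepFun (fun ω => (ξ i ω).1) (fun ω => (ξ i ω).2) P := by
      rw [indepFun_iff_map_prod_eq_prod_map_map (hξ i).fst.aemeasurable (hξ i).snd.aemeasurable]
      have h1 : P.map (fun ω => (ξ i ω).1) = μ := by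
        have e : Measure.map Prod.fst (μ.prod ν) = μ := by simp
        rw [← e, ← hlaw i, Measure.map_map measurable_fst (hξ i)]
        rfl
      have h2 : P.map (fun ω => (ξ i ω).2) = ν := by
        have e : Measure.map Prod.snd (μ.prod ν) = ν := by simp
        rw [← e, ← hlaw i, Measure.map_map measurable_snd (hξ i)]
        rfl
      rw [h1, h2, ← hlaw i]
    exact h.comp (φ := fun a : α => (a, c.2)) (ψ := fun b : β => (c.1, b))
      (measurable_id.prodMk measurable_const) (measurable_const.prodMk measurable_id)

end SplitDraws

/-! ### Which draws the iterates depend on. -/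

section Trajectory

variable {d m : ℕ} {r : Regime} {p : InfProjection d m} {Gl Ll Lh v D M σ γ μ : ℝ}
  {Ξg Ξl Ξh : Type*} [MeasurableSpace Ξg] [MeasurableSpace Ξl] [MeasurableSpace Ξh]
  {Pg : Measure Ξg} {Pl : Measure Ξl} {Ph : Measure Ξh}
  [IsProbabilityMeasure Pg] [IsProbabilityMeasure Pl] [IsProbabilityMeasure Ph]
  {o : Oracles d m Ξg Ξl Ξh}
  {Ω : Type*} [mΩ : MeasurableSpace Ω] {P : Measure Ω} [IsProbabilityMeasure P]
  {ξ : ℕ × ℕ → Ω → Draw Ξg Ξl Ξh} {x₁ : Vec d} {y₁ : Vec m}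

/-- The draws with both halves listed separately. -/
def halfDraws (c : Draw Ξg Ξl Ξh) (ξ : ℕ × ℕ → Ω → Draw Ξg Ξl Ξh) (q : (ℕ × ℕ) × Bool) (ω : Ω) :
    Draw Ξg Ξl Ξh := pairHalf c q.2 (ξ q.1 ω)

/-- The half-draws made before stage `k`. -/
def pastDraws (k : ℕ) : Set ((ℕ × ℕ) × Bool) := {q | q.1.1 < k}

/-- The half-draws made before the `y`-update of stage `k`. -/
def midDraws (k : ℕ) : Set ((ℕ × ℕ) × Bool) := {q | q.1.1 < k ∨ (q.1.1 = k ∧ q.2 = false)}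

/-- The σ-algebra generated by a set of half-draws. -/
abbrev drawAlgebra (c : Draw Ξg Ξl Ξh) (ξ : ℕ × ℕ → Ω → Draw Ξg Ξl Ξh)
    (s : Set ((ℕ × ℕ) × Bool)) : MeasurableSpace Ω :=
  ⨆ q ∈ s, MeasurableSpace.comap (halfDraws c ξ q) inferInstance

omit mΩ in
lemma measurable_fst_draw (c : Draw Ξg Ξl Ξh) (ξ : ℕ × ℕ → Ω → Draw Ξg Ξl Ξh)
    {s : Set ((ℕ × ℕ) × Bool)} {i : ℕ × ℕ} (hi : (i, false) ∈ s) :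
    Measurable[drawAlgebra c ξ s] fun ω => (ξ i ω).1 :=
  have h : Measurable[drawAlgebra c ξ s] fun ω => (halfDraws c ξ (i, false) ω).1 :=
    measurable_fst.comp (measurable_iSup_comap (halfDraws c ξ) hi)
  h

omit mΩ in
lemma measurable_snd_draw (c : Draw Ξg Ξl Ξh) (ξ : ℕ × ℕ → Ω → Draw Ξg Ξl Ξh)
    {s : Set ((ℕ × ℕ) × Bool)} {i : ℕ × ℕ} (hi : (i, true) ∈ s) :
    Measurable[drawAlgebra c ξ s] fun ω => (ξ i ω).2 :=
  have h : Measurable[drawAlgebra c ξ s] fun ω => (halfDraws c ξ (i, true) ω).2 :=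
    measurable_snd.comp (measurable_iSup_comap (halfDraws c ξ) hi)
  h

omit mΩ in
lemma measurable_fst_draws (c : Draw Ξg Ξl Ξh) (ξ : ℕ × ℕ → Ω → Draw Ξg Ξl Ξh)
    {s : Set ((ℕ × ℕ) × Bool)} {k : ℕ} (hk : ∀ t, ((k, t), false) ∈ s) :
    Measurable[drawAlgebra c ξ s] fun ω t => (ξ (k, t) ω).1 :=
  (@measurable_pi_iff _ _ _ (drawAlgebra c ξ s) _ _).2 fun t => measurable_fst_draw c ξ (hk t)

omit mΩ in
lemma measurable_snd_draws (c : Draw Ξg Ξl Ξh) (ξ : ℕ × ℕ → Ω → Draw Ξg Ξl Ξh)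
    {s : Set ((ℕ × ℕ) × Bool)} {k : ℕ} (hk : ∀ t, ((k, t), true) ∈ s) :
    Measurable[drawAlgebra c ξ s] fun ω t => (ξ (k, t) ω).2 :=
  (@measurable_pi_iff _ _ _ (drawAlgebra c ξ s) _ _).2 fun t => measurable_snd_draw c ξ (hk t)

omit [MeasurableSpace Ξg] [MeasurableSpace Ξl] [MeasurableSpace Ξh] in
lemma stSPG_succ (r : Regime) (p : InfProjection d m) (o : Oracles d m Ξg Ξl Ξh) (γ μ : ℝ)
    (x₁ : Vec d) (y₁ : Vec m) (ξ : ℕ × ℕ → Draw Ξg Ξl Ξh) {k : ℕ} (hk : k ≠ 0) :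
    stSPG r p o γ μ x₁ y₁ ξ (k + 1) =
      (spg p.X γ (fun t => gradX r o (stSPG r p o γ μ x₁ y₁ ξ k).1 (stSPG r p o γ μ x₁ y₁ ξ k).2
        (ξ (k, t)).1) (stSPG r p o γ μ x₁ y₁ ξ k).1 (stageLength γ k),
      spg p.domh μ (fun t => gradY o (stSPG r p o γ μ x₁ y₁ ξ (k + 1)).1 (ξ (k, t)).2)
        (stSPG r p o γ μ x₁ y₁ ξ k).2 (stageLength μ k)) := by
  simp only [stSPG, if_neg hk]

omit [MeasurableSpace Ξg] [MeasurableSpace Ξl] [MeasurableSpace Ξh] in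
lemma stSPG_mem (hp : p.Regular r Gl Ll Lh v D M) (hγ : 0 < γ) (hμ : 0 < μ) (hx₁ : x₁ ∈ p.X)
    (hy₁ : y₁ ∈ p.domh) (ξ : ℕ × ℕ → Draw Ξg Ξl Ξh) (k : ℕ) :
    (stSPG r p o γ μ x₁ y₁ ξ k).1 ∈ p.X ∧ (stSPG r p o γ μ x₁ y₁ ξ k).2 ∈ p.domh := by
  induction k with
  | zero => simpa [stSPG] using ⟨hx₁, hy₁⟩
  | succ k ih =>
    by_cases hk : k = 0
    · subst hk
      simpa [stSPG] using ⟨hx₁, hy₁⟩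
    · rw [stSPG_succ _ _ _ _ _ _ _ _ hk]
      exact ⟨spg_mem hp.isClosed_X hp.convex_X hγ _ ih.1 (stageLength_ne_zero _ _),
        spg_mem hp.isClosed_domh hp.convex_h.1 hμ _ ih.2 (stageLength_ne_zero _ _)⟩

section Measurable

omit mΩ [IsProbabilityMeasure Pg] [IsProbabilityMeasure Pl] [IsProbabilityMeasure Ph]

/-- The `x`-update of stage `k` uses only the first halves of that stage's draws, so the second
halves remain fresh for the `y`-update, whose objective depends on `x_{k+1}`. -/
lemma measurable_stSPG_x_succ (hp : p.Regular r Gl Ll Lh v D M) (ho : o.Regular p Pg Pl Ph σ)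
    (hγ : 0 < γ) (hx₁ : x₁ ∈ p.X) (c : Draw Ξg Ξl Ξh) {k : ℕ} (hk : k ≠ 0)
    (ih : Measurable[drawAlgebra c ξ (pastDraws k)]
      fun ω => stSPG r p o γ μ x₁ y₁ (fun i => ξ i ω) k) :
    Measurable[drawAlgebra c ξ (midDraws k)]
      fun ω => (stSPG r p o γ μ x₁ y₁ (fun i => ξ i ω) (k + 1)).1 := by
  have hle : drawAlgebra c ξ (pastDraws k) ≤ drawAlgebra c ξ (midDraws k) :=
    iSup_comap_mono _ fun q hq => Or.inl hq
  have ih' := ih.mono hle le_rfl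
  simp_rw [congrArg Prod.fst (stSPG_succ r p o γ μ x₁ y₁ _ hk)]
  refine measurable_spg (mΩ := drawAlgebra c ξ (midDraws k))
    (H := fun t ω => gradX r o (stSPG r p o γ μ x₁ y₁ (fun i => ξ i ω) k).1
      (stSPG r p o γ μ x₁ y₁ (fun i => ξ i ω) k).2 (ξ (k, t) ω).1)
    hp.isClosed_X hp.convex_X ⟨x₁, hx₁⟩ hγ (measurable_fst.comp ih') fun t => ?_
  have hd : Measurable[drawAlgebra c ξ (midDraws k)] fun ω => (ξ (k, t) ω).1 :=
    measurable_fst_draw c ξ (Or.inr ⟨rfl, rfl⟩)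
  exact (ho.measurable_gradX r).comp
    ((ih'.comp measurable_fst).prodMk ((hd.comp measurable_fst).prodMk measurable_snd))

lemma measurable_stSPG (hp : p.Regular r Gl Ll Lh v D M) (ho : o.Regular p Pg Pl Ph σ)
    (hγ : 0 < γ) (hμ : 0 < μ) (hx₁ : x₁ ∈ p.X) (hy₁ : y₁ ∈ p.domh) (c : Draw Ξg Ξl Ξh) (k : ℕ) :
    Measurable[drawAlgebra c ξ (pastDraws k)]
      fun ω => stSPG r p o γ μ x₁ y₁ (fun i => ξ i ω) k := by
  induction k with
  | zero => simp [stSPG]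
  | succ k ih =>
    by_cases hk : k = 0
    · subst hk
      simp [stSPG]
    · have hle : drawAlgebra c ξ (pastDraws k) ≤ drawAlgebra c ξ (pastDraws (k + 1)) :=
        iSup_comap_mono _ fun q (hq : q.1.1 < k) => hq.trans k.lt_succ_self
      have hle' : drawAlgebra c ξ (midDraws k) ≤ drawAlgebra c ξ (pastDraws (k + 1)) :=
        iSup_comap_mono _ fun q (hq : q.1.1 < k ∨ (q.1.1 = k ∧ q.2 = false)) =>
          show q.1.1 < k + 1 by omega
      have ih' := ih.mono hle le_rfl
      have hx := (measurable_stSPG_x_succ hp ho hγ hx₁ c hk ih).mono hle' le_rfl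
      have hy : Measurable[drawAlgebra c ξ (pastDraws (k + 1))]
          fun ω => (stSPG r p o γ μ x₁ y₁ (fun i => ξ i ω) (k + 1)).2 := by
        simp_rw [congrArg Prod.snd (stSPG_succ r p o γ μ x₁ y₁ _ hk)]
        refine measurable_spg (mΩ := drawAlgebra c ξ (pastDraws (k + 1)))
          (H := fun t ω => gradY o (stSPG r p o γ μ x₁ y₁ (fun i => ξ i ω) (k + 1)).1
            (ξ (k, t) ω).2)
          hp.isClosed_domh hp.convex_h.1 ⟨y₁, hy₁⟩ hμ (measurable_snd.comp ih') fun t => ?_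
        have hd : Measurable[drawAlgebra c ξ (pastDraws (k + 1))] fun ω => (ξ (k, t) ω).2 :=
          measurable_snd_draw c ξ (show k < k + 1 by omega)
        exact ho.measurable_gradY.comp
          ((hx.comp measurable_fst).prodMk ((hd.comp measurable_fst).prodMk measurable_snd))
      exact hx.prodMk hy

end Measurable

end Trajectory

/-! ### Expected decrease of `f` in one stage. -/

section Expectations

variable {d m : ℕ} {r : Regime} {p : InfProjection d m} {Gl Ll Lh v D M σ γ μ : ℝ}
  {Ξg Ξl Ξh : Type*} [MeasurableSpace Ξg] [MeasurableSpace Ξl] [MeasurableSpace Ξh]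
  {Pg : Measure Ξg} {Pl : Measure Ξl} {Ph : Measure Ξh}
  [IsProbabilityMeasure Pg] [IsProbabilityMeasure Pl] [IsProbabilityMeasure Ph]
  {o : Oracles d m Ξg Ξl Ξh}
  {Ω : Type*} [mΩ : MeasurableSpace Ω] {P : Measure Ω} [IsProbabilityMeasure P]
  {ξ : ℕ × ℕ → Ω → Draw Ξg Ξl Ξh} {x₁ : Vec d} {y₁ : Vec m}

omit [IsProbabilityMeasure Pg] [IsProbabilityMeasure Ph] in
-- The variance bound controls `ℓ(x; ξ)` only relative to `ℓ(x)`, which may be unbounded on `X`. So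
-- the noise level of the `y`-step is random, and only its mean is bounded, by the moment assumption
-- on `x_{k+1}`.
lemma lintegral_momentY_le (ho : o.Regular p Pg Pl Ph σ) {x : Ω → Vec d} (hx : ∀ ω, x ω ∈ p.X)
    (hmom : ∫⁻ ω, ∫⁻ s, ‖o.val (x ω) s‖ₑ ^ 2 ∂Pl ∂P ≤ ENNReal.ofReal (D ^ 2)) {c : ℝ}
    (hc : 0 ≤ c) :
    ∫⁻ ω, ENNReal.ofReal (c * momentY o Pl σ (x ω)) ∂P ≤
      ENNReal.ofReal (c * (2 * σ ^ 2 + 2 * D ^ 2)) := by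
  have h1 : ∀ ω, ENNReal.ofReal (c * momentY o Pl σ (x ω)) = ENNReal.ofReal (c * (2 * σ ^ 2))
      + ENNReal.ofReal (c * 2) * ∫⁻ s, ‖o.val (x ω) s‖ₑ ^ 2 ∂Pl := fun ω => by
    rw [momentY, mul_add, ENNReal.ofReal_add (by positivity) (by positivity)]
    congr 1
    rw [← mul_assoc, ENNReal.ofReal_mul (by positivity),
      ENNReal.ofReal_toReal (ho.lintegral_val_ne_top (hx ω))]
  simp_rw [h1]
  rw [lintegral_add_left measurable_const, lintegral_const_mul' _ _ ENNReal.ofReal_ne_top,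
    lintegral_const, measure_univ, mul_one]
  calc _ ≤ ENNReal.ofReal (c * (2 * σ ^ 2)) + ENNReal.ofReal (c * 2) * ENNReal.ofReal (D ^ 2) := by
        gcongr
    _ = _ := by
        rw [← ENNReal.ofReal_mul (by positivity), ← ENNReal.ofReal_add (by positivity)
          (by positivity)]
        ring_nf

section Independence

lemma iIndepFun_halfDraws (hξ : ∀ i, Measurable (ξ i)) (hind : iIndepFun ξ P)
    (hlaw : ∀ i, P.map (ξ i) = (Pg.prod Pl).prod (Ph.prod Pl)) (c : Draw Ξg Ξl Ξh) :
    iIndepFun (halfDraws c ξ) P := iIndepFun_pairHalf hξ hind hlaw c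

omit [IsProbabilityMeasure P] in
lemma measurable_halfDraws (hξ : ∀ i, Measurable (ξ i)) (c : Draw Ξg Ξl Ξh)
    (q : (ℕ × ℕ) × Bool) : Measurable (halfDraws c ξ q) :=
  (measurable_pairHalf c q.2).comp (hξ q.1)

lemma drawAlgebra_le (hξ : ∀ i, Measurable (ξ i)) (c : Draw Ξg Ξl Ξh)
    (s : Set ((ℕ × ℕ) × Bool)) : drawAlgebra c ξ s ≤ mΩ :=
  iSup₂_le fun q _ => (measurable_halfDraws hξ c q).comap_le

omit [IsProbabilityMeasure Pg] [IsProbabilityMeasure P] in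
lemma stage_fst_draws (hξ : ∀ i, Measurable (ξ i)) (hind : iIndepFun ξ P)
    (hlaw : ∀ i, P.map (ξ i) = (Pg.prod Pl).prod (Ph.prod Pl)) (k : ℕ) :
    (∀ t, Measurable fun ω => (ξ (k, t) ω).1) ∧ iIndepFun (fun t ω => (ξ (k, t) ω).1) P ∧
      ∀ t, P.map (fun ω => (ξ (k, t) ω).1) = Pg.prod Pl := by
  refine ⟨fun t => (hξ _).fst, ?_, fun t => ?_⟩
  · exact (hind.comp (fun _ => Prod.fst) fun _ => measurable_fst).precomp (g := fun t => (k, t))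
      fun t t' h => (Prod.mk.inj h).2
  · have e : Measure.map Prod.fst ((Pg.prod Pl).prod (Ph.prod Pl)) = Pg.prod Pl := by simp
    rw [← e, ← hlaw (k, t), Measure.map_map measurable_fst (hξ _)]
    rfl

omit [IsProbabilityMeasure P] in
lemma stage_snd_draws (hξ : ∀ i, Measurable (ξ i)) (hind : iIndepFun ξ P)
    (hlaw : ∀ i, P.map (ξ i) = (Pg.prod Pl).prod (Ph.prod Pl)) (k : ℕ) :
    (∀ t, Measurable fun ω => (ξ (k, t) ω).2) ∧ iIndepFun (fun t ω => (ξ (k, t) ω).2) P ∧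
      ∀ t, P.map (fun ω => (ξ (k, t) ω).2) = Ph.prod Pl := by
  refine ⟨fun t => (hξ _).snd, ?_, fun t => ?_⟩
  · exact (hind.comp (fun _ => Prod.snd) fun _ => measurable_snd).precomp (g := fun t => (k, t))
      fun t t' h => (Prod.mk.inj h).2
  · have e : Measure.map Prod.snd ((Pg.prod Pl).prod (Ph.prod Pl)) = Ph.prod Pl := by simp
    rw [← e, ← hlaw (k, t), Measure.map_map measurable_snd (hξ _)]
    rfl

end Independence

variable (hp : p.Regular r Gl Ll Lh v D M) (ho : o.Regular p Pg Pl Ph σ)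
  (hγ : 0 < γ) (hμ : 0 < μ) (hx₁ : x₁ ∈ p.X) (hy₁ : y₁ ∈ p.domh)
  (hGl : 0 ≤ Gl) (hLl : 0 ≤ Ll) (hD : 0 ≤ D) (hσ : 0 ≤ σ)
  (hξ : ∀ i, Measurable (ξ i)) (hind : iIndepFun ξ P)
  (hlaw : ∀ i, P.map (ξ i) = (Pg.prod Pl).prod (Ph.prod Pl))
  {x : ℕ → Ω → Vec d} {y : ℕ → Ω → Vec m}
  (hxy : ∀ k ω, (x k ω, y k ω) = stSPG r p o γ μ x₁ y₁ (fun i => ξ i ω) k)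

include hp hγ hμ hx₁ hy₁ hxy

omit [MeasurableSpace Ξg] [MeasurableSpace Ξl] [MeasurableSpace Ξh] mΩ in
lemma iterate_mem (k : ℕ) (ω : Ω) : x k ω ∈ p.X ∧ y k ω ∈ p.domh := by
  have h := stSPG_mem (o := o) hp hγ hμ hx₁ hy₁ (fun i => ξ i ω) k
  rwa [← hxy] at h

include ho hGl hLl hD hσ hξ hind hlaw

/-- Expected decrease of `f` in the `x`-update of stage `k`. -/
theorem x_update_progress {k : ℕ} (hk : 1 ≤ k) {c : ℝ}
    (hc : ∀ a ∈ p.X, ∀ b ∈ p.domh, 0 ≤ p.f a b + c) :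
    ∫⁻ ω, ENNReal.ofReal (p.f (x (k + 1) ω) (y k ω) + c) ∂P
      + ∫⁻ ω, ENNReal.ofReal (γ / 2 * ‖x k ω - exactX r p γ (x k ω) (y k ω)‖ ^ 2) ∂P ≤
      ∫⁻ ω, ENNReal.ofReal (p.f (x k ω) (y k ω) + c) ∂P
        + ENNReal.ofReal (6 * momentX Gl D σ / k) ∧
    ∫⁻ ω, ENNReal.ofReal (‖x (k + 1) ω - exactX r p γ (x k ω) (y k ω)‖ ^ 2) ∂P ≤
      ENNReal.ofReal (2 / γ * (6 * momentX Gl D σ / k)) := by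
  have hmem := iterate_mem hp hγ hμ hx₁ hy₁ hxy
  -- Any sample point supplies the default values that pad the half-draws.
  obtain ⟨ω₀⟩ := nonempty_of_isProbabilityMeasure P
  set e := ξ (0, 0) ω₀
  let A : Ω → p.X × p.domh := fun ω => (⟨x k ω, (hmem k ω).1⟩, ⟨y k ω, (hmem k ω).2⟩)
  have hxyk : (fun ω => stSPG r p o γ μ x₁ y₁ (fun i => ξ i ω) k) = fun ω => (x k ω, y k ω) :=
    funext fun ω => (hxy k ω).symm
  have hst := measurable_stSPG (ξ := ξ) hp ho hγ hμ hx₁ hy₁ e k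
  rw [hxyk] at hst
  have hAm : Measurable[drawAlgebra e ξ (pastDraws k)] A :=
    ((measurable_fst.comp hst).subtype_mk (h := fun ω => (hmem k ω).1)).prodMk
      ((measurable_snd.comp hst).subtype_mk (h := fun ω => (hmem k ω).2))
  have hζm : Measurable[drawAlgebra e ξ {q | q.1.1 = k}] fun ω t => (ξ (k, t) ω).1 :=
    measurable_fst_draws e ξ fun _ => rfl
  have hAζ : IndepFun A (fun ω t => (ξ (k, t) ω).1) P :=
    (iIndepFun_halfDraws hξ hind hlaw e).indepFun_of_measurable_iSup (measurable_halfDraws hξ e)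
      (Set.disjoint_left.2 fun q (h : q.1.1 < k) (h' : q.1.1 = k) => h.ne h') hAm hζm
  obtain ⟨h1, h2, h3⟩ := stage_fst_draws hξ hind hlaw k
  have hfm := (ho.continuous_f hp hσ).measurable
  -- Here `W` is the true objective `f(·, y_k) + c` and `φ` its model, equal at `x_k` after adding
  -- `h(y_k)`.
  have hmain := lintegral_stage_progress (α := p.X × p.domh) (S := p.X) (ν := Pg.prod Pl)
    (φ := fun a => objX r p a.1 a.2) (G := fun a => gradX r o a.1 a.2)
    (B := fun _ => momentX Gl D σ) (z₁ := fun a => a.1) (u := fun a => exactX r p γ a.1 a.2)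
    (A := A) (c := fun a => p.h a.2 + c) (W := fun a z => p.f z a.2 + c)
    (fun a => ho.stochSubgrad_objX hp a.1.2 a.2.2)
    ((ho.measurable_gradX r).comp
      (show Measurable fun q : (p.X × p.domh) × ((Ξg × Ξl) × Vec d) =>
          (((q.1.1 : Vec d), (q.1.2 : Vec m)), q.2) from
        ((measurable_subtype_coe.comp measurable_fst.fst).prodMk
          (measurable_subtype_coe.comp measurable_fst.snd)).prodMk measurable_snd))
    hp.isClosed_X hp.convex_X ⟨x₁, hx₁⟩ hγ (fun a => a.1.2)
    (measurable_subtype_coe.comp measurable_fst) h1 h2 h3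
    (fun a => ho.exactX_isProx hp hγ a.1.2 a.2.2)
    (ho.continuous_exactX hp hGl hLl hD hγ).measurable hk
    ((hfm.comp (measurable_snd.prodMk measurable_fst.snd)).add_const c)
    (fun a z => hc _ z.2 _ a.2.2)
    (fun a z => by have := hp.f_le_objX a.1.2 z.2 a.2.2; linarith)
    (fun a => by have := objX_self r p a.1 a.2; simp only; linarith)
    (hAm.mono (drawAlgebra_le hξ e _) le_rfl) hAζ
  have hnext : ∀ ω, spg p.X γ (fun t => gradX r o (x k ω) (y k ω) (ξ (k, t) ω).1) (x k ω)
      (stageLength γ k) = x (k + 1) ω := fun ω => by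
    have h4 := congrArg Prod.fst (hxy (k + 1) ω)
    rw [congrArg Prod.fst (stSPG_succ r p o γ μ x₁ y₁ _ (show k ≠ 0 by omega)), ← hxy] at h4
    exact h4.symm
  simpa only [A, hnext, lintegral_const, measure_univ, mul_one] using hmain

omit hLl hD in
/-- Expected decrease of `f` in the `y`-update of stage `k`. -/
theorem y_update_progress {k : ℕ} (hk : 1 ≤ k) {c : ℝ}
    (hc : ∀ a ∈ p.X, ∀ b ∈ p.domh, 0 ≤ p.f a b + c)
    (hmom : ∫⁻ ω, ∫⁻ s, ‖o.val (x (k + 1) ω) s‖ₑ ^ 2 ∂Pl ∂P ≤ ENNReal.ofReal (D ^ 2)) :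
    ∫⁻ ω, ENNReal.ofReal (p.f (x (k + 1) ω) (y (k + 1) ω) + c) ∂P
      + ∫⁻ ω, ENNReal.ofReal (μ / 2 * ‖y k ω - exactY p μ (x (k + 1) ω) (y k ω)‖ ^ 2) ∂P ≤
      ∫⁻ ω, ENNReal.ofReal (p.f (x (k + 1) ω) (y k ω) + c) ∂P
        + ENNReal.ofReal (6 / k * (2 * σ ^ 2 + 2 * D ^ 2)) := by
  have hmem := iterate_mem hp hγ hμ hx₁ hy₁ hxy
  obtain ⟨ω₀⟩ := nonempty_of_isProbabilityMeasure P
  set e := ξ (0, 0) ω₀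
  have hk0 : k ≠ 0 := by omega
  let A : Ω → p.X × p.domh := fun ω => (⟨x (k + 1) ω, (hmem (k + 1) ω).1⟩, ⟨y k ω, (hmem k ω).2⟩)
  have hst := measurable_stSPG (ξ := ξ) hp ho hγ hμ hx₁ hy₁ e k
  have hstx := measurable_stSPG_x_succ hp ho hγ hx₁ e hk0 hst
  have hxm : (fun ω => (stSPG r p o γ μ x₁ y₁ (fun i => ξ i ω) (k + 1)).1) = x (k + 1) :=
    funext fun ω => congrArg Prod.fst (hxy (k + 1) ω).symm
  have hxyk : (fun ω => stSPG r p o γ μ x₁ y₁ (fun i => ξ i ω) k) = fun ω => (x k ω, y k ω) :=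
    funext fun ω => (hxy k ω).symm
  rw [hxm] at hstx
  rw [hxyk] at hst
  have hsty : Measurable[drawAlgebra e ξ (midDraws k)] (y k) :=
    (measurable_snd.comp hst).mono (iSup_comap_mono _ fun q hq => Or.inl hq) le_rfl
  have hAm : Measurable[drawAlgebra e ξ (midDraws k)] A :=
    (hstx.subtype_mk (h := fun ω => (hmem (k + 1) ω).1)).prodMk
      (hsty.subtype_mk (h := fun ω => (hmem k ω).2))
  have hζm : Measurable[drawAlgebra e ξ {q | q.1.1 = k ∧ q.2 = true}]
      fun ω t => (ξ (k, t) ω).2 :=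
    measurable_snd_draws e ξ fun _ => ⟨rfl, rfl⟩
  have hAζ : IndepFun A (fun ω t => (ξ (k, t) ω).2) P :=
    (iIndepFun_halfDraws hξ hind hlaw e).indepFun_of_measurable_iSup (measurable_halfDraws hξ e)
      (Set.disjoint_left.2 fun q (h : q.1.1 < k ∨ (q.1.1 = k ∧ q.2 = false))
        (h' : q.1.1 = k ∧ q.2 = true) => by
          -- Disjointness from the draws in `midDraws`: those come from an earlier stage or are
          -- first halves of this one.
          rcases h with h | h
          · exact h.ne h'.1
          · simp [h.2] at h') hAm hζm
  obtain ⟨h1, h2, h3⟩ := stage_snd_draws hξ hind hlaw k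
  have hfm := (ho.continuous_f hp hσ).measurable
  have hmain := (lintegral_stage_progress (α := p.X × p.domh) (S := p.domh) (ν := Ph.prod Pl)
    (φ := fun a => objY p a.1) (G := fun a => gradY o a.1)
    (B := fun a => momentY o Pl σ a.1) (z₁ := fun a => a.2) (u := fun a => exactY p μ a.1 a.2)
    (A := A) (c := fun a => p.g a.1 + c) (W := fun a z => p.f a.1 z + c)
    (fun a => ho.stochSubgrad_objY hp a.1.2)
    (ho.measurable_gradY.comp
      (show Measurable fun q : (p.X × p.domh) × ((Ξh × Ξl) × Vec m) =>
          ((q.1.1 : Vec d), q.2) from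
        (measurable_subtype_coe.comp measurable_fst.fst).prodMk measurable_snd))
    hp.isClosed_domh hp.convex_h.1 ⟨y₁, hy₁⟩ hμ (fun a => a.2.2)
    (measurable_subtype_coe.comp measurable_snd) h1 h2 h3
    (fun a => ho.exactY_isProx hp hμ a.1.2 a.2.2)
    (ho.continuous_exactY hp hGl hμ).measurable hk
    ((hfm.comp (measurable_fst.fst.prodMk measurable_snd)).add_const c)
    (fun a z => hc _ a.1.2 _ z.2)
    (fun a z => by have := objY_add p a.1 z; linarith)
    (fun a => by have := objY_add p a.1 a.2; simp only; linarith)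
    (hAm.mono (drawAlgebra_le hξ e _) le_rfl) hAζ).1
  have hnext : ∀ ω, spg p.domh μ (fun t => gradY o (x (k + 1) ω) (ξ (k, t) ω).2) (y k ω)
      (stageLength μ k) = y (k + 1) ω := fun ω => by
    have h4 := congrArg Prod.snd (hxy (k + 1) ω)
    rw [congrArg Prod.snd (stSPG_succ r p o γ μ x₁ y₁ _ hk0), ← hxy, ← hxy] at h4
    exact h4.symm
  simp only [A, hnext] at hmain
  refine hmain.trans (add_le_add_right ?_ _)
  have hY := lintegral_momentY_le (P := P) ho (fun ω => (hmem (k + 1) ω).1) hmom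
    (c := 6 / k) (by positivity)
  refine le_trans (le_of_eq ?_) hY
  refine lintegral_congr fun ω => ?_
  congr 1
  ring

end Expectations

/-! ### From proximal residuals to stationarity of `F`. -/

section Conjugate

variable {d m : ℕ} {r : Regime} {p : InfProjection d m} {Gl Ll Lh v D M σ γ μ κ : ℝ}

lemma IsProx.subgradient_le {n : ℕ} {S : Set (Vec n)} {φ : Vec n → ℝ} {c u : Vec n}
    (hu : IsProx S φ κ c u) (hφ : ConvexOn ℝ S φ) {z : Vec n} (hz : z ∈ S) :
    φ u - κ * ⟪u - c, z - u⟫_ℝ ≤ φ z := by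
  have h := hu.strong hφ hz
  have h1 : ‖z - c‖ ^ 2 = ‖z - u‖ ^ 2 + 2 * ⟪z - u, u - c⟫_ℝ + ‖u - c‖ ^ 2 := by
    rw [← norm_add_sq_real]
    congr 2
    abel
  rw [h1, real_inner_comm (u - c)] at h
  linarith

lemma BoundedSubgrad.bddAbove_conj {n : ℕ} {S : Set (Vec n)} {φ : Vec n → ℝ} {L : ℝ}
    (hφ : BoundedSubgrad S φ L) (hL : 0 ≤ L) (hD : ∀ y ∈ S, ‖y‖ ≤ D) (s : Vec n) :
    BddAbove (Set.range fun y : S => ⟪(y : Vec n), s⟫_ℝ - φ y) := by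
  rcases S.eq_empty_or_nonempty with rfl | ⟨y₀, hy₀⟩
  · simp
  refine ⟨D * ‖s‖ + L * (D + D) - φ y₀, ?_⟩
  rintro _ ⟨⟨y, hy⟩, rfl⟩
  have h1 := hφ.sub_le hy₀ hy
  have h2 : ‖y₀ - y‖ ≤ D + D := (norm_sub_le _ _).trans (add_le_add (hD _ hy₀) (hD _ hy))
  have h3 : ⟪y, s⟫_ℝ ≤ D * ‖s‖ :=
    (real_inner_le_norm _ _).trans (mul_le_mul_of_nonneg_right (hD _ hy) (norm_nonneg _))
  have h4 := mul_le_mul_of_nonneg_left h2 hL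
  simp only
  linarith

/-- A maximizer in the definition of the conjugate is its gradient. -/
lemma gradient_conjOn_eq {n : ℕ} {S : Set (Vec n)} {φ : Vec n → ℝ} {s w : Vec n}
    (hdiff : Differentiable ℝ (conjOn S φ))
    (hbdd : ∀ s, BddAbove (Set.range fun y : S => ⟪(y : Vec n), s⟫_ℝ - φ y)) (hw : w ∈ S)
    (hmax : ∀ u ∈ S, ⟪u, s⟫_ℝ - φ u ≤ ⟪w, s⟫_ℝ - φ w) : gradient (conjOn S φ) s = w := by
  have hle : ∀ s', ⟪w, s'⟫_ℝ - φ w ≤ conjOn S φ s' := fun s' => le_ciSup (hbdd s') ⟨w, hw⟩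
  have heq : conjOn S φ s = ⟪w, s⟫_ℝ - φ w := by
    have : Nonempty S := ⟨⟨w, hw⟩⟩
    exact le_antisymm (ciSup_le fun y => hmax y y.2) (hle s)
  -- `h* - ⟪w, ·⟫` is bounded below by `-φ w` and attains this value at `s`; its derivative vanishes
  -- there.
  have hmin : IsLocalMin (fun s' => conjOn S φ s' - ⟪w, s'⟫_ℝ) s := by
    refine Eventually.of_forall fun s' => ?_
    have := hle s'
    simp only [heq]
    linarith
  have hd : HasFDerivAt (fun s' => conjOn S φ s' - ⟪w, s'⟫_ℝ)
      (InnerProductSpace.toDual ℝ _ (gradient (conjOn S φ) s) - innerSL ℝ w) s :=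
    (hdiff s).hasGradientAt.hasFDerivAt.sub (innerSL ℝ w).hasFDerivAt
  have h0 := hmin.hasFDerivAt_eq_zero hd
  refine ext_inner_right ℝ fun u => ?_
  have := congrArg (fun A : Vec n →L[ℝ] ℝ => A u) h0
  simpa [sub_eq_zero] using this

/-- No boundedness is involved: for real sets `sInf` is by definition the negative of `sSup` of the
reflected set. -/
lemma InfProjection.F_eq (p : InfProjection d m) (x : Vec d) :
    p.F x = p.g x - conjOn p.domh p.h (p.ℓ x) := by
  rw [InfProjection.F, conjOn, sub_eq_add_neg, iSup, iInf, Real.sInf_def]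
  congr 3
  ext a
  simp [eq_comm, neg_eq_iff_eq_neg]

variable {Ξg Ξl Ξh : Type*} [MeasurableSpace Ξg] [MeasurableSpace Ξl] [MeasurableSpace Ξh]
  {Pg : Measure Ξg} {Pl : Measure Ξl} {Ph : Measure Ξh}
  [IsProbabilityMeasure Pg] [IsProbabilityMeasure Pl] [IsProbabilityMeasure Ph]
  {o : Oracles d m Ξg Ξl Ξh}

omit [IsProbabilityMeasure Ph] in
/-- Optimality of the proximal point gives a Fréchet subgradient of `F`. -/
lemma exists_subgradient_F (hp : p.Regular r Gl Ll Lh v D M) (ho : o.Regular p Pg Pl Ph σ)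
    (hγ : 0 < γ) {x : Vec d} (hx : x ∈ p.X) {y : Vec m} (hy : y ∈ p.domh) :
    ∃ A : Vec d →L[ℝ] Vec m,
      ‖A - p.J (exactX r p γ x y)‖ ≤ Ll * ‖x - exactX r p γ x y‖ ∧
      A.adjoint y - γ • (exactX r p γ x y - x) - (p.J (exactX r p γ x y)).adjoint
        (gradient (conjOn p.domh p.h) (p.ℓ (exactX r p γ x y)))
        ∈ frechetSubdiff p.X p.F (exactX r p γ x y) := by
  have hprox := ho.exactX_isProx hp hγ hx hy
  have hcvx := (ho.stochSubgrad_objX hp hx hy).boundedSubgrad.convexOn hp.convex_X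
  generalize exactX r p γ x y = w at hprox
  -- Subtracting `h* ∘ ℓ` from this inequality shows that increments of `F` from `w` dominate those
  -- of a function differentiable at `w`. The two cases differ only in the Jacobian `A` multiplying
  -- `y`: `J x` for the linearized model, `J w` otherwise.
  have hsub := fun u hu => hprox.subgradient_le (z := u) hcvx hu
  have hw := hprox.1
  have hJ := hp.hasFDeriv_l w hw
  have hconj : HasFDerivWithinAt (fun u => conjOn p.domh p.h (p.ℓ u))
      ((InnerProductSpace.toDual ℝ _ (gradient (conjOn p.domh p.h) (p.ℓ w))).comp (p.J w)) p.X w :=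
    (hp.differentiable_conj (p.ℓ w)).hasGradientAt.hasFDerivAt.comp_hasFDerivWithinAt w hJ
  have hquad : HasFDerivWithinAt (fun u => γ * ⟪w - x, u⟫_ℝ) (γ • innerSL ℝ (w - x)) p.X w :=
    ((innerSL ℝ (w - x)).hasFDerivAt.const_mul γ).hasFDerivWithinAt
  cases r with
  | dc =>
    refine ⟨p.J x, hp.smooth_l x hx w hw, ?_⟩
    have hlin : HasFDerivWithinAt (fun u => ⟪y, p.J x u⟫_ℝ) ((innerSL ℝ y).comp (p.J x)) p.X w :=
      ((innerSL ℝ y).comp (p.J x)).hasFDerivAt.hasFDerivWithinAt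
    refine mem_frechetSubdiff_of_hasFDerivWithinAt hw ((hlin.sub hquad).sub hconj)
      (fun u hu => ?_) fun u => ?_
    · have := hsub u hu
      simp only [objX, map_sub, inner_add_right, inner_sub_right] at this
      simp only [InfProjection.F_eq, Pi.sub_apply]
      linarith
    · simp [inner_sub_left, real_inner_smul_left, ContinuousLinearMap.adjoint_inner_left]
  | biconvex =>
    refine ⟨p.J w, by
      rw [sub_self, norm_zero]
      exact (norm_nonneg _).trans (hp.smooth_l x hx w hw), ?_⟩
    have hlin : HasFDerivWithinAt (fun u => ⟪y, p.ℓ u⟫_ℝ) ((innerSL ℝ y).comp (p.J w)) p.X w :=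
      (innerSL ℝ y).hasFDerivAt.comp_hasFDerivWithinAt w hJ
    refine mem_frechetSubdiff_of_hasFDerivWithinAt hw ((hlin.sub hquad).sub hconj)
      (fun u hu => ?_) fun u => ?_
    · have := hsub u hu
      simp only [objX, inner_sub_right] at this
      simp only [InfProjection.F_eq, Pi.sub_apply]
      linarith
    · simp [inner_sub_left, real_inner_smul_left, ContinuousLinearMap.adjoint_inner_left]

omit [IsProbabilityMeasure Pg] in
/-- Distance from `y` to the gradient of the conjugate, through the proximal `y`-step. -/
lemma norm_sub_gradient_conj_le (hp : p.Regular r Gl Ll Lh v D M) (ho : o.Regular p Pg Pl Ph σ)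
    (hσ : 0 ≤ σ) (hμ : 0 < μ) (hv : 0 ≤ v) (hLh : 0 ≤ Lh) {x' z : Vec d} (hx' : x' ∈ p.X)
    (hz : z ∈ p.X) {y : Vec m} (hy : y ∈ p.domh) :
    ‖y - gradient (conjOn p.domh p.h) (p.ℓ z)‖ ≤ ‖y - exactY p μ x' y‖
      + Lh * (Gl * ‖x' - z‖ + μ * ‖y - exactY p μ x' y‖) ^ v := by
  have hprox := ho.exactY_isProx hp hμ hx' hy
  have hcvx := (ho.stochSubgrad_objY hp hx').boundedSubgrad.convexOn hp.convex_h.1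
  generalize exactY p μ x' y = w at hprox
  -- Optimality of the proximal `y`-step says that `ℓ(x') - μ (w - y)` is a subgradient of `h` at
  -- `w`; conjugation inverts this.
  have hgrad : gradient (conjOn p.domh p.h) (p.ℓ x' - μ • (w - y)) = w := by
    refine gradient_conjOn_eq hp.differentiable_conj
      ((ho.boundedSubgrad_h hp hσ).bddAbove_conj hσ hp.norm_le_of_mem_domh) hprox.1 fun u hu => ?_
    have := hprox.subgradient_le hcvx hu
    simp only [objY] at this
    have e : ⟪w - y, u - w⟫_ℝ = ⟪u, w - y⟫_ℝ - ⟪w, w - y⟫_ℝ := by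
      rw [real_inner_comm, inner_sub_left]
    rw [inner_sub_right u (p.ℓ x'), inner_sub_right w (p.ℓ x'), real_inner_smul_right,
      real_inner_smul_right]
    rw [e] at this
    linarith
  have h1 := hp.holder_conj (p.ℓ x' - μ • (w - y)) (p.ℓ z)
  rw [hgrad] at h1
  have h2 : ‖p.ℓ x' - μ • (w - y) - p.ℓ z‖ ≤ Gl * ‖x' - z‖ + μ * ‖y - w‖ := by
    rw [show p.ℓ x' - μ • (w - y) - p.ℓ z = (p.ℓ x' - p.ℓ z) - μ • (w - y) by abel]
    refine (norm_sub_le _ _).trans (add_le_add (hp.norm_l_sub_le hx' hz) ?_)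
    rw [norm_smul, Real.norm_of_nonneg hμ.le, norm_sub_rev]
  have h3 : ‖y - gradient (conjOn p.domh p.h) (p.ℓ z)‖ ≤
      ‖y - w‖ + ‖w - gradient (conjOn p.domh p.h) (p.ℓ z)‖ := norm_sub_le_norm_sub_add_norm_sub _ _ _
  refine h3.trans (add_le_add_right (h1.trans ?_) _)
  gcongr

/-- Stationarity of the proximal point, in terms of the distances between the iterates of a stage
and the exact solutions. -/
theorem infEDist_limitingSubdiff_le (hp : p.Regular r Gl Ll Lh v D M)
    (ho : o.Regular p Pg Pl Ph σ) (hσ : 0 ≤ σ) (hγ : 0 < γ) (hμ : 0 < μ) (hv : 0 ≤ v)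
    (hLh : 0 ≤ Lh) (hGl : 0 ≤ Gl) (hLl : 0 ≤ Ll) {x x' : Vec d} (hx : x ∈ p.X) (hx' : x' ∈ p.X)
    {y : Vec m} (hy : y ∈ p.domh) :
    Metric.infEDist 0 (limitingSubdiff p.X p.F (exactX r p γ x y)) ≤ ENNReal.ofReal
      ((γ + D * Ll) * ‖x - exactX r p γ x y‖ + Gl * (‖y - exactY p μ x' y‖
        + Lh * (Gl * ‖x' - exactX r p γ x y‖ + μ * ‖y - exactY p μ x' y‖) ^ v)) := by
  obtain ⟨A, hA, hmem⟩ := exists_subgradient_F hp ho hγ hx hy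
  have hz := (ho.exactX_isProx hp hγ hx hy).1
  have hq := norm_sub_gradient_conj_le hp ho hσ hμ hv hLh hx' hz hy
  refine (Metric.infEDist_le_edist_of_mem (frechetSubdiff_subset_limitingSubdiff hmem)).trans ?_
  rw [edist_comm, edist_zero_right, ← ofReal_norm]
  refine ENNReal.ofReal_le_ofReal ?_
  generalize exactX r p γ x y = z at *
  set q := gradient (conjOn p.domh p.h) (p.ℓ z)
  -- Adding and subtracting `(J z)ᵀ y` separates the linearization error from the distance of `y` to
  -- the optimal dual point `q`.
  have heq : A.adjoint y - γ • (z - x) - (p.J z).adjoint q =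
      (A - p.J z).adjoint y - γ • (z - x) + (p.J z).adjoint (y - q) := by
    rw [map_sub (p.J z).adjoint, map_sub ContinuousLinearMap.adjoint, sub_apply]
    abel
  have hadj : ∀ (B : Vec d →L[ℝ] Vec m) (u : Vec m), ‖B.adjoint u‖ ≤ ‖B‖ * ‖u‖ := fun B u => by
    have := B.adjoint.le_opNorm u
    rwa [LinearIsometryEquiv.norm_map] at this
  have h1 : ‖(A - p.J z).adjoint y‖ ≤ D * Ll * ‖x - z‖ := by
    have hyD := hp.norm_le_of_mem_domh y hy
    calc _ ≤ ‖A - p.J z‖ * ‖y‖ := hadj _ _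
      _ ≤ Ll * ‖x - z‖ * D := by gcongr
      _ = _ := by ring
  have h2 : ‖(p.J z).adjoint (y - q)‖ ≤ Gl * (‖y - exactY p μ x' y‖
      + Lh * (Gl * ‖x' - z‖ + μ * ‖y - exactY p μ x' y‖) ^ v) := by
    have hJz := hp.lipschitz_l z hz
    calc _ ≤ ‖p.J z‖ * ‖y - q‖ := hadj _ _
      _ ≤ _ := by gcongr
  have h3 : ‖γ • (z - x)‖ = γ * ‖x - z‖ := by
    rw [norm_smul, Real.norm_of_nonneg hγ.le, norm_sub_rev]
  rw [heq]
  refine (norm_add_le _ _).trans ?_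
  have h4 := norm_sub_le ((A - p.J z).adjoint y) (γ • (z - x))
  linarith

end Conjugate

/-! ### Power bounds and weighted summation. -/

section RealBounds

/-- With `t = s / l`, this is `t^q ≤ max(1, t) ≤ 1 + t`. Being affine in `s`, the bound survives
expectation and takes the place of Jensen's inequality. -/
lemma rpow_le_rpow_mul_one_add {s l q : ℝ} (hs : 0 ≤ s) (hl : 0 < l) (hq0 : 0 ≤ q) (hq1 : q ≤ 1) :
    s ^ q ≤ l ^ q * (1 + s / l) := by
  have h1 : s ^ q = l ^ q * (s / l) ^ q := by
    rw [← Real.mul_rpow hl.le (by positivity), mul_div_cancel₀ _ hl.ne']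
  rw [h1]
  have ht : 0 ≤ s / l := by positivity
  generalize s / l = t at ht
  refine mul_le_mul_of_nonneg_left ?_ (by positivity)
  rcases le_total t 1 with h | h
  · have := Real.rpow_le_one ht h hq0
    linarith
  · have := Real.rpow_le_rpow_of_exponent_le h hq1
    rw [Real.rpow_one] at this
    linarith

/-- Bernoulli's inequality at `-1 / (K + 1)` gives `(K + 1)^(α + 1) - K^(α + 1) ≤ (α + 1)(K + 1)^α`.
-/
lemma rpow_add_one_le_sum {α : ℝ} (hα : 0 ≤ α) (K : ℕ) :
    (K : ℝ) ^ (α + 1) ≤ (α + 1) * ∑ k ∈ Finset.Icc 1 K, (k : ℝ) ^ α := by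
  induction K with
  | zero => simp [Real.zero_rpow (show α + 1 ≠ 0 by positivity)]
  | succ K ih =>
    rw [Finset.sum_Icc_succ_top (by omega), mul_add]
    have hK : (0 : ℝ) < K + 1 := by positivity
    have h1 := one_add_mul_self_le_rpow_one_add (s := -1 / (K + 1 : ℝ)) (p := α + 1)
      (by rw [le_div_iff₀ hK]; nlinarith [Nat.cast_nonneg (α := ℝ) K]) (by linarith)
    have h2 : 1 + -1 / (K + 1 : ℝ) = K / (K + 1) := by field_simp; ring
    rw [h2, Real.div_rpow (Nat.cast_nonneg K) hK.le, le_div_iff₀ (by positivity)] at h1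
    have h3 : ((K : ℝ) + 1) ^ (α + 1) = (K + 1) ^ α * (K + 1) := by
      rw [Real.rpow_add hK, Real.rpow_one]
    have h4 : (1 + (α + 1) * (-1 / (K + 1 : ℝ))) * ((K : ℝ) + 1) ^ (α + 1) =
        (K + 1) ^ (α + 1) - (α + 1) * (K + 1) ^ α := by
      rw [h3]
      field_simp
      ring
    push_cast
    linarith

/-- Summation by parts with the weights `k ^ α`. -/
lemma sum_rpow_mul_le_of_progress {α M q : ℝ} (hα : 1 ≤ α) (hq : 0 ≤ q) {a e : ℕ → ℝ}
    (ha : ∀ k, a k ≤ M) {K : ℕ}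
    (h : ∀ k ∈ Finset.Icc 1 K, a (k + 1) + e k ≤ a k + q / k) :
    ∑ k ∈ Finset.Icc 1 K, (k : ℝ) ^ α * e k + (K : ℝ) ^ α * a (K + 1) ≤ (M + q) * (K : ℝ) ^ α := by
  have hα0 : 0 < α := by linarith
  have key : ∀ J ≤ K, ∑ k ∈ Finset.Icc 1 J, (k : ℝ) ^ α * e k + (J : ℝ) ^ α * a (J + 1) ≤
      M * (J : ℝ) ^ α + q * ∑ k ∈ Finset.Icc 1 J, (k : ℝ) ^ (α - 1) := by
    intro J hJ
    induction J with
    | zero => simp [Real.zero_rpow hα0.ne']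
    | succ J ih =>
      have ih := ih (by omega)
      rw [Finset.sum_Icc_succ_top (by omega), Finset.sum_Icc_succ_top (by omega)]
      have h1 := h (J + 1) (Finset.mem_Icc.2 ⟨by omega, hJ⟩)
      push_cast at h1 ⊢
      have hJ1 : (0 : ℝ) < J + 1 := by positivity
      have hw : 0 ≤ ((J : ℝ) + 1) ^ α := by positivity
      have h2 := mul_le_mul_of_nonneg_left h1 hw
      have h3 : ((J : ℝ) + 1) ^ α * (q / (J + 1)) = q * ((J : ℝ) + 1) ^ (α - 1) := by
        rw [Real.rpow_sub hJ1, Real.rpow_one]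
        ring
      -- Weights increase, so the increments `(J + 1)^α - J^α` multiply the upper bound `M` and
      -- telescope to `M K^α`.
      have h4 : (J : ℝ) ^ α ≤ ((J : ℝ) + 1) ^ α := by gcongr; linarith
      have h5 := mul_le_mul_of_nonneg_left (ha (J + 1)) (sub_nonneg.2 h4)
      nlinarith
  refine (key K le_rfl).trans ?_
  -- Since `α ≥ 1`, every summand is at most the last one.
  have h1 : ∑ k ∈ Finset.Icc 1 K, (k : ℝ) ^ (α - 1) ≤ (K : ℝ) ^ α := by
    calc ∑ k ∈ Finset.Icc 1 K, (k : ℝ) ^ (α - 1)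
        ≤ ∑ _k ∈ Finset.Icc 1 K, (K : ℝ) ^ (α - 1) := by
          refine Finset.sum_le_sum fun k hk => ?_
          have := (Finset.mem_Icc.1 hk).2
          gcongr
      _ = (K : ℝ) * (K : ℝ) ^ (α - 1) := by simp
      _ ≤ (K : ℝ) ^ α := by
          rcases K.eq_zero_or_pos with rfl | hK
          · simp [Real.zero_rpow_nonneg]
          · have hK' : (0 : ℝ) < K := by exact_mod_cast hK
            rw [Real.rpow_sub hK', Real.rpow_one, mul_div_cancel₀ _ hK'.ne']
  have := mul_le_mul_of_nonneg_left h1 hq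
  linarith

lemma ENNReal_sum_rpow_mul_le {α M q : ℝ} (hα : 1 ≤ α) (hq : 0 ≤ q) (hM : 0 ≤ M)
    {a e : ℕ → ℝ≥0∞} (ha : ∀ k, a k ≤ ENNReal.ofReal M) {K : ℕ}
    (h : ∀ k ∈ Finset.Icc 1 K, a (k + 1) + e k ≤ a k + ENNReal.ofReal (q / k)) :
    ∑ k ∈ Finset.Icc 1 K, ENNReal.ofReal ((k : ℝ) ^ α) * e k ≤
      ENNReal.ofReal ((M + q) * (K : ℝ) ^ α) := by
  have hat : ∀ k, a k ≠ ∞ := fun k => ((ha k).trans_lt ENNReal.ofReal_lt_top).ne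
  have het : ∀ k ∈ Finset.Icc 1 K, e k ≠ ∞ := fun k hk =>
    (((le_add_left le_rfl).trans (h k hk)).trans_lt
      (ENNReal.add_lt_top.2 ⟨(hat k).lt_top, ENNReal.ofReal_lt_top⟩)).ne
  have hreal := sum_rpow_mul_le_of_progress hα hq (a := fun k => (a k).toReal)
    (e := fun k => (e k).toReal) (M := M) (fun k => ENNReal.toReal_le_of_le_ofReal hM (ha k))
    (K := K) fun k hk => by
      have h1 := ENNReal.toReal_mono (ENNReal.add_ne_top.2 ⟨hat k, ENNReal.ofReal_ne_top⟩) (h k hk)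
      rwa [ENNReal.toReal_add (hat _) (het k hk), ENNReal.toReal_add (hat _) ENNReal.ofReal_ne_top,
        ENNReal.toReal_ofReal (by positivity)] at h1
  have hnn : 0 ≤ (K : ℝ) ^ α * (a (K + 1)).toReal := by positivity
  calc _ = ∑ k ∈ Finset.Icc 1 K, ENNReal.ofReal ((k : ℝ) ^ α * (e k).toReal) := by
        refine Finset.sum_congr rfl fun k hk => ?_
        rw [ENNReal.ofReal_mul (by positivity), ENNReal.ofReal_toReal (het k hk)]
    _ = ENNReal.ofReal (∑ k ∈ Finset.Icc 1 K, (k : ℝ) ^ α * (e k).toReal) :=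
        (ENNReal.ofReal_sum_of_nonneg fun k _ => by positivity).symm
    _ ≤ _ := ENNReal.ofReal_le_ofReal (by linarith)

end RealBounds

/-! ### Sampling the stage. -/

section RandomIndex

variable {Ω : Type*} {mΩ : MeasurableSpace Ω} {P : Measure Ω} [IsProbabilityMeasure P]

/-- Expectation of a process evaluated at an independent random time. -/
lemma lintegral_random_index {β : Type*} [MeasurableSpace β] {τ : Ω → ℕ} (hτ : Measurable τ)
    {W : Ω → β} (hW : Measurable W) (hind : IndepFun τ W P) {w : ℕ → ℝ} (hw : ∀ k, 0 ≤ w k)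
    {I : Finset ℕ} (hw1 : ∑ k ∈ I, w k = 1)
    (hτw : ∀ k ∈ I, P (τ ⁻¹' {k}) = ENNReal.ofReal (w k)) {φ : ℕ → Ω → ℝ≥0∞}
    (hφ : ∀ k, Measurable[MeasurableSpace.comap W inferInstance] (φ k)) :
    ∫⁻ ω, φ (τ ω) ω ∂P = ∑ k ∈ I, ENNReal.ofReal (w k) * ∫⁻ ω, φ k ω ∂P := by
  have hmeas : ∀ k, MeasurableSet (τ ⁻¹' {k}) := fun k => hτ (measurableSet_singleton k)
  -- The prescribed probabilities on `I` sum to one, so `τ` has no mass elsewhere.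
  have hI : P (τ ⁻¹' I) = 1 := by
    have h1 : τ ⁻¹' (I : Set ℕ) = ⋃ k ∈ I, τ ⁻¹' {k} := by ext; simp
    rw [h1, measure_biUnion_finset (fun i _ j _ hij => Set.disjoint_left.2 fun ω hi hj =>
      hij (by rw [← Set.mem_singleton_iff.1 hi, ← Set.mem_singleton_iff.1 hj])) fun k _ => hmeas k,
      Finset.sum_congr rfl hτw, ← ENNReal.ofReal_sum_of_nonneg fun k _ => hw k, hw1,
      ENNReal.ofReal_one]
  have hae : ∀ᵐ ω ∂P, τ ω ∈ I := by
    have h2 : MeasurableSet (τ ⁻¹' (I : Set ℕ)) := hτ I.measurableSet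
    exact (prob_compl_eq_zero_iff h2).2 hI
  have h3 : ∫⁻ ω, φ (τ ω) ω ∂P =
      ∫⁻ ω, ∑ k ∈ I, (τ ⁻¹' {k}).indicator 1 ω * φ k ω ∂P := by
    refine lintegral_congr_ae ?_
    filter_upwards [hae] with ω hω
    rw [Finset.sum_eq_single_of_mem (τ ω) hω]
    · simp
    · intro k _ hk
      simp [hk.symm]
  have hle : MeasurableSpace.comap W inferInstance ≤ mΩ := hW.comap_le
  have hm : ∀ k ∈ I, Measurable fun ω => (τ ⁻¹' {k}).indicator 1 ω * φ k ω := fun k _ =>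
    (measurable_one.indicator (hmeas k)).mul ((hφ k).mono hle le_rfl)
  rw [h3, lintegral_finsetSum _ hm]
  refine Finset.sum_congr rfl fun k hk => ?_
  have hi : Measurable[MeasurableSpace.comap τ inferInstance]
      ((τ ⁻¹' {k}).indicator (1 : Ω → ℝ≥0∞)) :=
    (measurable_of_countable (Set.indicator {k} 1)).comp (comap_measurable τ)
  rw [lintegral_mul_eq_lintegral_mul_lintegral_of_independent_measurableSpace
    (Mf := MeasurableSpace.comap τ inferInstance) (Mg := MeasurableSpace.comap W inferInstance)
    hτ.comap_le hle ((IndepFun_iff_Indep _ _ _).1 hind)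
    hi (hφ k),
    lintegral_indicator_one (hmeas k), hτw k hk]

end RandomIndex

/-! ### The stage gap and its mean at the random stage. -/

section Stage

/-- Squared distances that bound the stationarity of the exact `x`-step of a stage. -/
def stageGap {d m : ℕ} (r : Regime) (p : InfProjection d m) (γ μ : ℝ) (x x' : Vec d)
    (y : Vec m) : ℝ :=
  ‖x - exactX r p γ x y‖ ^ 2 + ‖y - exactY p μ x' y‖ ^ 2 + ‖x' - exactX r p γ x y‖ ^ 2

lemma stageGap_nonneg {d m : ℕ} (r : Regime) (p : InfProjection d m) (γ μ : ℝ) (x x' : Vec d)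
    (y : Vec m) : 0 ≤ stageGap r p γ μ x x' y := by
  unfold stageGap
  positivity

variable {d m : ℕ} {r : Regime} {p : InfProjection d m} {Gl Ll Lh v D M σ γ μ : ℝ}
  {Ξg Ξl Ξh : Type*} [MeasurableSpace Ξg] [MeasurableSpace Ξl] [MeasurableSpace Ξh]
  {Pg : Measure Ξg} {Pl : Measure Ξl} {Ph : Measure Ξh}
  [IsProbabilityMeasure Pg] [IsProbabilityMeasure Pl] [IsProbabilityMeasure Ph]
  {o : Oracles d m Ξg Ξl Ξh}

lemma norm_sub_exactX_le_rpow {l : ℝ} (hl : 0 < l) (x x' : Vec d) (y : Vec m) :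
    ‖x - exactX r p γ x y‖ ≤ l ^ (1 / 2 : ℝ) * (1 + stageGap r p γ μ x x' y / l) := by
  refine le_trans ?_ (rpow_le_rpow_mul_one_add (stageGap_nonneg r p γ μ x x' y) hl
    (by norm_num) (by norm_num))
  rw [← Real.sqrt_eq_rpow]
  refine Real.le_sqrt_of_sq_le ?_
  unfold stageGap
  nlinarith [sq_nonneg ‖y - exactY p μ x' y‖, sq_nonneg ‖x' - exactX r p γ x y‖]

/-- Each residual norm is at most `√gap`; the Hölder term contributes `gap^(v/2)` and the others
`gap^(1/2)`. Both powers are replaced by the same bound, affine in the gap. -/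
theorem infEDist_limitingSubdiff_le_rpow (hp : p.Regular r Gl Ll Lh v D M)
    (ho : o.Regular p Pg Pl Ph σ) (hσ : 0 ≤ σ) (hγ : 0 < γ) (hμ : 0 < μ) (hv : 0 ≤ v)
    (hv1 : v ≤ 1) (hLh : 0 ≤ Lh) (hGl : 0 ≤ Gl) (hLl : 0 ≤ Ll) (hD : 0 ≤ D) {x x' : Vec d}
    (hx : x ∈ p.X) (hx' : x' ∈ p.X) {y : Vec m} (hy : y ∈ p.domh) {l : ℝ} (hl : 0 < l)
    (hl1 : l ≤ 1) :
    Metric.infEDist 0 (limitingSubdiff p.X p.F (exactX r p γ x y)) ≤ ENNReal.ofReal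
      (((γ + D * Ll) + Gl * (1 + Lh * (Gl + μ) ^ v)) * l ^ (v / 2)
        * (1 + stageGap r p γ μ x x' y / l)) := by
  refine (infEDist_limitingSubdiff_le hp ho hσ hγ hμ hv hLh hGl hLl hx hx' hy).trans
    (ENNReal.ofReal_le_ofReal ?_)
  have hs := stageGap_nonneg r p γ μ x x' y
  have h1 : √(stageGap r p γ μ x x' y) ≤ l ^ (v / 2) * (1 + stageGap r p γ μ x x' y / l) := by
    rw [Real.sqrt_eq_rpow]
    refine (rpow_le_rpow_mul_one_add hs hl (by norm_num) (by norm_num)).trans ?_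
    refine mul_le_mul_of_nonneg_right ?_ (by positivity)
    -- Because `l ≤ 1` and `v ≤ 1`, the Hölder power `l^(v/2)` is the larger one.
    exact Real.rpow_le_rpow_of_exponent_ge hl hl1 (by linarith)
  have h2 : √(stageGap r p γ μ x x' y) ^ v ≤
      l ^ (v / 2) * (1 + stageGap r p γ μ x x' y / l) := by
    rw [Real.sqrt_eq_rpow, ← Real.rpow_mul hs, one_div_mul_eq_div]
    exact rpow_le_rpow_mul_one_add hs hl (by linarith) (by linarith)
  have hA : ‖x - exactX r p γ x y‖ ≤ √(stageGap r p γ μ x x' y) := by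
    refine Real.le_sqrt_of_sq_le ?_
    unfold stageGap
    nlinarith [sq_nonneg ‖y - exactY p μ x' y‖, sq_nonneg ‖x' - exactX r p γ x y‖]
  have hB : ‖y - exactY p μ x' y‖ ≤ √(stageGap r p γ μ x x' y) := by
    refine Real.le_sqrt_of_sq_le ?_
    unfold stageGap
    nlinarith [sq_nonneg ‖x - exactX r p γ x y‖, sq_nonneg ‖x' - exactX r p γ x y‖]
  have hC : ‖x' - exactX r p γ x y‖ ≤ √(stageGap r p γ μ x x' y) := by
    refine Real.le_sqrt_of_sq_le ?_
    unfold stageGap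
    nlinarith [sq_nonneg ‖y - exactY p μ x' y‖, sq_nonneg ‖x - exactX r p γ x y‖]
  have h3 : (Gl * ‖x' - exactX r p γ x y‖ + μ * ‖y - exactY p μ x' y‖) ^ v ≤
      (Gl + μ) ^ v * (l ^ (v / 2) * (1 + stageGap r p γ μ x x' y / l)) := by
    calc (Gl * ‖x' - exactX r p γ x y‖ + μ * ‖y - exactY p μ x' y‖) ^ v
        ≤ ((Gl + μ) * √(stageGap r p γ μ x x' y)) ^ v := by
          refine Real.rpow_le_rpow (by positivity) ?_ hv
          rw [add_mul]
          gcongr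
      _ = (Gl + μ) ^ v * √(stageGap r p γ μ x x' y) ^ v :=
          Real.mul_rpow (by positivity) (Real.sqrt_nonneg _)
      _ ≤ _ := by gcongr
  have h4 := hA.trans h1
  have h5 := hB.trans h1
  rw [mul_assoc]
  generalize l ^ (v / 2) * (1 + stageGap r p γ μ x x' y / l) = t at h3 h4 h5
  calc _ ≤ (γ + D * Ll) * t + Gl * (t + Lh * ((Gl + μ) ^ v * t)) := by gcongr
    _ = _ := by ring

variable {Ω : Type*} [mΩ : MeasurableSpace Ω] {P : Measure Ω} [IsProbabilityMeasure P]
  {ξ : ℕ × ℕ → Ω → Draw Ξg Ξl Ξh} {x₁ : Vec d} {y₁ : Vec m}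

lemma measurable_ofReal_stageGap {x x' : Ω → Vec d} {y : Ω → Vec m}
    (hmeas : Measurable fun ω => (x ω - exactX r p γ (x ω) (y ω), y ω - exactY p μ (x' ω) (y ω),
      x' ω - exactX r p γ (x ω) (y ω))) :
    Measurable fun ω => ENNReal.ofReal (stageGap r p γ μ (x ω) (x' ω) (y ω)) := by
  have h1 : Measurable fun ω => x ω - exactX r p γ (x ω) (y ω) := hmeas.fst
  have h2 : Measurable fun ω => y ω - exactY p μ (x' ω) (y ω) := hmeas.snd.fst
  have h3 : Measurable fun ω => x' ω - exactX r p γ (x ω) (y ω) := hmeas.snd.snd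
  unfold stageGap
  exact (((h1.norm.pow_const 2).add (h2.norm.pow_const 2)).add (h3.norm.pow_const 2)).ennreal_ofReal

omit [IsProbabilityMeasure P] in
-- The factor `2/γ + 2/μ + 1` undoes the weights `γ/2`, `μ/2` and `1` with which the residuals
-- appear in the descent inequality.
lemma lintegral_stageGap_le (hγ : 0 < γ) (hμ : 0 < μ) {x x' : Ω → Vec d} {y : Ω → Vec m}
    (hmeas : Measurable fun ω => (x ω - exactX r p γ (x ω) (y ω), y ω - exactY p μ (x' ω) (y ω),
      x' ω - exactX r p γ (x ω) (y ω))) :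
    ∫⁻ ω, ENNReal.ofReal (stageGap r p γ μ (x ω) (x' ω) (y ω)) ∂P ≤
      ENNReal.ofReal (2 / γ + 2 / μ + 1) *
        (∫⁻ ω, ENNReal.ofReal (γ / 2 * ‖x ω - exactX r p γ (x ω) (y ω)‖ ^ 2) ∂P
          + ∫⁻ ω, ENNReal.ofReal (μ / 2 * ‖y ω - exactY p μ (x' ω) (y ω)‖ ^ 2) ∂P
          + ∫⁻ ω, ENNReal.ofReal (‖x' ω - exactX r p γ (x ω) (y ω)‖ ^ 2) ∂P) := by
  have h1 : 1 ≤ (2 / γ + 2 / μ + 1) * (γ / 2) := by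
    have : (2 / γ + 2 / μ + 1) * (γ / 2) = 1 + (2 / μ + 1) * (γ / 2) := by field_simp; ring
    rw [this]
    exact le_add_of_nonneg_right (by positivity)
  have h2 : 1 ≤ (2 / γ + 2 / μ + 1) * (μ / 2) := by
    have : (2 / γ + 2 / μ + 1) * (μ / 2) = 1 + (2 / γ + 1) * (μ / 2) := by field_simp; ring
    rw [this]
    exact le_add_of_nonneg_right (by positivity)
  have h3 : 1 ≤ 2 / γ + 2 / μ + 1 := le_add_of_nonneg_left (by positivity)
  have hm1 : Measurable fun ω => ENNReal.ofReal (γ / 2 * ‖x ω - exactX r p γ (x ω) (y ω)‖ ^ 2) :=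
    ((hmeas.fst.norm.pow_const 2).const_mul (γ / 2)).ennreal_ofReal
  have hm2 : Measurable fun ω => ENNReal.ofReal (γ / 2 * ‖x ω - exactX r p γ (x ω) (y ω)‖ ^ 2)
      + ENNReal.ofReal (μ / 2 * ‖y ω - exactY p μ (x' ω) (y ω)‖ ^ 2) :=
    hm1.add ((hmeas.snd.fst.norm.pow_const 2).const_mul (μ / 2)).ennreal_ofReal
  rw [← lintegral_add_left hm1, ← lintegral_add_left hm2,
    ← lintegral_const_mul' _ _ ENNReal.ofReal_ne_top]
  refine lintegral_mono fun ω => ?_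
  rw [← ENNReal.ofReal_add (by positivity) (by positivity),
    ← ENNReal.ofReal_add (by positivity) (by positivity), ← ENNReal.ofReal_mul (by positivity)]
  refine ENNReal.ofReal_le_ofReal ?_
  rw [stageGap, mul_add, mul_add, ← mul_assoc, ← mul_assoc]
  exact add_le_add (add_le_add (le_mul_of_one_le_left (sq_nonneg _) h1)
    (le_mul_of_one_le_left (sq_nonneg _) h2)) (le_mul_of_one_le_left (sq_nonneg _) h3)

variable (hp : p.Regular r Gl Ll Lh v D M) (ho : o.Regular p Pg Pl Ph σ)
  (hγ : 0 < γ) (hμ : 0 < μ) (hx₁ : x₁ ∈ p.X) (hy₁ : y₁ ∈ p.domh)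
  (hGl : 0 ≤ Gl) (hLl : 0 ≤ Ll) (hD : 0 ≤ D) (hσ : 0 ≤ σ)
  (hξ : ∀ i, Measurable (ξ i)) (hind : iIndepFun ξ P)
  (hlaw : ∀ i, P.map (ξ i) = (Pg.prod Pl).prod (Ph.prod Pl))
  {x : ℕ → Ω → Vec d} {y : ℕ → Ω → Vec m}
  (hxy : ∀ k ω, (x k ω, y k ω) = stSPG r p o γ μ x₁ y₁ (fun i => ξ i ω) k)

omit [MeasurableSpace Ξg] [MeasurableSpace Ξl] [MeasurableSpace Ξh]
  [IsProbabilityMeasure Pg] [IsProbabilityMeasure Pl] [IsProbabilityMeasure Ph] mΩ in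
lemma drawAlgebra_le_comap [MeasurableSpace Ξg] [MeasurableSpace Ξl] [MeasurableSpace Ξh]
    (c : Draw Ξg Ξl Ξh) (s : Set ((ℕ × ℕ) × Bool)) :
    drawAlgebra c ξ s ≤ MeasurableSpace.comap (fun ω i => ξ i ω) inferInstance :=
  drawAlgebra_le (mΩ := MeasurableSpace.comap (fun ω i => ξ i ω) inferInstance)
    (fun i => (measurable_pi_apply i).comp (comap_measurable fun ω i => ξ i ω)) c s

include hp ho hγ hμ hx₁ hy₁ hGl hLl hD hxy

omit mΩ in
-- Measurability is needed for the σ-algebra generated by the draws, since `τ` is assumed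
-- independent of that one.
lemma measurable_stage_residuals (c : Draw Ξg Ξl Ξh) (k : ℕ) :
    Measurable[MeasurableSpace.comap (fun ω i => ξ i ω) inferInstance] fun ω =>
      (x k ω - exactX r p γ (x k ω) (y k ω), y k ω - exactY p μ (x (k + 1) ω) (y k ω),
        x (k + 1) ω - exactX r p γ (x k ω) (y k ω)) := by
  have hmem := iterate_mem hp hγ hμ hx₁ hy₁ hxy
  have hst : ∀ k, Measurable[MeasurableSpace.comap (fun ω i => ξ i ω) inferInstance]
      fun ω => (x k ω, y k ω) := fun k => by
    simp_rw [hxy]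
    exact (measurable_stSPG (ξ := ξ) hp ho hγ hμ hx₁ hy₁ c k).mono
      (drawAlgebra_le_comap c _) le_rfl
  have hX := fun k => measurable_fst.comp (hst k)
  have hY := measurable_snd.comp (hst k)
  have hXs := fun k => (hX k).subtype_mk (h := fun ω => (hmem k ω).1)
  have hYs := hY.subtype_mk (h := fun ω => (hmem k ω).2)
  have hz := (ho.continuous_exactX hp hGl hLl hD hγ).measurable.comp ((hXs k).prodMk hYs)
  have hw := (ho.continuous_exactY hp hGl hμ).measurable.comp ((hXs (k + 1)).prodMk hYs)
  exact ((hX k).sub hz).prodMk ((hY.sub hw).prodMk ((hX (k + 1)).sub hz))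

include hσ hξ hind hlaw

/-- Expected stage gap at a stage drawn with probability proportional to `k ^ α`. -/
theorem lintegral_stageGap_random_le {α : ℝ} (hα : 1 ≤ α) (hM : 0 ≤ M) {K : ℕ} (hK : 0 < K)
    (hmom : ∀ k ∈ Finset.Icc 1 K,
      ∫⁻ ω, ∫⁻ s, ‖o.val (x (k + 1) ω) s‖ₑ ^ 2 ∂Pl ∂P ≤ ENNReal.ofReal (D ^ 2))
    {τ : Ω → ℕ} (hτ : Measurable τ) (hτξ : IndepFun τ (fun ω i => ξ i ω) P)
    (hτw : ∀ k ∈ Finset.Icc 1 K, P (τ ⁻¹' {k}) =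
      ENNReal.ofReal ((k : ℝ) ^ α / ∑ s ∈ Finset.Icc 1 K, (s : ℝ) ^ α)) :
    ∫⁻ ω, ENNReal.ofReal (stageGap r p γ μ (x (τ ω) ω) (x (τ ω + 1) ω) (y (τ ω) ω)) ∂P ≤
      ENNReal.ofReal ((α + 1) * ((2 / γ + 2 / μ + 1) * (2 * M + (6 * momentX Gl D σ
        + 6 * (2 * σ ^ 2 + 2 * D ^ 2) + 2 / γ * (6 * momentX Gl D σ)))) / K) := by
  have hmem := iterate_mem hp hγ hμ hx₁ hy₁ hxy
  obtain ⟨ω₀⟩ := nonempty_of_isProbabilityMeasure P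
  have hres := measurable_stage_residuals hp ho hγ hμ hx₁ hy₁ hGl hLl hD hxy (ξ (0, 0) ω₀)
  have hle : MeasurableSpace.comap (fun ω i => ξ i ω) inferInstance ≤ mΩ :=
    (measurable_pi_lambda _ hξ).comap_le
  have hB : 0 ≤ momentX Gl D σ := by unfold momentX; positivity
  set S : ℝ := ∑ s ∈ Finset.Icc 1 K, (s : ℝ) ^ α with hS
  set q : ℝ := 6 * momentX Gl D σ + 6 * (2 * σ ^ 2 + 2 * D ^ 2) + 2 / γ * (6 * momentX Gl D σ)
    with hq
  set C : ℝ := 2 / γ + 2 / μ + 1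
  have hq0 : 0 ≤ q := by positivity
  have hC0 : 0 < C := by positivity
  have hS0 : 0 < S := Finset.sum_pos (fun k hk => by
    have : (0 : ℝ) < k := by exact_mod_cast (Finset.mem_Icc.1 hk).1
    positivity) ⟨1, Finset.mem_Icc.2 ⟨le_rfl, hK⟩⟩
  -- By the oscillation bound this shift puts `f + c` into `[0, 2M]`.
  set c : ℝ := M - p.f x₁ y₁ with hc
  have hc0 : ∀ a ∈ p.X, ∀ b ∈ p.domh, 0 ≤ p.f a b + c := fun a ha b hb => by
    have := hp.osc_f x₁ hx₁ a ha y₁ hy₁ b hb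
    linarith
  have hc1 : ∀ a ∈ p.X, ∀ b ∈ p.domh, p.f a b + c ≤ 2 * M := fun a ha b hb => by
    have := hp.osc_f a ha x₁ hx₁ b hb y₁ hy₁
    linarith
  set V : ℕ → ℝ≥0∞ := fun k =>
    ∫⁻ ω, ENNReal.ofReal (γ / 2 * ‖x k ω - exactX r p γ (x k ω) (y k ω)‖ ^ 2) ∂P with hV
  set U : ℕ → ℝ≥0∞ := fun k =>
    ∫⁻ ω, ENNReal.ofReal (μ / 2 * ‖y k ω - exactY p μ (x (k + 1) ω) (y k ω)‖ ^ 2) ∂P with hU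
  set R : ℕ → ℝ≥0∞ := fun k =>
    ∫⁻ ω, ENNReal.ofReal (‖x (k + 1) ω - exactX r p γ (x k ω) (y k ω)‖ ^ 2) ∂P with hR
  have hsum := ENNReal_sum_rpow_mul_le (α := α) (M := 2 * M) (q := q) hα hq0 (by positivity)
    (a := fun k => ∫⁻ ω, ENNReal.ofReal (p.f (x k ω) (y k ω) + c) ∂P)
    (e := fun k => V k + U k + R k) (K := K)
    (fun k => by
      refine (lintegral_mono fun ω => ENNReal.ofReal_le_ofReal
        (hc1 _ (hmem k ω).1 _ (hmem k ω).2)).trans ?_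
      simp)
    (fun k hk => by
      have hk1 := (Finset.mem_Icc.1 hk).1
      obtain ⟨h1, h2⟩ := x_update_progress hp ho hγ hμ hx₁ hy₁ hGl hLl hD hσ hξ hind hlaw hxy
        hk1 hc0
      have h3 := y_update_progress hp ho hγ hμ hx₁ hy₁ hGl hσ hξ hind hlaw hxy hk1 hc0 (hmom k hk)
      calc _ = (∫⁻ ω, ENNReal.ofReal (p.f (x (k + 1) ω) (y (k + 1) ω) + c) ∂P + U k) + V k
            + R k := by ring
        _ ≤ (∫⁻ ω, ENNReal.ofReal (p.f (x (k + 1) ω) (y k ω) + c) ∂P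
            + ENNReal.ofReal (6 / k * (2 * σ ^ 2 + 2 * D ^ 2))) + V k
            + ENNReal.ofReal (2 / γ * (6 * momentX Gl D σ / k)) := by gcongr
        _ = (∫⁻ ω, ENNReal.ofReal (p.f (x (k + 1) ω) (y k ω) + c) ∂P + V k)
            + ENNReal.ofReal (6 / k * (2 * σ ^ 2 + 2 * D ^ 2))
            + ENNReal.ofReal (2 / γ * (6 * momentX Gl D σ / k)) := by ring
        _ ≤ (∫⁻ ω, ENNReal.ofReal (p.f (x k ω) (y k ω) + c) ∂P
            + ENNReal.ofReal (6 * momentX Gl D σ / k))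
            + ENNReal.ofReal (6 / k * (2 * σ ^ 2 + 2 * D ^ 2))
            + ENNReal.ofReal (2 / γ * (6 * momentX Gl D σ / k)) := by gcongr
        _ = _ := by
          rw [add_assoc, add_assoc, ← ENNReal.ofReal_add (by positivity) (by positivity),
            ← ENNReal.ofReal_add (by positivity) (by positivity)]
          congr 2
          rw [hq]
          ring)
  have hgap := fun k => lintegral_stageGap_le (P := P) hγ hμ ((hres k).mono hle le_rfl)
  have hrand := lintegral_random_index (τ := τ) (W := fun ω i => ξ i ω) (P := P) hτ
    (measurable_pi_lambda _ hξ) hτξ (w := fun k => (k : ℝ) ^ α / S) (fun k => by positivity)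
    (I := Finset.Icc 1 K) (by rw [← Finset.sum_div, ← hS, div_self hS0.ne']) hτw
    (φ := fun k ω => ENNReal.ofReal (stageGap r p γ μ (x k ω) (x (k + 1) ω) (y k ω)))
    (fun k => @measurable_ofReal_stageGap _ _ _ _ _ _ _ (MeasurableSpace.comap _ _) _ _ _ (hres k))
  rw [hrand]
  calc ∑ k ∈ Finset.Icc 1 K, ENNReal.ofReal ((k : ℝ) ^ α / S) *
        ∫⁻ ω, ENNReal.ofReal (stageGap r p γ μ (x k ω) (x (k + 1) ω) (y k ω)) ∂P
      ≤ ∑ k ∈ Finset.Icc 1 K, ENNReal.ofReal ((k : ℝ) ^ α / S) *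
        (ENNReal.ofReal C * (V k + U k + R k)) := by
        gcongr with k hk
        exact hgap k
    _ = ENNReal.ofReal (C / S) *
        ∑ k ∈ Finset.Icc 1 K, ENNReal.ofReal ((k : ℝ) ^ α) * (V k + U k + R k) := by
        rw [Finset.mul_sum]
        refine Finset.sum_congr rfl fun k _ => ?_
        rw [← mul_assoc, ← mul_assoc, ← ENNReal.ofReal_mul (by positivity),
          ← ENNReal.ofReal_mul (by positivity)]
        congr 2
        ring
    _ ≤ ENNReal.ofReal (C / S) * ENNReal.ofReal ((2 * M + q) * (K : ℝ) ^ α) := by gcongr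
    _ ≤ _ := by
        rw [← ENNReal.ofReal_mul (by positivity)]
        refine ENNReal.ofReal_le_ofReal ?_
        have hKR : (0 : ℝ) < K := by exact_mod_cast hK
        -- The normalization `S` is of order `K^(α + 1)`, against `K^α` from the summation by parts;
        -- the quotient gives the rate `1 / K`.
        have h1 := rpow_add_one_le_sum (α := α) (by linarith) K
        rw [← hS, Real.rpow_add hKR, Real.rpow_one] at h1
        rw [le_div_iff₀ hKR]
        have h2 : C / S * ((2 * M + q) * (K : ℝ) ^ α) * K =
            C * (2 * M + q) * ((K : ℝ) ^ α * K / S) := by ring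
        have h3 : (K : ℝ) ^ α * K / S ≤ α + 1 := by rwa [div_le_iff₀ hS0]
        rw [h2]
        calc _ ≤ C * (2 * M + q) * (α + 1) := by gcongr
          _ = _ := by ring

end Stage

/-- Integrate `B (1 + s / l)` using `E s ≤ l`. Measurability of `φ` and `s` is not required, since
the only sum split has a constant summand. -/
lemma lintegral_le_two_mul {Ω : Type*} [MeasurableSpace Ω] {P : Measure Ω}
    [IsProbabilityMeasure P] {B l : ℝ} (hB : 0 ≤ B) (hl : 0 < l) {s : Ω → ℝ} (hs : ∀ ω, 0 ≤ s ω)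
    {φ : Ω → ℝ≥0∞} (hφ : ∀ ω, φ ω ≤ ENNReal.ofReal (B * (1 + s ω / l)))
    (hI : ∫⁻ ω, ENNReal.ofReal (s ω) ∂P ≤ ENNReal.ofReal l) :
    ∫⁻ ω, φ ω ∂P ≤ ENNReal.ofReal (2 * B) := by
  have h1 : ∀ ω, ENNReal.ofReal (B * (1 + s ω / l)) =
      ENNReal.ofReal B + ENNReal.ofReal (B / l) * ENNReal.ofReal (s ω) := fun ω => by
    have := hs ω
    rw [← ENNReal.ofReal_mul (by positivity), ← ENNReal.ofReal_add hB (by positivity)]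
    congr 1
    ring
  calc ∫⁻ ω, φ ω ∂P ≤ ∫⁻ ω, (ENNReal.ofReal B + ENNReal.ofReal (B / l) * ENNReal.ofReal (s ω)) ∂P :=
        lintegral_mono fun ω => (hφ ω).trans_eq (h1 ω)
    _ = ENNReal.ofReal B + ENNReal.ofReal (B / l) * ∫⁻ ω, ENNReal.ofReal (s ω) ∂P := by
        rw [lintegral_add_left measurable_const, lintegral_const_mul' _ _ ENNReal.ofReal_ne_top,
          lintegral_const, measure_univ, mul_one]
    _ ≤ ENNReal.ofReal B + ENNReal.ofReal (B / l) * ENNReal.ofReal l := by gcongr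
    _ = ENNReal.ofReal (2 * B) := by
        rw [← ENNReal.ofReal_mul (by positivity), ← ENNReal.ofReal_add hB (by positivity),
          div_mul_cancel₀ _ hl.ne', two_mul]

/-! ### Iteration count and choice of the constants. -/

lemma stageLength_le {γ : ℝ} (hγ : 0 < γ) (k : ℕ) : (stageLength γ k : ℝ) ≤ k / γ + 2 := by
  have := Nat.ceil_lt_add_one (a := (k : ℝ) / γ) (by positivity)
  rw [stageLength]
  push_cast
  linarith

lemma sum_stageLength_le {γ μ : ℝ} (hγ : 0 < γ) (hμ : 0 < μ) (K : ℕ) :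
    ((∑ k ∈ Finset.Icc 1 K, (stageLength γ k + stageLength μ k) : ℕ) : ℝ) ≤
      (1 / γ + 1 / μ + 4) * (K : ℝ) ^ 2 := by
  push_cast
  have h : ∀ k ∈ Finset.Icc 1 K, (stageLength γ k + stageLength μ k : ℝ) ≤
      (1 / γ + 1 / μ + 4) * K := fun k hk => by
    obtain ⟨hk1, hkK⟩ := Finset.mem_Icc.1 hk
    have hk1' : (1 : ℝ) ≤ K := by exact_mod_cast hk1.trans hkK
    have hkK' : (k : ℝ) ≤ K := by exact_mod_cast hkK
    have h1 := stageLength_le hγ k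
    have h2 := stageLength_le hμ k
    have h3 : (k : ℝ) / γ ≤ K / γ := by gcongr
    have h4 : (k : ℝ) / μ ≤ K / μ := by gcongr
    have h5 : (1 / γ + 1 / μ + 4) * (K : ℝ) = K / γ + K / μ + 4 * K := by ring
    linarith
  refine (Finset.sum_le_sum h).trans_eq ?_
  simp
  ring

end

theorem corollary2 (γ μ α v Lh Gl Ll D σ M : ℝ)
    (hγ : 0 < γ) (hμ : 0 < μ) (hα : 1 ≤ α) (hv0 : 0 < v) (hv1 : v ≤ 1) (hLh : 0 < Lh)
    (hGl : 0 ≤ Gl) (hLl : 0 ≤ Ll) (hD : 0 ≤ D) (hσ : 0 ≤ σ) (hM : 0 ≤ M) :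
    ∃ c : ℝ, 0 < c ∧ ∃ C : ℝ, 0 < C ∧
      ∀ (d m : ℕ) (r : Regime) (p : InfProjection d m), p.Regular r Gl Ll Lh v D M →
      ∀ (Ξg Ξl Ξh : Type*) [MeasurableSpace Ξg] [MeasurableSpace Ξl] [MeasurableSpace Ξh]
        (Pg : Measure Ξg) (Pl : Measure Ξl) (Ph : Measure Ξh)
        [IsProbabilityMeasure Pg] [IsProbabilityMeasure Pl] [IsProbabilityMeasure Ph]
        (o : Oracles d m Ξg Ξl Ξh), o.Regular p Pg Pl Ph σ →
      ∀ x₁ ∈ p.X, ∀ y₁ ∈ p.domh,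
      ∀ (Ω : Type*) [MeasurableSpace Ω] (P : Measure Ω) [IsProbabilityMeasure P]
        (ξ : ℕ × ℕ → Ω → Draw Ξg Ξl Ξh),
        (∀ i, Measurable (ξ i)) → iIndepFun ξ P →
        (∀ i, P.map (ξ i) = (Pg.prod Pl).prod (Ph.prod Pl)) →
      ∀ (x : ℕ → Ω → Vec d) (y : ℕ → Ω → Vec m) (z : ℕ → Ω → Vec d),
        (∀ k ω, (x k ω, y k ω) = stSPG r p o γ μ x₁ y₁ (fun i => ξ i ω) k) →
        (∀ k ω, z k ω = exactX r p γ (x k ω) (y k ω)) →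
      ∀ ε : ℝ, 0 < ε → ε ≤ 1 → ∀ K : ℕ, c * ε ^ (-2 / v) ≤ (K : ℝ) →
        (∀ k ∈ Finset.Icc 1 K,
          ∫⁻ ω, ∫⁻ s, ‖o.val (x (k + 1) ω) s‖ₑ ^ 2 ∂Pl ∂P ≤ ENNReal.ofReal (D ^ 2)) →
      ∀ τ : Ω → ℕ, Measurable τ → IndepFun τ (fun ω i => ξ i ω) P →
        (∀ k ∈ Finset.Icc 1 K, P (τ ⁻¹' {k}) =
          ENNReal.ofReal ((k : ℝ) ^ α / ∑ s ∈ Finset.Icc 1 K, (s : ℝ) ^ α)) →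
        ∫⁻ ω, Metric.infEDist 0 (limitingSubdiff p.X p.F (z (τ ω) ω)) ∂P ≤ ENNReal.ofReal ε ∧
        ∫⁻ ω, ‖x (τ ω) ω - z (τ ω) ω‖ₑ ∂P ≤ ENNReal.ofReal (C * ε ^ (1 / v)) ∧
        ((K : ℝ) ≤ c * ε ^ (-2 / v) + 1 →
          ((∑ k ∈ Finset.Icc 1 K, (stageLength γ k + stageLength μ k) : ℕ) : ℝ)
            ≤ C * ε ^ (-4 / v)) := by
  set q : ℝ := 6 * momentX Gl D σ + 6 * (2 * σ ^ 2 + 2 * D ^ 2) + 2 / γ * (6 * momentX Gl D σ)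
    with hq
  set Q : ℝ := (α + 1) * ((2 / γ + 2 / μ + 1) * (2 * M + q)) with hQ
  set N : ℝ := (γ + D * Ll) + Gl * (1 + Lh * (Gl + μ) ^ v) with hN
  have hB : 0 ≤ momentX Gl D σ := by unfold momentX; positivity
  have hQ0 : 0 ≤ Q := by positivity
  have hN0 : 0 ≤ N := by positivity
  -- Chosen so that `2 N (ρ ε^(2/v))^(v/2) = N/(N + 1) · ε ≤ ε`; the `+ 1` also ensures `ρ ≤ 1`.
  set ρ : ℝ := (2 * (N + 1)) ^ (-2 / v) with hρ
  have hρ0 : 0 < ρ := by positivity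
  have hρ1 : ρ ≤ 1 :=
    Real.rpow_le_one_of_one_le_of_nonpos (by linarith)
      (div_nonpos_of_nonpos_of_nonneg (by norm_num) hv0.le)
  have hρv : ρ ^ (v / 2) = (2 * (N + 1))⁻¹ := by
    rw [hρ, ← Real.rpow_mul (by positivity), ← Real.rpow_neg_one]
    congr 1
    field_simp
  -- With this `c`, `K ≥ c ε^(-2/v)` forces `Q / K ≤ ρ ε^(2/v)`; the `+ 1` keeps `c`, and hence `K`,
  -- positive when `Q = 0`.
  set c : ℝ := (Q + 1) / ρ with hc
  have hc0 : 0 < c := by positivity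
  refine ⟨c, hc0, 2 + (1 / γ + 1 / μ + 4) * (c + 1) ^ 2, by positivity, ?_⟩
  intro d m r p hp Ξg Ξl Ξh _ _ _ Pg Pl Ph _ _ _ o ho x₁ hx₁ y₁ hy₁ Ω _ P _ ξ hξ hind hlaw x y z
    hxy hz ε hε hε1 K hK hmom τ hτ hτξ hτw
  have hmem := iterate_mem hp hγ hμ hx₁ hy₁ hxy
  have hKR : (0 : ℝ) < K := lt_of_lt_of_le (by positivity) hK
  -- The target level for the expected stage gap.
  set l : ℝ := ρ * ε ^ (2 / v) with hl
  have hl0 : 0 < l := by positivity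
  have hεv : ε ^ (2 / v) ≤ 1 := Real.rpow_le_one hε.le hε1 (by positivity)
  have hl1 : l ≤ 1 := mul_le_one₀ hρ1 (by positivity) hεv
  have hlv : l ^ (v / 2) = (2 * (N + 1))⁻¹ * ε := by
    rw [hl, Real.mul_rpow hρ0.le (by positivity), hρv, ← Real.rpow_mul hε.le,
      show 2 / v * (v / 2) = 1 by field_simp, Real.rpow_one]
  have hl2 : l ^ (1 / 2 : ℝ) ≤ ε ^ (1 / v) := by
    rw [hl, Real.mul_rpow hρ0.le (by positivity), ← Real.rpow_mul hε.le,
      show 2 / v * (1 / 2 : ℝ) = 1 / v by field_simp]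
    exact mul_le_of_le_one_left (by positivity) (Real.rpow_le_one hρ0.le hρ1 (by norm_num))
  have hQl : Q / K ≤ l := by
    rw [div_le_iff₀ hKR]
    calc Q ≤ ρ * c := by rw [hc, mul_div_cancel₀ _ hρ0.ne']; linarith
      _ = l * (c * ε ^ (-2 / v)) := by
        rw [hl, neg_div, Real.rpow_neg hε.le]
        field_simp
      _ ≤ l * K := by gcongr
  have hI := (lintegral_stageGap_random_le hp ho hγ hμ hx₁ hy₁ hGl hLl hD hσ hξ hind hlaw hxy
    hα hM (by exact_mod_cast hKR) hmom hτ hτξ hτw).trans (ENNReal.ofReal_le_ofReal hQl)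
  have hs := fun ω => stageGap_nonneg r p γ μ (x (τ ω) ω) (x (τ ω + 1) ω) (y (τ ω) ω)
  refine ⟨?_, ?_, fun hK' => ?_⟩
  · refine (lintegral_le_two_mul (B := N * l ^ (v / 2)) (by positivity) hl0 hs (fun ω => ?_)
      hI).trans (ENNReal.ofReal_le_ofReal ?_)
    · rw [hz]
      exact infEDist_limitingSubdiff_le_rpow hp ho hσ hγ hμ hv0.le hv1 hLh.le hGl hLl hD
        (hmem _ ω).1 (hmem _ ω).1 (hmem _ ω).2 hl0 hl1
    · have h1 : 2 * (N * l ^ (v / 2)) = N / (N + 1) * ε := by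
        rw [hlv]
        field_simp
      rw [h1]
      exact mul_le_of_le_one_left hε.le ((div_le_one (by positivity)).2 (by linarith))
  · refine (lintegral_le_two_mul (B := l ^ (1 / 2 : ℝ)) (by positivity) hl0 hs (fun ω => ?_)
      hI).trans (ENNReal.ofReal_le_ofReal ?_)
    · rw [hz, ← ofReal_norm]
      exact ENNReal.ofReal_le_ofReal (norm_sub_exactX_le_rpow hl0 _ _ _)
    · refine mul_le_mul ?_ hl2 (by positivity) (by positivity)
      exact le_add_of_nonneg_right (by positivity)
  · have h1 : (1 : ℝ) ≤ ε ^ (-2 / v) := Real.one_le_rpow_of_pos_of_le_one_of_nonpos hε hε1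
      (div_nonpos_of_nonpos_of_nonneg (by norm_num) hv0.le)
    have h2 : (K : ℝ) ≤ (c + 1) * ε ^ (-2 / v) := by linarith
    have h3 : (ε ^ (-2 / v)) ^ 2 = ε ^ (-4 / v) := by
      rw [← Real.rpow_natCast, ← Real.rpow_mul hε.le]
      congr 1
      push_cast
      ring
    calc _ ≤ (1 / γ + 1 / μ + 4) * (K : ℝ) ^ 2 := sum_stageLength_le hγ hμ K
      _ ≤ (1 / γ + 1 / μ + 4) * ((c + 1) * ε ^ (-2 / v)) ^ 2 := by gcongr
      _ = (1 / γ + 1 / μ + 4) * (c + 1) ^ 2 * ε ^ (-4 / v) := by rw [mul_pow, h3, mul_assoc]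
      _ ≤ _ := by
        refine mul_le_mul_of_nonneg_right ?_ (by positivity)
        exact le_add_of_nonneg_left (by norm_num)
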